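/- Let $(M,J,g)$ be an anti-Kaehler manifold: a (Hausdorff, finite dimensional) complex manifold $M$ with complex structure $J$ on its real tangent spaces and a smooth pseudo-Riemannian metric $g$ such that $g(JX,JY)=-g(X,Y)$ and $\nabla J=0$, where $\nabla$ is the Levi-Civita connection of $g$. Let $R$ be its curvature tensor, $R(X,Y)Z=\nabla_X\nabla_YZ-\nabla_Y\nabla_XZ-\nabla_{[X,Y]}Z$, and let $\nabla^{\bf c}$, $R^{\bf c}$ be the complex linear extensions of $\nabla$, $R$ to $TM\otimes{\bf C}$. Let $\gamma:{\bf C}\to M$ be a complex geodesic, that is, with $v:=\gamma_*((\partial/\partial s)_0)$, $s={\rm Re}\,z$, one has $\gamma(z)=\exp_{\gamma(0)}(({\rm Re}\,z)\,v+({\rm Im}\,z)\,Jv)$ for all $z\in{\bf C}$ (each of these values of $\exp$ being defined by a geodesic with domain ${\bf R}$). A holomorphic vector field along $\gamma$ is a map $Y$ assigning to each $z$ a vector $Y_z\in(T_{\gamma(z)}M)^{(1,0)}$ whose components $Y_i(z)$ with respect to $\partial/\partial z_1,\dots,\partial/\partial z_n$ are holomorphic in $z$, for every holomorphic chart $(z_1,\dots,z_n)$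 of $M$. Its real part is $Y_{\bf R}$, so that $Y=Y_{\bf R}-\sqrt{-1}JY_{\bf R}$. It is a complex Jacobi field along $\gamma$ if $$\nabla^{\bf c}_{\gamma_*(d/dz)}\nabla^{\bf c}_{\gamma_*(d/dz)}Y+R^{\bf c}(Y,\gamma_*(d/dz))\gamma_*(d/dz)=0 .$$ A number $z_0\in{\bf C}$ is a complex conjugate radius of $\gamma(0)$ along $\gamma$ if there is a complex Jacobi field $Y$ along $\gamma$, not identically zero, with $Y_0=0$ and $Y_{z_0}=0$. For $z_0\in{\bf C}$ put $\gamma_{z_0}(u):=\gamma(uz_0)$, $u\in{\bf R}$. The point $\gamma(z_0)=\gamma_{z_0}(1)$ is called conjugate to $\gamma(0)=\gamma_{z_0}(0)$ along $\gamma_{z_0}$ if there is a Jacobi field along $\gamma_{z_0}$, not identically zero, that vanishes at $u=0$ and at $u=1$. Then every $\gamma_{z_0}$ ($z_0\in{\bf C}$) is a geodesic, and: (i) A holomorphic vector field $Y$ along $\gamma$ is a complex Jacobi field along $\gamma$ if and only if, for every $z_0\in{\bf C}$, $u\mapsto(Y_{\bf R})_{uz_0}$ is a Jacobi field along the geodesic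 $\gamma_{z_0}$. (ii) A complex number $z_0\neq0$ is a complex conjugate radius of $\gamma(0)$ along $\gamma$ if and only if $\gamma(z_0)$ is a conjugate point of $\gamma(0)$ along the geodesic $\gamma_{z_0}$. -/

import Mathlib

open scoped Manifold ContDiff

/-!
Throughout, `M` is a complex manifold modelled on a finite dimensional complex vector space `E`.
Its underlying smooth manifold has the same charts and the model `𝓘(ℝ, E)`; the real tangent space
`TangentSpace 𝓘(ℝ, E) x` is, as always in Mathlib, the space `E` in which tangent vectors at `x` are
read through the preferred chart `chartAt E x`.
-/

namespace AntiKaehler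

noncomputable section

/-! ### Complexification of a real vector space -/

/-- The complexification `V ⊕ √-1 V` of a real vector space; `⟨a, b⟩` stands for `a + √-1 b`. -/
@[ext]
structure Complexified (V : Type*) where
  re : V
  im : V

namespace Complexified

variable {V : Type*}

instance [Zero V] : Zero (Complexified V) := ⟨⟨0, 0⟩⟩

instance [Add V] : Add (Complexified V) := ⟨fun a b => ⟨a.re + b.re, a.im + b.im⟩⟩

instance [AddCommGroup V] [Module ℝ V] : SMul ℂ (Complexified V) :=
  ⟨fun c a => ⟨c.re • a.re - c.im • a.im, c.re • a.im + c.im • a.re⟩⟩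

end Complexified

variable {E : Type*} [NormedAddCommGroup E] [NormedSpace ℂ E]
  {M : Type*} [TopologicalSpace M] [ChartedSpace E M]

/-- The real tangent space of `M` at `x`. -/
abbrev Tan (E : Type*) [NormedAddCommGroup E] [NormedSpace ℂ E]
    {M : Type*} [TopologicalSpace M] [ChartedSpace E M] (x : M) : Type _ :=
  TangentSpace 𝓘(ℝ, E) x

/-- The components of a tangent vector at `x` in the preferred chart `chartAt E x` (by Mathlib's
convention on tangent spaces, this is the identity map of `E`). -/
def comp (x : M) : Tan E x ≃L[ℝ] E := ContinuousLinearEquiv.refl ℝ E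

/-- The complex structure `J` on the real tangent space at `x`. -/
def J (x : M) (v : Tan E x) : Tan E x :=
  (comp x).symm (Complex.I • comp x v)

/-- The differential at `x` of a chart `φ`, applied to a tangent vector `v` at `x`: the coordinates
of `v` in the chart `φ`. -/
def coord (φ : OpenPartialHomeomorph M E) (x : M) (v : Tan E x) : E :=
  mfderiv 𝓘(ℝ, E) 𝓘(ℝ, E) φ x v

/-! ### Metric, Levi-Civita connection and curvature -/

/-- A field of bilinear forms on the real tangent spaces of `M`. -/
abbrev BilinField (E : Type*) [NormedAddCommGroup E] [NormedSpace ℂ E]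
    (M : Type*) [TopologicalSpace M] [ChartedSpace E M] : Type _ :=
  (x : M) → Tan E x →L[ℝ] Tan E x →L[ℝ] ℝ

/-- The components of `g` in the preferred chart at `x₀`, at the point `y` of its target. -/
def metricInChart (g : BilinField E M) (x₀ : M) (y : E) : E →L[ℝ] E →L[ℝ] ℝ :=
  ContinuousLinearMap.bilinearComp
    (show E →L[ℝ] E →L[ℝ] ℝ from g ((chartAt E x₀).symm y))
    (show E →L[ℝ] E from mfderiv 𝓘(ℝ, E) 𝓘(ℝ, E) (chartAt E x₀).symm y)
    (show E →L[ℝ] E from mfderiv 𝓘(ℝ, E) 𝓘(ℝ, E) (chartAt E x₀).symm y)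

/-- The right hand side of the Koszul formula for coordinate vector fields:
`w ↦ (∂ᵤ g(v, w) + ∂ᵥ g(u, w) - ∂_w g(u, v)) / 2`. -/
def koszul (g : BilinField E M) (x₀ : M) (y u v : E) : E →L[ℝ] ℝ :=
  (1 / 2 : ℝ) • (fderiv ℝ (metricInChart g x₀) y u v + fderiv ℝ (metricInChart g x₀) y v u
    - ((fderiv ℝ (metricInChart g x₀) y).flip u).flip v)

/-- The Christoffel symbols `Γ(u, v) = ∇ᵤ v` (`u`, `v` constant in the chart) of the Levi-Civita
connection in the preferred chart at `x₀`, at the point `y`: the vector whose product with every `w`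
is given by the Koszul formula. -/
def christoffel (g : BilinField E M) (x₀ : M) (y u v : E) : E :=
  (metricInChart g x₀ y).inverse (koszul g x₀ y u v)

/-- The coordinate expression of a vector field on `M` in the preferred chart at `x₀`. -/
def fieldInChart (V : (x : M) → Tan E x) (x₀ : M) (y : E) : E :=
  coord (chartAt E x₀) ((chartAt E x₀).symm y) (V ((chartAt E x₀).symm y))

/-- The Levi-Civita covariant derivative `(∇ᵤ V)(x)` of a vector field on `M`. -/
def covDeriv (g : BilinField E M) (V : (x : M) → Tan E x) (x : M) (u : Tan E x) : Tan E x :=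
  (comp x).symm (fderiv ℝ (fieldInChart V x) (chartAt E x x) (comp x u)
    + christoffel g x (chartAt E x x) (comp x u) (comp x (V x)))

/-- The components of the curvature tensor in the preferred chart at `x₀`, at the point `y`:
`∂ᵤ Γ(v, w) - ∂ᵥ Γ(u, w) + Γ(u, Γ(v, w)) - Γ(v, Γ(u, w))`. -/
def curvatureInChart (g : BilinField E M) (x₀ : M) (y u v w : E) : E :=
  fderiv ℝ (fun y' => christoffel g x₀ y' v w) y u
    - fderiv ℝ (fun y' => christoffel g x₀ y' u w) y v
    + christoffel g x₀ y u (christoffel g x₀ y v w)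
    - christoffel g x₀ y v (christoffel g x₀ y u w)

/-- The curvature tensor `R(u, v)w = ∇ᵤ∇ᵥw - ∇ᵥ∇ᵤw - ∇_[u,v] w` of the Levi-Civita connection. -/
def curvature (g : BilinField E M) (x : M) (u v w : Tan E x) : Tan E x :=
  (comp x).symm
    (curvatureInChart g x (chartAt E x x) (comp x u) (comp x v) (comp x w))

/-- `(M, J, g)` is an anti-Kaehler manifold: `g` is a pseudo-Riemannian metric (smooth, symmetric
and nondegenerate) with `g(Ju, Jv) = -g(u, v)` and `∇J = 0`, that is `∇ᵤ(JV) = J∇ᵤV`. -/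
structure IsAntiKaehler (g : BilinField E M) : Prop where
  smooth : ∀ x₀ : M, ContDiffOn ℝ ∞ (metricInChart g x₀) (chartAt E x₀).target
  symm : ∀ (x : M) (u v : Tan E x), g x u v = g x v u
  nondegenerate : ∀ (x : M) (u : Tan E x), (∀ v, g x u v = 0) → u = 0
  antiHermitian : ∀ (x : M) (u v : Tan E x), g x (J x u) (J x v) = -g x u v
  parallel : ∀ (V : (x : M) → Tan E x) (x : M),
    DifferentiableAt ℝ (fieldInChart V x) (chartAt E x x) →
      ∀ u : Tan E x, covDeriv g (fun x' => J x' (V x')) x u = J x (covDeriv g V x u)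

/-! ### Vector fields along maps, geodesics, Jacobi fields -/

section Along

variable {X : Type*} [NormedAddCommGroup X] [NormedSpace ℝ X]

/-- The vector field `V` along `f` is smooth: it has smooth coordinates in the charts of `M`. -/
def IsSmoothAlong (f : X → M) (V : (q : X) → Tan E (f q)) : Prop :=
  ∀ x₀ : M, ContDiffOn ℝ ∞ (fun q => coord (chartAt E x₀) (f q) (V q))
    (f ⁻¹' (chartAt E x₀).source)

/-- The differential `f_* ξ` of a map `f : X → M` at `p`. -/
def push (E : Type*) [NormedAddCommGroup E] [NormedSpace ℂ E]
    {M : Type*} [TopologicalSpace M] [ChartedSpace E M]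
    (f : X → M) (p : X) (ξ : X) : Tan E (f p) :=
  mfderiv 𝓘(ℝ, X) 𝓘(ℝ, E) f p ξ

/-- The Levi-Civita covariant derivative `∇_{f_* ξ} V` at `p` of a vector field `V` along `f`. -/
def covDerivAlong (g : BilinField E M) (f : X → M) (V : (q : X) → Tan E (f q)) (p ξ : X) :
    Tan E (f p) :=
  (comp (f p)).symm (fderiv ℝ (fun q => coord (chartAt E (f p)) (f q) (V q)) p ξ
    + christoffel g (f p) (chartAt E (f p) (f p)) (comp (f p) (push E f p ξ)) (comp (f p) (V p)))

end Along

/-- The velocity of a curve. -/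
def velocity (E : Type*) [NormedAddCommGroup E] [NormedSpace ℂ E]
    {M : Type*} [TopologicalSpace M] [ChartedSpace E M] (c : ℝ → M) (u : ℝ) : Tan E (c u) :=
  push E c u 1

/-- `c` is a geodesic. -/
def IsGeodesic (g : BilinField E M) (c : ℝ → M) : Prop :=
  ContMDiff 𝓘(ℝ, ℝ) 𝓘(ℝ, E) ∞ c ∧ ∀ u : ℝ, covDerivAlong g c (velocity E c) u 1 = 0

/-- `V` is a Jacobi field along `c`: `∇_{c'}∇_{c'}V + R(V, c')c' = 0`. -/
def IsJacobiField (g : BilinField E M) (c : ℝ → M) (V : (u : ℝ) → Tan E (c u)) : Prop :=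
  IsSmoothAlong c V ∧
    ∀ u : ℝ, covDerivAlong g c (fun u' => covDerivAlong g c V u' 1) u 1
      + curvature g (c u) (V u) (velocity E c u) (velocity E c u) = 0

/-- `c b` is a conjugate point of `c a` along the geodesic `c`. -/
def IsConjugateAlong (g : BilinField E M) (c : ℝ → M) (a b : ℝ) : Prop :=
  ∃ V : (u : ℝ) → Tan E (c u), IsJacobiField g c V ∧ (∃ u, V u ≠ 0) ∧ V a = 0 ∧ V b = 0

/-- `exp_p v = q`: some geodesic starts at `p` with velocity `v` and is at `q` at time `1`. -/
def IsExp (g : BilinField E M) (p : M) (v : Tan E p) (q : M) : Prop :=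
  ∃ c : ℝ → M, IsGeodesic g c ∧
    (⟨c 0, velocity E c 0⟩ : TangentBundle 𝓘(ℝ, E) M) = ⟨p, v⟩ ∧ c 1 = q

/-! ### Complex geodesics and complex Jacobi fields -/

/-- `γ : ℂ → M` is a complex geodesic: `γ(z) = exp_{γ(0)}((Re z) v + (Im z) J v)`, where
`v = γ_*((∂/∂s)₀)`, `s = Re z`. -/
def IsComplexGeodesic (g : BilinField E M) (γ : ℂ → M) : Prop :=
  ∀ z : ℂ, IsExp g (γ 0) (z.re • push E γ 0 1 + z.im • J (γ 0) (push E γ 0 1)) (γ z)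

/-- `Z` is a complex tangent vector of type `(1,0)`: `Jᶜ Z = √-1 Z`. -/
def IsType10 {x : M} (Z : Complexified (Tan E x)) : Prop :=
  (⟨J x Z.re, J x Z.im⟩ : Complexified (Tan E x)) = Complex.I • Z

/-- The components `(dz₁(Z), …, dzₙ(Z))` of a complex tangent vector in a holomorphic chart
`φ = (z₁, …, zₙ)`; here `dzᵢ` is extended complex linearly, so that for `Z` of type `(1,0)` one has
`Z = ∑ᵢ dzᵢ(Z) ∂/∂zᵢ`. -/
def holCoord (φ : OpenPartialHomeomorph M E) (x : M) (Z : Complexified (Tan E x)) : E :=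
  coord φ x Z.re + Complex.I • coord φ x Z.im

/-- `Y : ℂ → (TM)^{(1,0)}` is a holomorphic vector field along `γ`. -/
def IsHolomorphicAlong (γ : ℂ → M) (Y : (z : ℂ) → Complexified (Tan E (γ z))) : Prop :=
  (∀ z, IsType10 (Y z)) ∧
    ∀ φ ∈ IsManifold.maximalAtlas 𝓘(ℂ, E) ω M,
      DifferentiableOn ℂ (fun z => holCoord φ (γ z) (Y z)) (γ ⁻¹' φ.source)

/-- The complex vector field `d/dz = (∂/∂s - √-1 ∂/∂t) / 2` on `ℂ`, `z = s + √-1 t`. -/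
def ddz : Complexified ℂ := (1 / 2 : ℂ) • ⟨1, -Complex.I⟩

/-- The differential of `γ`, extended complex linearly. -/
def pushC (E : Type*) [NormedAddCommGroup E] [NormedSpace ℂ E]
    {M : Type*} [TopologicalSpace M] [ChartedSpace E M]
    (γ : ℂ → M) (z : ℂ) (ζ : Complexified ℂ) : Complexified (Tan E (γ z)) :=
  ⟨push E γ z ζ.re, push E γ z ζ.im⟩

/-- The complexification of the Levi-Civita connection, along `γ`: the complex bilinear extension
of `(ξ, V) ↦ ∇_{γ_* ξ} V`. -/
def covDerivAlongC (g : BilinField E M) (γ : ℂ → M) (Y : (z : ℂ) → Complexified (Tan E (γ z)))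
    (z : ℂ) (ζ : Complexified ℂ) : Complexified (Tan E (γ z)) :=
  ⟨covDerivAlong g γ (fun q => (Y q).re) z ζ.re - covDerivAlong g γ (fun q => (Y q).im) z ζ.im,
   covDerivAlong g γ (fun q => (Y q).im) z ζ.re + covDerivAlong g γ (fun q => (Y q).re) z ζ.im⟩

/-- The complex trilinear extension of the curvature tensor. -/
def curvatureC (g : BilinField E M) (x : M) (A B C : Complexified (Tan E x)) :
    Complexified (Tan E x) :=
  ⟨curvature g x A.re B.re C.re - curvature g x A.re B.im C.im
      - curvature g x A.im B.re C.im - curvature g x A.im B.im C.re,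
   curvature g x A.re B.re C.im + curvature g x A.re B.im C.re
      + curvature g x A.im B.re C.re - curvature g x A.im B.im C.im⟩

/-- `Y` is a complex Jacobi field along `γ`. -/
def IsComplexJacobiField (g : BilinField E M) (γ : ℂ → M)
    (Y : (z : ℂ) → Complexified (Tan E (γ z))) : Prop :=
  IsHolomorphicAlong γ Y ∧
    ∀ z : ℂ, covDerivAlongC g γ (fun z' => covDerivAlongC g γ Y z' ddz) z ddz
      + curvatureC g (γ z) (Y z) (pushC E γ z ddz) (pushC E γ z ddz) = 0

/-- `z₀` is a complex conjugate radius of `γ(0)` along `γ`. -/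
def IsComplexConjugateRadius (g : BilinField E M) (γ : ℂ → M) (z₀ : ℂ) : Prop :=
  ∃ Y : (z : ℂ) → Complexified (Tan E (γ z)),
    IsComplexJacobiField g γ Y ∧ (∃ z, Y z ≠ 0) ∧ Y 0 = 0 ∧ Y z₀ = 0

end

end AntiKaehler

open scoped Manifold ContDiff Topology
open Set Filter Metric

set_option linter.unusedSectionVars false

/-! An anti-Kaehler metric is the real part of a holomorphic metric, so the geodesic and Jacobi
equations are restrictions to real lines of holomorphic equations in complex time.

Holomorphy of the connection. Since the connection is torsion free and `∇J = 0`, the Christoffel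
symbols in a holomorphic chart are complex bilinear (`christoffel_I_right`). Compatibility with the
metric then gives Cauchy-Riemann relations for the first derivatives of `g`, and differentiating the
Koszul identity shows that the symbols depend holomorphically on the point
(`differentiableAt_christoffel`). Hence the curvature is complex trilinear (`curvature_cmul`).

Holomorphy of `γ`. Each value of `γ` comes from its own geodesic; rescaling and uniqueness show that
all `u ↦ γ(u z)` are geodesics. Solving the geodesic equation in complex time gives local
holomorphic maps whose restrictions to real lines through the origin are geodesics. Uniqueness of
geodesics, and the identity theorem along a ray, identify them with `γ`
(`IsComplexGeodesic.isHolAt`).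

Part (i). Let `X` be the real part of a holomorphic field along `γ`. Then `∇_ξ X = ξ ∇_1 X`, with
complex scalars acting through `J`. The complex Jacobi expression is therefore the (1,0)-vector with
real part `jacobiOp g γ X`, while the real Jacobi expression along `γ_{z₀}` is `z₀²` times the same
vector (`isJacobiField_ray_iff`). Letting `z₀` vary gives the equivalence.

Part (ii). In charts the complex Jacobi equation is a linear first order system with holomorphic
coefficients. Its local solutions glue to global ones because `ℂ` is simply connected
(`exists_flat_section`, `exists_isJacobiPairAt`). A real Jacobi field along a ray solves the
restricted system, so it is determined by its initial data (`isJacobiField_ray_unique`). Hence every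
real Jacobi field along `γ_{z₀}` that vanishes at 0 is the restriction of a complex one, and a
complex one that vanishes on a whole ray is zero. -/

namespace AntiKaehler

/-! ### Holomorphic ordinary differential equations -/

section HolomorphicODE

variable {F : Type*} [NormedAddCommGroup F] [NormedSpace ℂ F] [CompleteSpace F]

/-- Existence of local holomorphic solutions of `y' = f(y)` for holomorphic `f`. -/
theorem exists_hasDerivAt_of_lipschitzOnWith {f : F → F} {c : F} {U : Set F} (hU : U ∈ 𝓝 c)
    (hf : DifferentiableOn ℂ f U) {K : NNReal} (hK : LipschitzOnWith K f U) (z₀ : ℂ) :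
    ∃ ε > 0, ∃ y : ℂ → F, y z₀ = c ∧ ∀ z ∈ ball z₀ ε, y z ∈ U ∧ HasDerivAt y (f (y z)) z := by
  obtain ⟨r, hr, hrU⟩ := Metric.mem_nhds_iff.1 hU
  have hcU : c ∈ U := hrU (mem_ball_self hr)
  set C : ℝ := ‖f c‖ + K * r with hC
  have hC0 : 0 ≤ C := by positivity
  have hfC : ∀ x ∈ closedBall c (r / 2), ‖f x‖ ≤ C := by
    intro x hx
    have hxU : x ∈ U := hrU (closedBall_subset_ball (by linarith) hx)
    have h1 := hK.dist_le_mul x hxU c hcU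
    have h2 : dist x c ≤ r := (mem_closedBall.1 hx).trans (by linarith)
    have h3 : ‖f x‖ ≤ ‖f c‖ + ‖f x - f c‖ := by
      simpa using norm_add_le (f c) (f x - f c)
    rw [dist_eq_norm] at h1
    have h4 : (K : ℝ) * dist x c ≤ K * r := by gcongr
    linarith
  -- The first bound keeps the Picard iterates in the closed ball of radius `r / 2`; the second
  -- makes the iteration contract by the factor 1/2. The added 1 keeps the denominators positive.
  set ε : ℝ := min (r / (2 * (C + 1))) (1 / (2 * (K + 1))) with hε
  have hε0 : 0 < ε := by
    have : (0 : ℝ) ≤ K := K.2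
    positivity
  have hεC : C * ε ≤ r / 2 := by
    have h1 : ε ≤ r / (2 * (C + 1)) := min_le_left _ _
    calc C * ε ≤ (C + 1) * (r / (2 * (C + 1))) := by gcongr; linarith
      _ = r / 2 := by field_simp
  have hεK : K * ε ≤ 1 / 2 := by
    have h1 : ε ≤ 1 / (2 * (K + 1)) := min_le_right _ _
    calc (K : ℝ) * ε ≤ (K + 1) * (1 / (2 * (K + 1))) := by gcongr; linarith
      _ = 1 / 2 := by
        have : (0 : ℝ) ≤ K := K.2
        field_simp
  set B := ball z₀ ε with hB
  have hz₀ : z₀ ∈ B := mem_ball_self hε0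
  have hBo : IsOpen B := isOpen_ball
  have hsub : closedBall c (r / 2) ⊆ U := (closedBall_subset_ball (by linarith)).trans hrU
  let P : (ℂ → F) → Prop := fun y =>
    y z₀ = c ∧ DifferentiableOn ℂ y B ∧ ∀ z ∈ B, y z ∈ closedBall c (r / 2)
  -- One Picard step: in place of an integral, take the holomorphic primitive of `f ∘ y`, which
  -- exists on a disc, normalised to have the value `c` at `z₀`.
  have step : ∀ y : {y // P y}, ∃ y' : {y // P y}, ∀ z ∈ B, HasDerivAt y'.1 (f (y.1 z)) z := by
    rintro ⟨y, hy0, hyd, hyb⟩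
    have hfy : DifferentiableOn ℂ (fun z => f (y z)) B :=
      hf.comp hyd fun z hz => hsub (hyb z hz)
    obtain ⟨y', hy'0, hy'⟩ := hfy.isExactOn_ball.with_val_at z₀ c
    refine ⟨⟨y', hy'0, fun z hz => (hy' z hz).differentiableAt.differentiableWithinAt,
      fun z hz => ?_⟩, hy'⟩
    have := (convex_ball z₀ ε).norm_image_sub_le_of_norm_hasDerivWithin_le
      (fun x hx => (hy' x hx).hasDerivWithinAt) (fun x hx => hfC _ (hyb x hx)) hz₀ hz
    rw [mem_closedBall, dist_eq_norm, ← hy'0]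
    refine this.trans (le_trans ?_ hεC)
    have h5 : ‖z - z₀‖ < ε := by simpa [hB, dist_eq_norm] using hz
    gcongr
  choose T hT using step
  let s : ℕ → {y // P y} := fun n => T^[n] ⟨fun _ => c, rfl, differentiableOn_const c,
    fun _ _ => mem_closedBall_self (by linarith)⟩
  have hs : ∀ n, ∀ z ∈ B, HasDerivAt (s (n + 1)).1 (f ((s n).1 z)) z := by
    intro n z hz
    have : s (n + 1) = T (s n) := Function.iterate_succ_apply' _ _ _
    rw [this]
    exact hT _ z hz
  have hd : ∀ n, ∀ z ∈ B, dist ((s n).1 z) ((s (n + 1)).1 z) ≤ r * (1 / 2) ^ n := by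
    intro n
    induction n with
    | zero =>
      intro z hz
      have h1 := mem_closedBall.1 ((s 0).2.2.2 z hz)
      have h2 := mem_closedBall'.1 ((s 1).2.2.2 z hz)
      have := dist_triangle ((s 0).1 z) c ((s 1).1 z)
      simp only [pow_zero, mul_one, zero_add]
      linarith
    | succ n ih =>
      intro z hz
      have := (convex_ball z₀ ε).norm_image_sub_le_of_norm_hasDerivWithin_le
        (f := fun z => (s (n + 1)).1 z - (s (n + 1 + 1)).1 z) (C := K * (r * (1 / 2) ^ n))
        (fun x hx => ((hs n x hx).sub (hs (n + 1) x hx)).hasDerivWithinAt) (fun x hx => by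
          have h1 := hK.dist_le_mul _ (hsub ((s n).2.2.2 x hx)) _ (hsub ((s (n + 1)).2.2.2 x hx))
          rw [dist_eq_norm] at h1
          refine h1.trans ?_
          have := ih x hx
          gcongr) hz₀ hz
      have h6 : (s (n + 1)).1 z₀ = (s (n + 1 + 1)).1 z₀ :=
        (s (n + 1)).2.1.trans (s (n + 1 + 1)).2.1.symm
      rw [h6, sub_self, sub_zero] at this
      rw [dist_eq_norm]
      refine this.trans ?_
      have h5 : ‖z - z₀‖ < ε := by simpa [hB, dist_eq_norm] using hz
      calc K * (r * (1 / 2) ^ n) * ‖z - z₀‖ ≤ K * (r * (1 / 2) ^ n) * ε := by gcongr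
        _ = (K * ε) * (r * (1 / 2) ^ n) := by ring
        _ ≤ (1 / 2) * (r * (1 / 2) ^ n) := by gcongr
        _ = r * (1 / 2) ^ (n + 1) := by ring
  have hlim : ∀ z, ∃ l, z ∈ B → Tendsto (fun n => (s n).1 z) atTop (𝓝 l) := by
    intro z
    by_cases hz : z ∈ B
    · obtain ⟨l, hl⟩ := cauchySeq_tendsto_of_complete
        (cauchySeq_of_le_geometric (1 / 2) r (by norm_num) fun n => hd n z hz)
      exact ⟨l, fun _ => hl⟩
    · exact ⟨0, fun h => absurd h hz⟩
  choose Y hY using hlim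
  have hunif : TendstoUniformlyOn (fun n => (s n).1) Y atTop B := by
    rw [Metric.tendstoUniformlyOn_iff]
    intro δ hδ
    have h0 : Tendsto (fun n : ℕ => r * (1 / 2 : ℝ) ^ n / (1 - 1 / 2)) atTop (𝓝 0) := by
      have := ((tendsto_pow_atTop_nhds_zero_of_lt_one (r := (1 / 2 : ℝ)) (by norm_num)
        (by norm_num)).const_mul r).div_const (1 - 1 / 2)
      simpa using this
    filter_upwards [h0.eventually (gt_mem_nhds hδ)] with n hn z hz
    rw [dist_comm]
    exact (dist_le_of_le_geometric_of_tendsto (1 / 2) r (by norm_num) (fun n => hd n z hz)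
      (hY z hz) n).trans_lt hn
  have hloc := hunif.tendstoLocallyUniformlyOn
  have hdiff : ∀ᶠ n in atTop, DifferentiableOn ℂ (s n).1 B := Eventually.of_forall fun n =>
    (s n).2.2.1
  have hYd : DifferentiableOn ℂ Y B := hloc.differentiableOn hdiff hBo
  have hYb : ∀ z ∈ B, Y z ∈ closedBall c (r / 2) := fun z hz =>
    isClosed_closedBall.mem_of_tendsto (hY z hz) (Eventually.of_forall fun n => (s n).2.2.2 z hz)
  refine ⟨ε, hε0, Y, ?_, fun z hz => ⟨hsub (hYb z hz), ?_⟩⟩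
  · refine tendsto_nhds_unique (hY z₀ hz₀) ?_
    simp only [(s _).2.1]
    exact tendsto_const_nhds
  · have h1 := (hYd.differentiableAt (hBo.mem_nhds hz)).hasDerivAt
    -- By Weierstrass the derivatives of the iterates converge too, so the recursion passes to the
    -- limit and becomes the differential equation.
    have h2 : Tendsto (fun n => deriv (s n).1 z) atTop (𝓝 (deriv Y z)) :=
      (hloc.deriv hdiff hBo).tendsto_at hz
    have h3 : Tendsto (fun n => f ((s n).1 z)) atTop (𝓝 (f (Y z))) := by
      have hc : ContinuousAt f (Y z) :=
        (hK.continuousOn.continuousAt (mem_of_superset (isOpen_ball.mem_nhds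
          (closedBall_subset_ball (by linarith) (hYb z hz))) hrU))
      exact hc.tendsto.comp (hY z hz)
    have h4 : (fun n => deriv (s (n + 1)).1 z) = fun n => f ((s n).1 z) :=
      funext fun n => (hs n z hz).deriv
    have h5 := h2.comp (tendsto_add_atTop_nat 1)
    rw [show (fun n => deriv (s n).1 z) ∘ (fun a => a + 1) = fun n => f ((s n).1 z) from h4] at h5
    rwa [tendsto_nhds_unique h5 h3] at h1

end HolomorphicODE

/-! ### Real smooth functions that are complex differentiable -/

section RealComplex

variable {E F : Type*} [NormedAddCommGroup E] [NormedSpace ℂ E]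
  [NormedAddCommGroup F] [NormedSpace ℂ F]

/-- Cauchy-Riemann: a real linear derivative commuting with `I` is complex linear. -/
theorem differentiableAt_complex_of_fderiv_real {f : E → F} {x : E}
    (hf : DifferentiableAt ℝ f x)
    (hI : ∀ w, fderiv ℝ f x (Complex.I • w) = Complex.I • fderiv ℝ f x w) :
    DifferentiableAt ℂ f x := by
  rw [differentiableAt_iff_restrictScalars ℝ hf]
  refine ⟨⟨⟨(fderiv ℝ f x).toLinearMap.toAddHom, fun c w => ?_⟩, (fderiv ℝ f x).cont⟩, ?_⟩
  · show fderiv ℝ f x (c • w) = c • fderiv ℝ f x w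
    have h1 : c • w = c.re • w + c.im • (Complex.I • w) := by
      conv_lhs => rw [← Complex.re_add_im c]
      rw [add_smul, mul_smul]; rfl
    have h2 : c • fderiv ℝ f x w = c.re • fderiv ℝ f x w + c.im • (Complex.I • fderiv ℝ f x w) := by
      conv_lhs => rw [← Complex.re_add_im c]
      rw [add_smul, mul_smul]; rfl
    rw [h1, h2, map_add, map_smul, map_smul, hI]
  · rfl

theorem fderiv_real_eq {f : E → F} {x : E} (hf : DifferentiableAt ℂ f x) (w : E) :
    fderiv ℝ f x w = fderiv ℂ f x w := by
  rw [hf.fderiv_restrictScalars ℝ]; rfl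

theorem fderiv_real_smul {f : E → F} {x : E} (hf : DifferentiableAt ℂ f x) (c : ℂ) (w : E) :
    fderiv ℝ f x (c • w) = c • fderiv ℝ f x w := by
  rw [fderiv_real_eq hf, fderiv_real_eq hf, map_smul]

theorem fderiv_fderiv_symm {E F : Type*} [NormedAddCommGroup E] [NormedSpace ℝ E]
    [NormedAddCommGroup F] [NormedSpace ℝ F] {f : E → F} {x : E} (hf : ContDiffAt ℝ 2 f x)
    (u v : E) : fderiv ℝ (fun y => fderiv ℝ f y u) x v = fderiv ℝ (fun y => fderiv ℝ f y v) x u := by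
  have hd : DifferentiableAt ℝ (fderiv ℝ f) x :=
    (hf.fderiv_right (m := 1) le_rfl).differentiableAt one_ne_zero
  rw [fderiv_clm_apply hd (differentiableAt_const u), fderiv_clm_apply hd (differentiableAt_const v)]
  simpa using (hf.isSymmSndFDerivAt (by simp)).eq v u

/-- The directional derivatives of a real smooth, complex differentiable function are complex
differentiable. -/
theorem differentiableOn_fderiv_apply {f : E → F} {T : Set E} (hT : IsOpen T)
    (hr : ContDiffOn ℝ 2 f T) (hc : DifferentiableOn ℂ f T) (u : E) :
    DifferentiableOn ℂ (fun y => fderiv ℝ f y u) T := by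
  intro y hy
  have hy' := hr.contDiffAt (hT.mem_nhds hy)
  have hd : DifferentiableAt ℝ (fderiv ℝ f) y :=
    (hy'.fderiv_right (m := 1) le_rfl).differentiableAt one_ne_zero
  refine (differentiableAt_complex_of_fderiv_real (hd.clm_apply (differentiableAt_const u))
    fun w => ?_).differentiableWithinAt
  -- Exchanging the derivatives puts the direction `I • w` on the inner one, where complex
  -- differentiability of `f` extracts the factor `I`.
  rw [fderiv_fderiv_symm hy' u, fderiv_fderiv_symm hy' u]
  have : (fun y => fderiv ℝ f y (Complex.I • w)) =ᶠ[𝓝 y] fun y => Complex.I • fderiv ℝ f y w := by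
    filter_upwards [hT.mem_nhds hy] with x hx
    exact fderiv_real_smul (hc.differentiableAt (hT.mem_nhds hx)) _ _
  rw [this.fderiv_eq, fderiv_fun_const_smul (hd.clm_apply (differentiableAt_const w))]
  rfl

end RealComplex

/-! ### Global sections of local systems on `ℂ` -/

/-- If `Θ a z`, `z ∈ ball a (r a)`, are local trivializations of the product `ℂ × F` with locally
constant transition maps, then there is a global flat section with prescribed initial value. -/
theorem exists_flat_section {F : Type*} (r : ℂ → ℝ) (hr : ∀ a, 0 < r a) (Θ : ℂ → ℂ → F ≃ F)
    (hΘ : ∀ a b, ∀ z ∈ ball a (r a) ∩ ball b (r b), ∀ w ∈ ball a (r a) ∩ ball b (r b), ∀ x,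
      Θ b z ((Θ a z).symm x) = Θ b w ((Θ a w).symm x)) (s₀ : F) :
    ∃ s : ℂ → F, s 0 = s₀ ∧
      ∀ a, ∀ z ∈ ball a (r a), ∀ w ∈ ball a (r a), Θ a z (s z) = Θ a w (s w) := by
  -- With the discrete topology on the fibre, locally constant transition maps are continuous, and
  -- the bundle they define is a covering of `ℂ`.
  let _ : TopologicalSpace F := ⊥
  have : DiscreteTopology F := ⟨rfl⟩
  let Z : FiberBundleCore ℂ ℂ F :=
    { baseSet := fun a => ball a (r a)
      isOpen_baseSet := fun a => isOpen_ball
      indexAt := id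
      mem_baseSet_at := fun x => mem_ball_self (hr x)
      coordChange := fun a b z x => Θ b z ((Θ a z).symm x)
      coordChange_self := by simp
      continuousOn_coordChange := by
        intro a b
        by_cases hne : (ball a (r a) ∩ ball b (r b)).Nonempty
        · obtain ⟨w, hw⟩ := hne
          have h : Continuous fun p : ℂ × F => Θ b w ((Θ a w).symm p.2) :=
            (continuous_of_discreteTopology (f := fun x => Θ b w ((Θ a w).symm x))).comp
              continuous_snd
          exact h.continuousOn.congr fun p hp => hΘ a b p.1 hp.1 w hw p.2
        · rw [not_nonempty_iff_eq_empty.1 hne, empty_prod]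
          exact continuousOn_empty _
      coordChange_comp := by simp }
  have hcov : IsCoveringMap (Bundle.TotalSpace.proj : Z.TotalSpace → ℂ) :=
    FiberBundle.isCoveringMap (F := F) (E := Z.Fiber)
  -- Since `ℂ` is simply connected, its identity map lifts to a section through the chosen point
  -- over 0.
  obtain ⟨S, ⟨hS0, hSp⟩, -⟩ := hcov.existsUnique_continuousMap_lifts
    (ContinuousMap.id ℂ) 0 ⟨0, (Θ 0 0 s₀ : F)⟩ rfl
  have hproj : ∀ z, (S z).1 = z := fun z => congrFun hSp z
  refine ⟨fun z => (Θ z z).symm ((Z.localTriv z (S z)).2), ?_, ?_⟩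
  · have : S (0 : ℂ) = ⟨0, (Θ 0 0 s₀ : F)⟩ := hS0
    simp only [this]
    rw [Equiv.symm_apply_eq]
    show Θ 0 0 ((Θ 0 0).symm (Θ 0 0 s₀)) = _
    simp
  · intro a z hz w hw
    have hcont : ContinuousOn (fun z => (Z.localTriv a (S z)).2) (ball a (r a)) := by
      refine continuous_snd.comp_continuousOn ?_
      refine (Z.localTriv a).continuousOn_toFun.comp S.continuous.continuousOn fun z hz => ?_
      rw [(Z.localTriv a).source_eq]
      show (S z).1 ∈ ball a (r a)
      rwa [hproj]
    have key : ∀ z ∈ ball a (r a),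
        Θ a z ((Θ z z).symm ((Z.localTriv z (S z)).2)) = (Z.localTriv a (S z)).2 := by
      intro z hz
      rw [Z.localTriv_apply, Z.localTriv_apply, hproj]
      show Θ a z ((Θ z z).symm (Θ z z ((Θ z z).symm _))) = Θ a z ((Θ z z).symm _)
      simp
    simp only
    rw [key z hz, key w hw]
    -- In one trivialization the lift is a continuous map from a connected ball to a discrete space,
    -- hence constant.
    exact (convex_ball a (r a)).isPreconnected.constant_of_mapsTo (T := univ)
      (isDiscrete_univ_iff.2 inferInstance) hcont
      (mapsTo_univ _ _) hz hw

/-! ### Charts and tangent vectors -/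

section Charts

variable {E : Type*} [NormedAddCommGroup E] [NormedSpace ℂ E]
  {M : Type*} [TopologicalSpace M] [ChartedSpace E M]

/-- Tangent vectors at `f p` are by convention read in the chart at `f p`. Where differentiability
fails both sides are zero, so continuity is enough. -/
theorem mfderiv_eq_fderiv_chart {X : Type*} [NormedAddCommGroup X] [NormedSpace ℝ X] {f : X → M}
    {p : X} (hf : ContinuousAt f p) (ξ : X) :
    (mfderiv 𝓘(ℝ, X) 𝓘(ℝ, E) f p ξ : E) = fderiv ℝ (fun q => chartAt E (f p) (f q)) p ξ := by
  have hw : writtenInExtChartAt 𝓘(ℝ, X) 𝓘(ℝ, E) p f = fun q => chartAt E (f p) (f q) := rfl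
  have key : (mfderiv 𝓘(ℝ, X) 𝓘(ℝ, E) f p : X →L[ℝ] E) =
      fderiv ℝ (fun q => chartAt E (f p) (f q)) p := by
    by_cases h : MDifferentiableAt 𝓘(ℝ, X) 𝓘(ℝ, E) f p
    · refine h.mfderiv.trans ?_
      rw [hw]
      simp only [modelWithCornersSelf_coe, range_id, fderivWithin_univ]
      rfl
    · refine (mfderiv_zero_of_not_mdifferentiableAt h).trans ?_
      rw [mdifferentiableAt_iff, hw] at h
      have : ¬ DifferentiableAt ℝ (fun q => chartAt E (f p) (f q)) p := by
        intro h'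
        exact h ⟨hf, h'.differentiableWithinAt⟩
      rw [fderiv_zero_of_not_differentiableAt this]
      rfl
  exact DFunLike.congr_fun key ξ

theorem coord_eq_fderiv {φ : OpenPartialHomeomorph M E} {x : M} (hx : x ∈ φ.source)
    (v : Tan E x) :
    coord φ x v = fderiv ℝ (fun q => φ ((chartAt E x).symm q)) (chartAt E x x) v := by
  have hw : writtenInExtChartAt 𝓘(ℝ, E) 𝓘(ℝ, E) x φ = fun q => φ ((chartAt E x).symm q) := rfl
  have key : (mfderiv 𝓘(ℝ, E) 𝓘(ℝ, E) φ x : E →L[ℝ] E) =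
      fderiv ℝ (fun q => φ ((chartAt E x).symm q)) (chartAt E x x) := by
    by_cases h : MDifferentiableAt 𝓘(ℝ, E) 𝓘(ℝ, E) φ x
    · refine h.mfderiv.trans ?_
      rw [hw]
      simp only [modelWithCornersSelf_coe, range_id, fderivWithin_univ]
      rfl
    · refine (mfderiv_zero_of_not_mdifferentiableAt h).trans ?_
      rw [mdifferentiableAt_iff, hw] at h
      have : ¬ DifferentiableAt ℝ (fun q => φ ((chartAt E x).symm q)) (chartAt E x x) := by
        intro h'
        exact h ⟨φ.continuousAt hx, h'.differentiableWithinAt⟩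
      rw [fderiv_zero_of_not_differentiableAt this]
      rfl
  exact DFunLike.congr_fun key v

variable [IsManifold 𝓘(ℂ, E) ω M]

theorem chart_mem (x : M) : chartAt E x ∈ IsManifold.maximalAtlas 𝓘(ℂ, E) ω M :=
  IsManifold.chart_mem_maximalAtlas x

variable {φ ψ χ : OpenPartialHomeomorph M E}

/-- The derivative of the coordinate change from `φ` to `ψ`. -/
noncomputable def jac (φ ψ : OpenPartialHomeomorph M E) (y : E) : E →L[ℂ] E :=
  fderiv ℂ (fun q => ψ (φ.symm q)) y

variable (hφ : φ ∈ IsManifold.maximalAtlas 𝓘(ℂ, E) ω M)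
  (hψ : ψ ∈ IsManifold.maximalAtlas 𝓘(ℂ, E) ω M) (hχ : χ ∈ IsManifold.maximalAtlas 𝓘(ℂ, E) ω M)

include hφ hψ

theorem contDiffAt_transition {y : E} (hy : y ∈ φ.target) (hy' : φ.symm y ∈ ψ.source) :
    ContDiffAt ℂ ω (fun q => ψ (φ.symm q)) y := by
  have h := contMDiffOn_of_mem_contDiffGroupoid
    (StructureGroupoid.compatible_of_mem_maximalAtlas hφ hψ)
  have hy2 : y ∈ (φ.symm ≫ₕ ψ).source := by
    simp [hy, hy']
  exact (contMDiffOn_iff_contDiffOn.1 h).contDiffAt ((φ.symm ≫ₕ ψ).open_source.mem_nhds hy2)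

theorem contDiffAt_transition_real {y : E} (hy : y ∈ φ.target) (hy' : φ.symm y ∈ ψ.source) :
    ContDiffAt ℝ ω (fun q => ψ (φ.symm q)) y :=
  (contDiffAt_transition hφ hψ hy hy').restrict_scalars ℝ

theorem differentiableAt_transition {y : E} (hy : y ∈ φ.target) (hy' : φ.symm y ∈ ψ.source) :
    DifferentiableAt ℂ (fun q => ψ (φ.symm q)) y :=
  (contDiffAt_transition hφ hψ hy hy').differentiableAt (by simp)

theorem contDiffAt_jac {y : E} (hy : y ∈ φ.target) (hy' : φ.symm y ∈ ψ.source) :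
    ContDiffAt ℂ ω (jac φ ψ) y :=
  (contDiffAt_transition hφ hψ hy hy').fderiv_right (m := ω) (by simp)

theorem fderiv_transition_apply {y : E} (hy : y ∈ φ.target) (hy' : φ.symm y ∈ ψ.source) (v : E) :
    fderiv ℝ (fun q => ψ (φ.symm q)) y v = jac φ ψ y v :=
  fderiv_real_eq (differentiableAt_transition hφ hψ hy hy') v

include hχ in
theorem jac_comp {y : E} (hy : y ∈ φ.target) (hy' : φ.symm y ∈ ψ.source)
    (hy'' : φ.symm y ∈ χ.source) (v : E) :
    jac ψ χ (ψ (φ.symm y)) (jac φ ψ y v) = jac φ χ y v := by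
  have h1 := differentiableAt_transition hφ hψ hy hy'
  have h2 : DifferentiableAt ℂ (fun q => χ (ψ.symm q)) (ψ (φ.symm y)) :=
    differentiableAt_transition hψ hχ (ψ.map_source hy') (by rwa [ψ.left_inv hy'])
  have h3 := fderiv_comp y h2 h1
  have h4 : (fun q => χ (φ.symm q)) =ᶠ[𝓝 y]
      (fun q => χ (ψ.symm q)) ∘ (fun q => ψ (φ.symm q)) := by
    filter_upwards [(φ.continuousAt_symm hy).preimage_mem_nhds (ψ.open_source.mem_nhds hy')]
      with q hq
    simp only [Function.comp, ψ.left_inv hq]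
  rw [jac, jac, jac, h4.fderiv_eq, h3]
  rfl

omit hφ hψ [ChartedSpace E M] [IsManifold 𝓘(ℂ, E) ω M] in
theorem jac_self {y : E} (hy : y ∈ φ.target) (v : E) : jac φ φ y v = v := by
  have h : (fun q => φ (φ.symm q)) =ᶠ[𝓝 y] id := by
    filter_upwards [φ.open_target.mem_nhds hy] with q hq
    exact φ.right_inv hq
  rw [jac, h.fderiv_eq, fderiv_id]
  rfl

theorem jac_inv {y : E} (hy : y ∈ φ.target) (hy' : φ.symm y ∈ ψ.source) (v : E) :
    jac ψ φ (ψ (φ.symm y)) (jac φ ψ y v) = v := by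
  rw [jac_comp hφ hψ hφ hy hy' (φ.map_target hy), jac_self hy]

omit hψ in
theorem coord_eq_jac {x : M} (hx : x ∈ φ.source) (v : Tan E x) :
    coord φ x v = jac (chartAt E x) φ (chartAt E x x) v := by
  rw [coord_eq_fderiv hx]
  refine fderiv_transition_apply (chart_mem x) hφ (mem_chart_target E x) ?_ v
  rwa [(chartAt E x).left_inv (mem_chart_source E x)]

theorem coord_change {x : M} (hx : x ∈ φ.source) (hx' : x ∈ ψ.source) (v : Tan E x) :
    coord ψ x v = jac φ ψ (φ x) (coord φ x v) := by
  rw [coord_eq_jac hφ hx, coord_eq_jac hψ hx']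
  have h := jac_comp (chart_mem x) hφ hψ (mem_chart_target E x) (v := v)
  rw [(chartAt E x).left_inv (mem_chart_source E x)] at h
  exact (h hx hx').symm

omit hφ hψ in
theorem coord_chartAt (x : M) (v : Tan E x) : coord (chartAt E x) x v = v := by
  rw [coord_eq_jac (chart_mem x) (mem_chart_source E x)]
  exact jac_self (mem_chart_target E x) v

omit hψ in
-- `J` is defined through the preferred chart; since coordinate changes have complex linear
-- derivatives, it is multiplication by `I` in every holomorphic chart.
theorem coord_J {x : M} (hx : x ∈ φ.source) (v : Tan E x) :
    coord φ x (J x v) = Complex.I • coord φ x v := by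
  rw [coord_eq_jac hφ hx, coord_eq_jac hφ hx]
  exact map_smul _ _ _

omit hφ hψ [IsManifold 𝓘(ℂ, E) ω M] in
theorem coord_add (φ : OpenPartialHomeomorph M E) (x : M) (v w : Tan E x) :
    coord φ x (v + w) = coord φ x v + coord φ x w :=
  map_add (mfderiv 𝓘(ℝ, E) 𝓘(ℝ, E) φ x) v w

omit hφ hψ [IsManifold 𝓘(ℂ, E) ω M] in
theorem coord_zero (φ : OpenPartialHomeomorph M E) (x : M) : coord φ x (0 : Tan E x) = 0 :=
  map_zero (mfderiv 𝓘(ℝ, E) 𝓘(ℝ, E) φ x)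

omit hψ in
/-- The coordinates of tangent vectors in a holomorphic chart, as a linear isomorphism. -/
theorem exists_coordEquiv {x : M} (hx : x ∈ φ.source) :
    ∃ L : E ≃L[ℂ] E, ∀ v : Tan E x, coord φ x v = L v := by
  have h1 : (chartAt E x).symm (chartAt E x x) = x := (chartAt E x).left_inv (mem_chart_source E x)
  refine ⟨ContinuousLinearEquiv.equivOfInverse (jac (chartAt E x) φ (chartAt E x x))
    (jac φ (chartAt E x) (φ x)) ?_ ?_, fun v => coord_eq_jac hφ hx v⟩
  · intro v
    have := jac_inv (chart_mem x) hφ (mem_chart_target E x) (by rwa [h1]) v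
    rwa [h1] at this
  · intro v
    have h2 := φ.left_inv hx
    have := jac_inv hφ (chart_mem x) (φ.map_source hx) (by rw [h2]; exact mem_chart_source E x) v
    rwa [h2] at this

omit hψ in
theorem coord_injective {x : M} (hx : x ∈ φ.source) {v w : Tan E x}
    (h : coord φ x v = coord φ x w) : v = w := by
  obtain ⟨L, hL⟩ := exists_coordEquiv hφ hx
  rw [hL, hL] at h
  exact L.injective h

omit hψ in
theorem coord_surjective {x : M} (hx : x ∈ φ.source) (w : E) : ∃ v : Tan E x, coord φ x v = w := by
  obtain ⟨L, hL⟩ := exists_coordEquiv hφ hx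
  exact ⟨L.symm w, (hL (L.symm w)).trans (L.apply_symm_apply w)⟩

omit hψ in
theorem coord_eq_zero {x : M} (hx : x ∈ φ.source) {v : Tan E x} :
    coord φ x v = 0 ↔ v = 0 :=
  ⟨fun h => coord_injective hφ hx (by rw [h, coord_zero]), fun h => by rw [h, coord_zero]⟩

/-! Maps into `M` in charts. -/

variable {X : Type*} [NormedAddCommGroup X] [NormedSpace ℝ X] {f : X → M} {p : X}

omit hφ hψ [IsManifold 𝓘(ℂ, E) ω M] in
theorem eventually_chart_change (hf : ContinuousAt f p) (hp : f p ∈ φ.source) :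
    (fun q => ψ (f q)) =ᶠ[𝓝 p] (fun q => ψ (φ.symm q)) ∘ fun q => φ (f q) := by
  filter_upwards [hf.preimage_mem_nhds (φ.open_source.mem_nhds hp)] with q hq
  simp only [Function.comp, φ.left_inv hq]

theorem contDiffAt_chart_change {n : ℕ∞} (hf : ContinuousAt f p) (hp : f p ∈ φ.source)
    (hp' : f p ∈ ψ.source) (h : ContDiffAt ℝ n (fun q => φ (f q)) p) :
    ContDiffAt ℝ n (fun q => ψ (f q)) p := by
  refine ContDiffAt.congr_of_eventuallyEq ?_ (eventually_chart_change hf hp)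
  refine ContDiffAt.comp p ?_ h
  exact (contDiffAt_transition_real hφ hψ (φ.map_source hp) (by rwa [φ.left_inv hp])).of_le le_top

theorem differentiableAt_chart_change (hf : ContinuousAt f p) (hp : f p ∈ φ.source)
    (hp' : f p ∈ ψ.source) (h : DifferentiableAt ℝ (fun q => φ (f q)) p) :
    DifferentiableAt ℝ (fun q => ψ (f q)) p := by
  refine DifferentiableAt.congr_of_eventuallyEq ?_ (eventually_chart_change hf hp)
  exact DifferentiableAt.comp p ((differentiableAt_transition hφ hψ (φ.map_source hp)
    (by rwa [φ.left_inv hp])).restrictScalars ℝ) h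

theorem fderiv_chart_change (hf : ContinuousAt f p) (hp : f p ∈ φ.source)
    (hp' : f p ∈ ψ.source) (h : DifferentiableAt ℝ (fun q => φ (f q)) p) (ξ : X) :
    fderiv ℝ (fun q => ψ (f q)) p ξ = jac φ ψ (φ (f p)) (fderiv ℝ (fun q => φ (f q)) p ξ) := by
  have h1 : DifferentiableAt ℝ (fun q => ψ (φ.symm q)) (φ (f p)) :=
    (differentiableAt_transition hφ hψ (φ.map_source hp) (by rwa [φ.left_inv hp])).restrictScalars ℝ
  rw [(eventually_chart_change hf hp).fderiv_eq, fderiv_comp p h1 h]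
  exact fderiv_transition_apply hφ hψ (φ.map_source hp) (by rwa [φ.left_inv hp]) _

omit hψ in
theorem coord_push (hf : ContinuousAt f p) (hp : f p ∈ φ.source)
    (h : DifferentiableAt ℝ (fun q => φ (f q)) p) (ξ : X) :
    coord φ (f p) (push E f p ξ) = fderiv ℝ (fun q => φ (f q)) p ξ := by
  have h1 := differentiableAt_chart_change hφ (chart_mem (f p)) hf hp (mem_chart_source E _) h
  rw [coord_eq_jac hφ hp, fderiv_chart_change (chart_mem (f p)) hφ hf (mem_chart_source E _) hp h1,
    push, mfderiv_eq_fderiv_chart hf]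

theorem eventually_coord_change {V : (q : X) → Tan E (f q)} (hf : ContinuousAt f p)
    (hp : f p ∈ φ.source) (hp' : f p ∈ ψ.source) :
    (fun q => coord ψ (f q) (V q)) =ᶠ[𝓝 p]
      fun q => jac φ ψ (φ (f q)) (coord φ (f q) (V q)) := by
  filter_upwards [hf.preimage_mem_nhds (φ.open_source.mem_nhds hp),
    hf.preimage_mem_nhds (ψ.open_source.mem_nhds hp')] with q hq hq'
  exact coord_change hφ hψ hq hq' _

end Charts

/-! ### The metric and the Christoffel symbols in charts -/

section Metric

variable {E : Type*} [NormedAddCommGroup E] [NormedSpace ℂ E]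
  {M : Type*} [TopologicalSpace M] [ChartedSpace E M] [IsManifold 𝓘(ℂ, E) ω M]
  {g : BilinField E M}

/-- The derivative of the inverse chart undoes `coord`, so `metricInChart` really is the coordinate
expression of `g`. -/
theorem metricInChart_coord {x₀ : M} {y : E} (hy : y ∈ (chartAt E x₀).target)
    (a b : Tan E ((chartAt E x₀).symm y)) :
    metricInChart g x₀ y (coord (chartAt E x₀) _ a) (coord (chartAt E x₀) _ b) =
      g ((chartAt E x₀).symm y) a b := by
  have hx : (chartAt E x₀).symm y ∈ (chartAt E x₀).source := (chartAt E x₀).map_target hy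
  have key : ∀ a : Tan E ((chartAt E x₀).symm y),
      (mfderiv 𝓘(ℝ, E) 𝓘(ℝ, E) (chartAt E x₀).symm y (coord (E := E) (chartAt E x₀) _ a) : E) = a := by
    intro a
    have h1 := coord_change (chart_mem x₀) (chart_mem _) hx (mem_chart_source E _) a
    rw [coord_chartAt, (chartAt E x₀).right_inv hy] at h1
    conv_rhs => rw [h1]
    refine (mfderiv_eq_fderiv_chart ((chartAt E x₀).continuousAt_symm hy) _).trans ?_
    exact fderiv_transition_apply (chart_mem x₀) (chart_mem _) hy (mem_chart_source E _) _
  have h : metricInChart g x₀ y (coord (chartAt E x₀) _ a) (coord (chartAt E x₀) _ b) =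
      g ((chartAt E x₀).symm y)
        (mfderiv 𝓘(ℝ, E) 𝓘(ℝ, E) (chartAt E x₀).symm y (coord (E := E) (chartAt E x₀) _ a))
        (mfderiv 𝓘(ℝ, E) 𝓘(ℝ, E) (chartAt E x₀).symm y (coord (E := E) (chartAt E x₀) _ b)) := rfl
  rw [h]
  congr 1
  · exact congrArg _ (key a)
  · exact key b

theorem metricInChart_transform {x₀ x₁ : M} {y : E} (hy : y ∈ (chartAt E x₀).target)
    (hy' : (chartAt E x₀).symm y ∈ (chartAt E x₁).source) (u v : E) :
    metricInChart g x₀ y u v = metricInChart g x₁ (chartAt E x₁ ((chartAt E x₀).symm y))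
      (jac (chartAt E x₀) (chartAt E x₁) y u) (jac (chartAt E x₀) (chartAt E x₁) y v) := by
  have hx : (chartAt E x₀).symm y ∈ (chartAt E x₀).source := (chartAt E x₀).map_target hy
  obtain ⟨a, ha⟩ := coord_surjective (chart_mem x₀) hx u
  obtain ⟨b, hb⟩ := coord_surjective (chart_mem x₀) hx v
  have hy1 := (chartAt E x₁).map_source hy'
  have h0 := metricInChart_coord (g := g) hy a b
  have h1 : ∀ x, x = (chartAt E x₀).symm y → ∀ a b : Tan E x,
      metricInChart g x₁ (chartAt E x₁ ((chartAt E x₀).symm y)) (coord (chartAt E x₁) x a)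
        (coord (chartAt E x₁) x b) = g x a b := by
    intro x hx
    have : x = (chartAt E x₁).symm (chartAt E x₁ ((chartAt E x₀).symm y)) := by
      rw [hx, (chartAt E x₁).left_inv hy']
    subst this
    exact metricInChart_coord hy1
  rw [← ha, ← hb, h0, ← h1 _ rfl a b, coord_change (chart_mem x₀) (chart_mem x₁) hx hy' a,
    coord_change (chart_mem x₀) (chart_mem x₁) hx hy' b, (chartAt E x₀).right_inv hy]

variable {x₀ : M} {y : E}

/-! ### Pointwise identities for the metric and the Christoffel symbols -/

section Algebra

variable (hg : IsAntiKaehler g) (hy : y ∈ (chartAt E x₀).target)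

include hg hy

theorem metricInChart_symm (u v : E) :
    metricInChart g x₀ y u v = metricInChart g x₀ y v u := by
  have hx : (chartAt E x₀).symm y ∈ (chartAt E x₀).source := (chartAt E x₀).map_target hy
  obtain ⟨a, rfl⟩ := coord_surjective (chart_mem x₀) hx u
  obtain ⟨b, rfl⟩ := coord_surjective (chart_mem x₀) hx v
  rw [metricInChart_coord hy, metricInChart_coord hy, hg.symm]

theorem metricInChart_nondegenerate {u : E} (h : ∀ v, metricInChart g x₀ y u v = 0) : u = 0 := by
  have hx : (chartAt E x₀).symm y ∈ (chartAt E x₀).source := (chartAt E x₀).map_target hy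
  obtain ⟨a, rfl⟩ := coord_surjective (chart_mem x₀) hx u
  rw [coord_eq_zero (chart_mem x₀) hx]
  refine hg.nondegenerate _ a fun b => ?_
  rw [← metricInChart_coord hy, h]

theorem metricInChart_ext {u u' : E}
    (h : ∀ v, metricInChart g x₀ y u v = metricInChart g x₀ y u' v) : u = u' := by
  refine sub_eq_zero.1 (metricInChart_nondegenerate hg hy fun v => ?_)
  rw [map_sub, sub_apply, h, sub_self]

/-- Because `I² = -1`, the anti-Hermitian condition for `u` and `-I v` says that `I` is
self-adjoint. -/
theorem metricInChart_I (u v : E) :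
    metricInChart g x₀ y (Complex.I • u) v = metricInChart g x₀ y u (Complex.I • v) := by
  have key : ∀ u v : E, metricInChart g x₀ y (Complex.I • u) (Complex.I • v) =
      - metricInChart g x₀ y u v := by
    intro u v
    have hx : (chartAt E x₀).symm y ∈ (chartAt E x₀).source := (chartAt E x₀).map_target hy
    obtain ⟨a, rfl⟩ := coord_surjective (chart_mem x₀) hx u
    obtain ⟨b, rfl⟩ := coord_surjective (chart_mem x₀) hx v
    rw [← coord_J (chart_mem x₀) hx, ← coord_J (chart_mem x₀) hx, metricInChart_coord hy,
      metricInChart_coord hy, hg.antiHermitian]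
  have := key u (-(Complex.I • v))
  rw [smul_neg, smul_smul, Complex.I_mul_I, neg_smul, one_smul, neg_neg, map_neg, neg_neg] at this
  exact this

theorem contDiffAt_metricInChart : ContDiffAt ℝ ∞ (metricInChart g x₀) y :=
  (hg.smooth x₀).contDiffAt ((chartAt E x₀).open_target.mem_nhds hy)

theorem differentiableAt_metricInChart : DifferentiableAt ℝ (metricInChart g x₀) y :=
  (contDiffAt_metricInChart hg hy).differentiableAt (by simp)

theorem fderiv_metricInChart_apply (a u v : E) :
    fderiv ℝ (metricInChart g x₀) y a u v = fderiv ℝ (fun q => metricInChart g x₀ q u v) y a := by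
  have h := ((differentiableAt_metricInChart hg hy).hasFDerivAt.clm_apply
    (hasFDerivAt_const u y)).clm_apply (hasFDerivAt_const v y)
  rw [h.fderiv]
  simp

theorem fderiv_metricInChart_symm (a u v : E) :
    fderiv ℝ (metricInChart g x₀) y a u v = fderiv ℝ (metricInChart g x₀) y a v u := by
  rw [fderiv_metricInChart_apply hg hy, fderiv_metricInChart_apply hg hy]
  have : (fun q => metricInChart g x₀ q u v) =ᶠ[𝓝 y] fun q => metricInChart g x₀ q v u := by
    filter_upwards [(chartAt E x₀).open_target.mem_nhds hy] with q hq
    exact metricInChart_symm hg hq u v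
  rw [this.fderiv_eq]

theorem fderiv_metricInChart_I (a u v : E) :
    fderiv ℝ (metricInChart g x₀) y a (Complex.I • u) v =
      fderiv ℝ (metricInChart g x₀) y a u (Complex.I • v) := by
  rw [fderiv_metricInChart_apply hg hy, fderiv_metricInChart_apply hg hy]
  have : (fun q => metricInChart g x₀ q (Complex.I • u) v) =ᶠ[𝓝 y]
      fun q => metricInChart g x₀ q u (Complex.I • v) := by
    filter_upwards [(chartAt E x₀).open_target.mem_nhds hy] with q hq
    exact metricInChart_I hg hq u v
  rw [this.fderiv_eq]

omit hg hy in
theorem koszul_apply (u v w : E) :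
    koszul g x₀ y u v w = (1 / 2) * (fderiv ℝ (metricInChart g x₀) y u v w
      + fderiv ℝ (metricInChart g x₀) y v u w - fderiv ℝ (metricInChart g x₀) y w u v) := rfl

variable [FiniteDimensional ℂ E]

/-- A nondegenerate form embeds `E` in its dual, and equality of dimensions makes this an
isomorphism. Thus the `inverse` in `christoffel` is a true inverse and not the default value 0. -/
theorem exists_metricInChart_equiv :
    ∃ L : E ≃L[ℝ] (E →L[ℝ] ℝ), (L : E →L[ℝ] (E →L[ℝ] ℝ)) = metricInChart g x₀ y := by
  have : FiniteDimensional ℝ E := FiniteDimensional.complexToReal E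
  have hinj : Function.Injective (metricInChart g x₀ y).toLinearMap := by
    intro u u' h
    exact metricInChart_ext hg hy fun v => DFunLike.congr_fun h v
  have hdim : Module.finrank ℝ E = Module.finrank ℝ (E →L[ℝ] ℝ) := by
    rw [← (LinearMap.toContinuousLinearMap (𝕜 := ℝ) (E := E) (F' := ℝ)).finrank_eq]
    exact (Subspace.dual_finrank_eq (K := ℝ) (V := E)).symm
  refine ⟨(LinearEquiv.ofInjectiveOfFinrankEq (metricInChart g x₀ y).toLinearMap hinj
    hdim).toContinuousLinearEquiv, ?_⟩
  ext u v
  rfl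

theorem metricInChart_christoffel (u v w : E) :
    metricInChart g x₀ y (christoffel g x₀ y u v) w = koszul g x₀ y u v w := by
  obtain ⟨L, hL⟩ := exists_metricInChart_equiv hg hy
  rw [christoffel, ← hL, ContinuousLinearMap.inverse_equiv]
  show L (L.symm _) w = _
  rw [L.apply_symm_apply]

theorem christoffel_unique {u v a : E}
    (h : ∀ w, metricInChart g x₀ y a w = koszul g x₀ y u v w) : christoffel g x₀ y u v = a :=
  metricInChart_ext hg hy fun w => by rw [metricInChart_christoffel hg hy, h]

theorem christoffel_symm (u v : E) : christoffel g x₀ y u v = christoffel g x₀ y v u := by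
  refine christoffel_unique hg hy fun w => ?_
  rw [metricInChart_christoffel hg hy, koszul_apply, koszul_apply,
    fderiv_metricInChart_symm hg hy w u v]
  ring

theorem christoffel_add_right (u v v' : E) :
    christoffel g x₀ y u (v + v') = christoffel g x₀ y u v + christoffel g x₀ y u v' := by
  refine christoffel_unique hg hy fun w => ?_
  rw [map_add, add_apply, metricInChart_christoffel hg hy,
    metricInChart_christoffel hg hy]
  simp only [koszul_apply, map_add, add_apply]
  ring

theorem christoffel_smul_right (c : ℝ) (u v : E) :
    christoffel g x₀ y u (c • v) = c • christoffel g x₀ y u v := by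
  refine christoffel_unique hg hy fun w => ?_
  rw [map_smul, smul_apply, metricInChart_christoffel hg hy]
  simp only [koszul_apply, map_smul, smul_apply, smul_eq_mul]
  ring

/-- The Levi-Civita connection is metric. -/
theorem fderiv_metricInChart_eq (a u v : E) :
    fderiv ℝ (metricInChart g x₀) y a u v = metricInChart g x₀ y (christoffel g x₀ y a u) v
      + metricInChart g x₀ y u (christoffel g x₀ y a v) := by
  rw [metricInChart_symm hg hy u, metricInChart_christoffel hg hy, metricInChart_christoffel hg hy,
    koszul_apply, koszul_apply, fderiv_metricInChart_symm hg hy a v u]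
  ring

omit hy in
theorem contDiffOn_koszul (u v : E) :
    ContDiffOn ℝ ∞ (fun q => koszul g x₀ q u v) (chartAt E x₀).target := by
  have : FiniteDimensional ℝ E := FiniteDimensional.complexToReal E
  have h : ∀ a u v, ContDiffOn ℝ ∞ (fun q => fderiv ℝ (metricInChart g x₀) q a u v)
      (chartAt E x₀).target := by
    intro a u v q hq
    have h1 : ContDiffAt ℝ ∞ (fun q => metricInChart g x₀ q u v) q :=
      ((contDiffAt_metricInChart hg hq).clm_apply contDiffAt_const).clm_apply contDiffAt_const
    have h2 : ContDiffAt ℝ ∞ (fun q => fderiv ℝ (fun q => metricInChart g x₀ q u v) q a) q :=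
      (h1.fderiv_right (m := ∞) (by exact le_rfl)).clm_apply contDiffAt_const
    refine (h2.congr_of_eventuallyEq ?_).contDiffWithinAt
    filter_upwards [(chartAt E x₀).open_target.mem_nhds hq] with q' hq'
    exact fderiv_metricInChart_apply hg hq' a u v
  rw [contDiffOn_clm_apply]
  intro w
  simp only [koszul_apply]
  exact contDiffOn_const.mul (((h u v w).add (h v u w)).sub (h w u v))

theorem contDiffAt_christoffel (u v : E) :
    ContDiffAt ℝ ∞ (fun q => christoffel g x₀ q u v) y := by
  have : FiniteDimensional ℝ E := FiniteDimensional.complexToReal E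
  have : CompleteSpace E := FiniteDimensional.complete ℝ E
  obtain ⟨L, hL⟩ := exists_metricInChart_equiv hg hy
  have hm := contDiffAt_metricInChart hg hy
  have hinv : ContDiffAt ℝ ∞
      ((ContinuousLinearMap.inverse : (E →L[ℝ] E →L[ℝ] ℝ) → (E →L[ℝ] ℝ) →L[ℝ] E) ∘
        metricInChart g x₀) y := by
    refine ContDiffAt.comp y ?_ hm
    rw [← hL]
    exact contDiffAt_map_inverse L
  exact hinv.clm_apply ((contDiffOn_koszul hg u v).contDiffAt
    ((chartAt E x₀).open_target.mem_nhds hy))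

end Algebra

/-! ### Change of charts and the consequences of `∇J = 0` -/

section Transform

variable [FiniteDimensional ℂ E] (hg : IsAntiKaehler g)

include hg

omit hg in
theorem fderiv_jac_symm {φ ψ : OpenPartialHomeomorph M E}
    (hφ : φ ∈ IsManifold.maximalAtlas 𝓘(ℂ, E) ω M) (hψ : ψ ∈ IsManifold.maximalAtlas 𝓘(ℂ, E) ω M)
    {y : E} (hy : y ∈ φ.target) (hy' : φ.symm y ∈ ψ.source) (u v : E) :
    fderiv ℝ (fun q => jac φ ψ q u) y v = fderiv ℝ (fun q => jac φ ψ q v) y u := by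
  have h : ∀ u, (fun q => jac φ ψ q u) =ᶠ[𝓝 y]
      fun q => fderiv ℝ (fun q => ψ (φ.symm q)) q u := by
    intro u
    filter_upwards [(φ.continuousAt_symm hy).preimage_mem_nhds (ψ.open_source.mem_nhds hy'),
      φ.open_target.mem_nhds hy] with q hq hq'
    exact (fderiv_transition_apply hφ hψ hq' hq u).symm
  rw [(h u).fderiv_eq, (h v).fderiv_eq]
  exact fderiv_fderiv_symm ((contDiffAt_transition_real hφ hψ hy hy').of_le le_top) u v

/-- The transformation law of the Christoffel symbols. -/
theorem christoffel_transform {x₀ x₁ : M} {y : E} (hy : y ∈ (chartAt E x₀).target)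
    (hy' : (chartAt E x₀).symm y ∈ (chartAt E x₁).source) (u v : E) :
    jac (chartAt E x₀) (chartAt E x₁) y (christoffel g x₀ y u v) =
      christoffel g x₁ (chartAt E x₁ ((chartAt E x₀).symm y))
        (jac (chartAt E x₀) (chartAt E x₁) y u) (jac (chartAt E x₀) (chartAt E x₁) y v)
      + fderiv ℝ (fun q => jac (chartAt E x₀) (chartAt E x₁) q v) y u := by
  set φ := chartAt E x₀ with hφ
  set ψ := chartAt E x₁ with hψ
  have hy1 : ψ (φ.symm y) ∈ ψ.target := ψ.map_source hy'
  have hJd : ∀ u, DifferentiableAt ℝ (fun q => jac φ ψ q u) y := fun u =>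
    (((contDiffAt_jac (chart_mem x₀) (chart_mem x₁) hy hy').differentiableAt
      (by simp)).clm_apply (differentiableAt_const u)).restrictScalars ℝ
  have hnear : ∀ u v, (fun q => metricInChart g x₀ q u v) =ᶠ[𝓝 y]
      fun q => metricInChart g x₁ (ψ (φ.symm q)) (jac φ ψ q u) (jac φ ψ q v) := by
    intro u v
    filter_upwards [(φ.continuousAt_symm hy).preimage_mem_nhds (ψ.open_source.mem_nhds hy'),
      φ.open_target.mem_nhds hy] with q hq hq'
    exact metricInChart_transform hq' hq u v
  have hD : ∀ a u v, fderiv ℝ (metricInChart g x₀) y a u v =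
      fderiv ℝ (metricInChart g x₁) (ψ (φ.symm y)) (jac φ ψ y a) (jac φ ψ y u) (jac φ ψ y v)
      + metricInChart g x₁ (ψ (φ.symm y)) (fderiv ℝ (fun q => jac φ ψ q u) y a) (jac φ ψ y v)
      + metricInChart g x₁ (ψ (φ.symm y)) (jac φ ψ y u) (fderiv ℝ (fun q => jac φ ψ q v) y a) := by
    intro a u v
    have ht : HasFDerivAt (fun q => ψ (φ.symm q)) (fderiv ℝ (fun q => ψ (φ.symm q)) y) y :=
      ((differentiableAt_transition (chart_mem x₀) (chart_mem x₁) hy hy').restrictScalars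
        ℝ).hasFDerivAt
    have hta : fderiv ℝ (fun q => ψ (φ.symm q)) y a = jac φ ψ y a :=
      fderiv_transition_apply (chart_mem x₀) (chart_mem x₁) hy hy' a
    have hm := (differentiableAt_metricInChart hg hy1).hasFDerivAt
    have h1 := HasFDerivAt.comp (g := metricInChart g x₁) y hm ht
    have h2 := (h1.clm_apply (hJd u).hasFDerivAt).clm_apply (hJd v).hasFDerivAt
    simp only [Function.comp_def] at h2
    rw [fderiv_metricInChart_apply hg hy, (hnear u v).fderiv_eq, h2.fderiv]
    simp only [add_apply, ContinuousLinearMap.comp_apply,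
      ContinuousLinearMap.flip_apply, hta]
    ring
  have hs := fderiv_jac_symm (chart_mem x₀) (chart_mem x₁) hy hy'
  refine metricInChart_ext hg hy1 fun w => ?_
  obtain ⟨w, rfl⟩ : ∃ w', jac φ ψ y w' = w := by
    refine ⟨jac ψ φ (ψ (φ.symm y)) w, ?_⟩
    have := jac_inv (chart_mem x₁) (chart_mem x₀) hy1
      (by rw [ψ.left_inv hy']; exact φ.map_target hy) w
    rwa [← hφ, ← hψ, ψ.left_inv hy', φ.right_inv hy] at this
  -- The Koszul expression receives six terms with second derivatives of the coordinate change. By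
  -- symmetry four cancel, and the remaining two are equal and give the inhomogeneous term.
  rw [← metricInChart_transform hy hy', metricInChart_christoffel hg hy, koszul_apply, hD, hD, hD,
    map_add, add_apply, metricInChart_christoffel hg hy1, koszul_apply,
    hs u v, hs w v, hs w u, metricInChart_symm hg hy1 (jac φ ψ y v),
    metricInChart_symm hg hy1 (jac φ ψ y u)]
  ring

omit hg in
-- `parallel` gives information only at the centre of the preferred chart. Applied to a field that
-- is constant in that chart, it leaves just the Christoffel term.
theorem christoffel_I_center (hg : IsAntiKaehler g) (x : M) (u v : E) :
    christoffel g x (chartAt E x x) u (Complex.I • v) =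
      Complex.I • christoffel g x (chartAt E x x) u v := by
  have hV : ∀ x' : M, ∃ a : Tan E x', x' ∈ (chartAt E x).source →
      coord (chartAt E x) x' a = v := by
    intro x'
    by_cases h : x' ∈ (chartAt E x).source
    · obtain ⟨a, ha⟩ := coord_surjective (chart_mem x) h v
      exact ⟨a, fun _ => ha⟩
    · exact ⟨0, fun h' => absurd h' h⟩
  choose V hV using hV
  have hx := mem_chart_source E x
  have hVx : comp x (V x) = v := by
    rw [← hV x hx, coord_chartAt]
    rfl
  have hc : fieldInChart V x =ᶠ[𝓝 (chartAt E x x)] fun _ => v := by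
    filter_upwards [(chartAt E x).open_target.mem_nhds (mem_chart_target E x)] with q hq
    exact hV _ ((chartAt E x).map_target hq)
  have hcJ : fieldInChart (fun x' => J x' (V x')) x =ᶠ[𝓝 (chartAt E x x)]
      fun _ => Complex.I • v := by
    filter_upwards [(chartAt E x).open_target.mem_nhds (mem_chart_target E x)] with q hq
    rw [fieldInChart, coord_J (chart_mem x) ((chartAt E x).map_target hq),
      hV _ ((chartAt E x).map_target hq)]
  have h1 : (covDeriv g V x u : E) = christoffel g x (chartAt E x x) u v := by
    show fderiv ℝ (fieldInChart V x) (chartAt E x x) u +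
      christoffel g x (chartAt E x x) u (comp x (V x)) = _
    rw [hc.fderiv_eq, hVx]
    simp
  have h2 : (covDeriv g (fun x' => J x' (V x')) x u : E) =
      christoffel g x (chartAt E x x) u (Complex.I • v) := by
    show fderiv ℝ (fieldInChart (fun x' => J x' (V x')) x) (chartAt E x x) u +
      christoffel g x (chartAt E x x) u (Complex.I • comp x (V x)) = _
    rw [hcJ.fderiv_eq, hVx]
    simp
  have h3 := hg.parallel V x ((differentiableAt_const v).congr_of_eventuallyEq hc) u
  rw [← h2, ← h1]
  exact h3

/-- Transport `christoffel_I_center` from the chart centred at the given point by the transformation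
law. The inhomogeneous term causes no trouble: the coordinate change is holomorphic, so that term
too is complex linear in `v`. -/
theorem christoffel_I_right {x₀ : M} {y : E} (hy : y ∈ (chartAt E x₀).target) (u v : E) :
    christoffel g x₀ y u (Complex.I • v) = Complex.I • christoffel g x₀ y u v := by
  set x := (chartAt E x₀).symm y with hx
  have hy' : (chartAt E x₀).symm y ∈ (chartAt E x).source := mem_chart_source E x
  have hJd : DifferentiableAt ℝ (fun q => jac (chartAt E x₀) (chartAt E x) q v) y :=
    (((contDiffAt_jac (chart_mem x₀) (chart_mem x) hy hy').differentiableAt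
      (by simp)).clm_apply (differentiableAt_const v)).restrictScalars ℝ
  have h1 := christoffel_transform hg hy hy' u v
  have h2 := christoffel_transform hg hy hy' u (Complex.I • v)
  simp only [map_smul] at h2
  rw [fderiv_fun_const_smul hJd, ← hx, christoffel_I_center hg] at h2
  rw [← hx] at h1
  have h3 : jac (chartAt E x₀) (chartAt E x) y (christoffel g x₀ y u (Complex.I • v)) =
      jac (chartAt E x₀) (chartAt E x) y (Complex.I • christoffel g x₀ y u v) := by
    rw [h2, map_smul, h1, smul_add]
    rfl
  have h4 := congrArg (jac (chartAt E x) (chartAt E x₀) (chartAt E x ((chartAt E x₀).symm y))) h3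
  rwa [jac_inv (chart_mem x₀) (chart_mem x) hy hy', jac_inv (chart_mem x₀) (chart_mem x) hy hy']
    at h4

/-- The metric of an anti-Kaehler manifold is the real part of a holomorphic one. -/
theorem fderiv_metricInChart_I_left {x₀ : M} {y : E} (hy : y ∈ (chartAt E x₀).target)
    (a u v : E) : fderiv ℝ (metricInChart g x₀) y (Complex.I • a) u v =
      fderiv ℝ (metricInChart g x₀) y a (Complex.I • u) v := by
  -- By symmetry the symbols are complex linear in the first argument as well; metric compatibility
  -- then carries `I` from the direction of differentiation to an argument of the metric.
  have h1 : ∀ w, christoffel g x₀ y (Complex.I • a) w = Complex.I • christoffel g x₀ y a w := by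
    intro w
    rw [christoffel_symm hg hy, christoffel_I_right hg hy, christoffel_symm hg hy]
  rw [fderiv_metricInChart_eq hg hy, fderiv_metricInChart_eq hg hy, h1, h1,
    christoffel_I_right hg hy, metricInChart_I hg hy u]

end Transform

end Metric

/-! ### Complex smoothness from real smoothness and complex differentiability -/

section RealComplexSmooth

theorem two_le_infty : (2 : WithTop ℕ∞) ≤ ∞ := WithTop.coe_le_coe.2 (le_top (a := (2 : ℕ∞)))

variable {E F : Type*} [NormedAddCommGroup E] [NormedSpace ℂ E] [FiniteDimensional ℂ E]
  [NormedAddCommGroup F] [NormedSpace ℂ F]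

/-- A real smooth, complex differentiable function is smooth over `ℂ`. -/
theorem contDiffOn_complex_of_real {f : E → F} {T : Set E} (hT : IsOpen T)
    (hr : ContDiffOn ℝ ∞ f T) (hc : DifferentiableOn ℂ f T) : ContDiffOn ℂ ∞ f T := by
  rw [contDiffOn_infty]
  intro n
  induction n generalizing f with
  | zero => exact contDiffOn_zero.2 hc.continuousOn
  | succ n ih =>
    -- The directional derivatives inherit both hypotheses, so the induction hypothesis applies to
    -- them.
    refine contDiffOn_succ_of_fderiv_apply hc (fun h => absurd h (by exact_mod_cast WithTop.natCast_ne_top n)) fun u => ?_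
    have h1 : ContDiffOn ℝ ∞ (fun q => fderiv ℝ f q u) T :=
      (hr.fderiv_of_isOpen hT (m := ∞) (by exact le_rfl)).clm_apply contDiffOn_const
    have h2 := differentiableOn_fderiv_apply hT (hr.of_le two_le_infty) hc u
    refine (ih h1 h2).congr fun q hq => ?_
    rw [fderivWithin_of_isOpen hT hq, fderiv_real_eq (hc.differentiableAt (hT.mem_nhds hq))]

end RealComplexSmooth

section Christoffel

variable {E : Type*} [NormedAddCommGroup E] [NormedSpace ℂ E]
  {M : Type*} [TopologicalSpace M] [ChartedSpace E M] [IsManifold 𝓘(ℂ, E) ω M]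
  {g : BilinField E M} [FiniteDimensional ℂ E] (hg : IsAntiKaehler g) {x₀ : M} {y : E}

include hg

/-! ### The Christoffel symbols are holomorphic -/

/-- Exchange the two derivatives so that `I • a` becomes the inner direction, move `I` into the
metric by the first order relations, and exchange back. -/
theorem fderiv_fderiv_metricInChart_I (hy : y ∈ (chartAt E x₀).target) (a u v b : E) :
    fderiv ℝ (fun q => fderiv ℝ (metricInChart g x₀) q u v b) y (Complex.I • a) =
      fderiv ℝ (fun q => fderiv ℝ (metricInChart g x₀) q u v (Complex.I • b)) y a := by
  have hs : ∀ a u v b, fderiv ℝ (fun q => fderiv ℝ (metricInChart g x₀) q u v b) y a =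
      fderiv ℝ (fun q => fderiv ℝ (metricInChart g x₀) q a v b) y u := by
    intro a u v b
    have h : ∀ u, (fun q => fderiv ℝ (metricInChart g x₀) q u v b) =ᶠ[𝓝 y]
        fun q => fderiv ℝ (fun q => metricInChart g x₀ q v b) q u := by
      intro u
      filter_upwards [(chartAt E x₀).open_target.mem_nhds hy] with q hq
      exact fderiv_metricInChart_apply hg hq u v b
    rw [(h u).fderiv_eq, (h a).fderiv_eq]
    have h1 : ContDiffAt ℝ ∞ (fun q => metricInChart g x₀ q v b) y :=
      ((contDiffAt_metricInChart hg hy).clm_apply contDiffAt_const).clm_apply contDiffAt_const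
    exact fderiv_fderiv_symm (h1.of_le two_le_infty) u a
  rw [hs, hs a]
  have h : (fun q => fderiv ℝ (metricInChart g x₀) q (Complex.I • a) v b) =ᶠ[𝓝 y]
      fun q => fderiv ℝ (metricInChart g x₀) q a v (Complex.I • b) := by
    filter_upwards [(chartAt E x₀).open_target.mem_nhds hy] with q hq
    rw [fderiv_metricInChart_I_left hg hq, fderiv_metricInChart_I hg hq]
  rw [h.fderiv_eq]

theorem differentiableAt_fderiv_metricInChart (hy : y ∈ (chartAt E x₀).target) (u v b : E) :
    DifferentiableAt ℝ (fun q => fderiv ℝ (metricInChart g x₀) q u v b) y := by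
  have h1 : ContDiffAt ℝ ∞ (fun q => metricInChart g x₀ q v b) y :=
    ((contDiffAt_metricInChart hg hy).clm_apply contDiffAt_const).clm_apply contDiffAt_const
  have h2 : ContDiffAt ℝ ∞ (fun q => fderiv ℝ (fun q => metricInChart g x₀ q v b) q u) y :=
    (h1.fderiv_right (m := ∞) (by exact le_rfl)).clm_apply contDiffAt_const
  refine (h2.differentiableAt (by simp)).congr_of_eventuallyEq ?_
  filter_upwards [(chartAt E x₀).open_target.mem_nhds hy] with q hq
  exact fderiv_metricInChart_apply hg hq u v b

theorem fderiv_koszul (hy : y ∈ (chartAt E x₀).target) (a u v b : E) :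
    fderiv ℝ (fun q => koszul g x₀ q u v b) y a =
      (1 / 2) * (fderiv ℝ (fun q => fderiv ℝ (metricInChart g x₀) q u v b) y a
        + fderiv ℝ (fun q => fderiv ℝ (metricInChart g x₀) q v u b) y a
        - fderiv ℝ (fun q => fderiv ℝ (metricInChart g x₀) q b u v) y a) := by
  have hd := fun u v b => (differentiableAt_fderiv_metricInChart hg hy u v b).hasFDerivAt
  have h := (((hd u v b).add (hd v u b)).sub (hd b u v)).const_mul (1 / 2 : ℝ)
  have h' : (fun q => koszul g x₀ q u v b) = fun q => (1 / 2 : ℝ) *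
      (((fun q => fderiv ℝ (metricInChart g x₀) q u v b) +
        (fun q => fderiv ℝ (metricInChart g x₀) q v u b)) -
        (fun q => fderiv ℝ (metricInChart g x₀) q b u v)) q := rfl
  rw [h', h.fderiv]
  rfl

theorem fderiv_koszul_I (hy : y ∈ (chartAt E x₀).target) (a u v b : E) :
    fderiv ℝ (fun q => koszul g x₀ q u v b) y (Complex.I • a) =
      fderiv ℝ (fun q => koszul g x₀ q u v (Complex.I • b)) y a := by
  have h : (fun q => fderiv ℝ (metricInChart g x₀) q (Complex.I • b) u v) =ᶠ[𝓝 y]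
      fun q => fderiv ℝ (metricInChart g x₀) q b u (Complex.I • v) := by
    filter_upwards [(chartAt E x₀).open_target.mem_nhds hy] with q hq
    rw [fderiv_metricInChart_I_left hg hq, fderiv_metricInChart_I hg hq]
  rw [fderiv_koszul hg hy, fderiv_koszul hg hy, fderiv_fderiv_metricInChart_I hg hy,
    fderiv_fderiv_metricInChart_I hg hy, fderiv_fderiv_metricInChart_I hg hy, h.fderiv_eq]

/-- Differentiate `g(Γ(u, v), b) = koszul(u, v)(b)`. For both the metric and the Koszul form, a
factor `I` on the direction can be moved onto `b`. The remaining term must obey the same rule, and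
by nondegeneracy the derivative of `Γ(u, v)` commutes with `I`. -/
theorem differentiableAt_christoffel (hy : y ∈ (chartAt E x₀).target) (u v : E) :
    DifferentiableAt ℂ (fun q => christoffel g x₀ q u v) y := by
  have hd : DifferentiableAt ℝ (fun q => christoffel g x₀ q u v) y :=
    (contDiffAt_christoffel hg hy u v).differentiableAt (by simp)
  have key : ∀ a b, fderiv ℝ (fun q => koszul g x₀ q u v b) y a =
      fderiv ℝ (metricInChart g x₀) y a (christoffel g x₀ y u v) b +
        metricInChart g x₀ y (fderiv ℝ (fun q => christoffel g x₀ q u v) y a) b := by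
    intro a b
    have h : (fun q => koszul g x₀ q u v b) =ᶠ[𝓝 y]
        fun q => metricInChart g x₀ q (christoffel g x₀ q u v) b := by
      filter_upwards [(chartAt E x₀).open_target.mem_nhds hy] with q hq
      exact (metricInChart_christoffel hg hq u v b).symm
    have h1 := ((differentiableAt_metricInChart hg hy).hasFDerivAt.clm_apply
      hd.hasFDerivAt).clm_apply (hasFDerivAt_const b y)
    rw [h.fderiv_eq, h1.fderiv]
    simp [add_comm]
  refine differentiableAt_complex_of_fderiv_real hd fun a => metricInChart_ext hg hy fun b => ?_
  have h1 := key (Complex.I • a) b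
  have h2 := key a (Complex.I • b)
  rw [fderiv_koszul_I hg hy, h2, fderiv_metricInChart_I_left hg hy,
    fderiv_metricInChart_I hg hy] at h1
  rw [metricInChart_I hg hy]
  linarith

theorem contDiffOn_christoffel (u v : E) :
    ContDiffOn ℂ ∞ (fun q => christoffel g x₀ q u v) (chartAt E x₀).target :=
  contDiffOn_complex_of_real (chartAt E x₀).open_target
    (fun _ hq => (contDiffAt_christoffel hg hq u v).contDiffWithinAt)
    (fun _ hq => (differentiableAt_christoffel hg hq u v).differentiableWithinAt)

theorem christoffel_smul_right_complex (hy : y ∈ (chartAt E x₀).target) (c : ℂ) (u v : E) :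
    christoffel g x₀ y u (c • v) = c • christoffel g x₀ y u v := by
  have h1 : ∀ w : E, c • w = c.re • w + c.im • (Complex.I • w) := by
    intro w
    conv_lhs => rw [← Complex.re_add_im c]
    rw [add_smul, mul_smul]; rfl
  rw [h1, h1, christoffel_add_right hg hy, christoffel_smul_right hg hy,
    christoffel_smul_right hg hy, christoffel_I_right hg hy]

theorem exists_christoffel_bilin (hy : y ∈ (chartAt E x₀).target) :
    ∃ b : E →L[ℂ] E →L[ℂ] E, ∀ u v, christoffel g x₀ y u v = b u v := by
  let b : E →ₗ[ℂ] E →ₗ[ℂ] E := LinearMap.mk₂ ℂ (fun u v => christoffel g x₀ y u v)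
    (fun u u' v => by
      rw [christoffel_symm hg hy, christoffel_add_right hg hy, christoffel_symm hg hy v,
        christoffel_symm hg hy v])
    (fun c u v => by
      rw [christoffel_symm hg hy, christoffel_smul_right_complex hg hy, christoffel_symm hg hy v])
    (fun u v v' => christoffel_add_right hg hy u v v')
    (fun c u v => christoffel_smul_right_complex hg hy c u v)
  exact ⟨LinearMap.toContinuousLinearMap
    ((LinearMap.toContinuousLinearMap (𝕜 := ℂ) (E := E) (F' := E)).toLinearMap ∘ₗ b),
    fun u v => rfl⟩

omit hg in
open Classical in
/-- The Christoffel symbols of an anti-Kaehler metric, as a complex bilinear map. -/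
noncomputable def chrC (g : BilinField E M) (x₀ : M) (y : E) : E →L[ℂ] E →L[ℂ] E :=
  if h : ∃ b : E →L[ℂ] E →L[ℂ] E, ∀ u v, christoffel g x₀ y u v = b u v then h.choose else 0

theorem chrC_apply (hy : y ∈ (chartAt E x₀).target) (u v : E) :
    chrC g x₀ y u v = christoffel g x₀ y u v := by
  have h := exists_christoffel_bilin hg hy
  rw [chrC, dif_pos h]
  exact (h.choose_spec u v).symm

theorem contDiffOn_chrC : ContDiffOn ℂ ∞ (chrC g x₀) (chartAt E x₀).target := by
  rw [contDiffOn_clm_apply]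
  intro u
  rw [contDiffOn_clm_apply]
  intro v
  exact (contDiffOn_christoffel hg u v).congr fun q hq => chrC_apply hg hq u v

theorem contDiffAt_chrC (hy : y ∈ (chartAt E x₀).target) : ContDiffAt ℂ ∞ (chrC g x₀) y :=
  (contDiffOn_chrC hg).contDiffAt ((chartAt E x₀).open_target.mem_nhds hy)

theorem differentiableAt_chrC (hy : y ∈ (chartAt E x₀).target) :
    DifferentiableAt ℂ (chrC g x₀) y :=
  (contDiffAt_chrC hg hy).differentiableAt (by simp)

theorem differentiableAt_fderiv_chrC (hy : y ∈ (chartAt E x₀).target) :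
    DifferentiableAt ℂ (fderiv ℂ (chrC g x₀)) y :=
  ((contDiffAt_chrC hg hy).fderiv_right (m := ∞) (by exact le_rfl)).differentiableAt (by simp)

omit hg in
/-- The curvature tensor in a chart, in terms of the complex Christoffel symbols. -/
noncomputable def curvC (g : BilinField E M) (x₀ : M) (y u v w : E) : E :=
  fderiv ℂ (chrC g x₀) y u v w - fderiv ℂ (chrC g x₀) y v u w
    + chrC g x₀ y u (chrC g x₀ y v w) - chrC g x₀ y v (chrC g x₀ y u w)

theorem curvatureInChart_eq (hy : y ∈ (chartAt E x₀).target) (u v w : E) :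
    curvatureInChart g x₀ y u v w = curvC g x₀ y u v w := by
  have h : ∀ u v w, fderiv ℝ (fun q => christoffel g x₀ q v w) y u =
      fderiv ℂ (chrC g x₀) y u v w := by
    intro u v w
    have h1 : (fun q => christoffel g x₀ q v w) =ᶠ[𝓝 y] fun q => chrC g x₀ q v w := by
      filter_upwards [(chartAt E x₀).open_target.mem_nhds hy] with q hq
      exact (chrC_apply hg hq v w).symm
    have h2 := ((differentiableAt_chrC hg hy).hasFDerivAt.clm_apply
      (hasFDerivAt_const v y)).clm_apply (hasFDerivAt_const w y)
    rw [h1.fderiv_eq, fderiv_real_eq h2.differentiableAt, h2.fderiv]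
    simp
  rw [curvatureInChart, curvC, h, h, chrC_apply hg hy, chrC_apply hg hy, chrC_apply hg hy,
    chrC_apply hg hy]

/-! ### The covariant derivative along maps in charts -/

section Along

variable {X : Type*} [NormedAddCommGroup X] [NormedSpace ℝ X] {f : X → M} {p : X}
  {V : (q : X) → Tan E (f q)}

/-- `covDerivAlong` uses the preferred chart at `f p`. The product rule for the changed coordinates
of `V` produces a derivative of the Jacobian, which is exactly the inhomogeneous term of
`christoffel_transform`; so the same formula holds in every chart. -/
theorem coord_covDerivAlong (hf : ContinuousAt f p) (hp : f p ∈ (chartAt E x₀).source)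
    (hfd : DifferentiableAt ℝ (fun q => chartAt E x₀ (f q)) p)
    (hV : DifferentiableAt ℝ (fun q => coord (chartAt E x₀) (f q) (V q)) p) (ξ : X) :
    coord (chartAt E x₀) (f p) (covDerivAlong g f V p ξ) =
      fderiv ℝ (fun q => coord (chartAt E x₀) (f q) (V q)) p ξ +
        chrC g x₀ (chartAt E x₀ (f p)) (fderiv ℝ (fun q => chartAt E x₀ (f q)) p ξ)
          (coord (chartAt E x₀) (f p) (V p)) := by
  set x := f p with hx
  set φ := chartAt E x₀ with hφ
  set χ := chartAt E x with hχ
  have hpx : x ∈ χ.source := mem_chart_source E x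
  have hφm : φ ∈ IsManifold.maximalAtlas 𝓘(ℂ, E) ω M := chart_mem x₀
  have hχm : χ ∈ IsManifold.maximalAtlas 𝓘(ℂ, E) ω M := chart_mem x
  have hy : χ x ∈ χ.target := χ.map_source hpx
  have hy' : χ.symm (χ x) ∈ φ.source := by rwa [χ.left_inv hpx]
  have hfd' : DifferentiableAt ℝ (fun q => χ (f q)) p :=
    differentiableAt_chart_change hφm hχm hf hp hpx hfd
  have hV' : DifferentiableAt ℝ (fun q => coord χ (f q) (V q)) p := by
    refine DifferentiableAt.congr_of_eventuallyEq ?_ (eventually_coord_change hφm hχm hf hp hpx)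
    have h1 : DifferentiableAt ℝ (jac φ χ) (φ (f p)) :=
      ((contDiffAt_jac hφm hχm (φ.map_source hp) (by rwa [φ.left_inv hp])).differentiableAt
        (by simp)).restrictScalars ℝ
    have h2 : DifferentiableAt ℝ (fun q => jac φ χ (φ (f q))) p :=
      DifferentiableAt.comp (g := jac φ χ) p h1 hfd
    let L : (E →L[ℂ] E) →L[ℝ] (E →L[ℝ] E) := ContinuousLinearMap.restrictScalarsL ℂ E E ℝ ℝ
    exact (L.differentiableAt.comp p h2).clm_apply hV
  have hJ : DifferentiableAt ℝ (jac χ φ) (χ x) :=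
    ((contDiffAt_jac hχm hφm hy hy').differentiableAt (by simp)).restrictScalars ℝ
  have hJa : ∀ a v, fderiv ℝ (fun q => jac χ φ q v) (χ x) a = fderiv ℝ (jac χ φ) (χ x) a v := by
    intro a v
    have hJ' := (contDiffAt_jac hχm hφm hy hy').differentiableAt (by simp)
    have h2 := hJ'.hasFDerivAt.clm_apply (hasFDerivAt_const v (χ x))
    rw [fderiv_real_eq h2.differentiableAt, h2.fderiv, fderiv_real_eq hJ']
    simp
  have h1 : fderiv ℝ (fun q => coord φ (f q) (V q)) p ξ =
      fderiv ℝ (fun q => jac χ φ q (coord χ (f p) (V p))) (χ x)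
        (fderiv ℝ (fun q => χ (f q)) p ξ) +
      jac χ φ (χ x) (fderiv ℝ (fun q => coord χ (f q) (V q)) p ξ) := by
    let L : (E →L[ℂ] E) →L[ℝ] (E →L[ℝ] E) := ContinuousLinearMap.restrictScalarsL ℂ E E ℝ ℝ
    have h2 := HasFDerivAt.comp (g := jac χ φ) p hJ.hasFDerivAt hfd'.hasFDerivAt
    have h3 := (L.hasFDerivAt.comp p h2).clm_apply hV'.hasFDerivAt
    have h4 : (fun q => coord φ (f q) (V q)) =ᶠ[𝓝 p]
        fun q => (L ∘ jac χ φ ∘ fun q => χ (f q)) q (coord χ (f q) (V q)) :=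
      eventually_coord_change hχm hφm hf hpx hp
    rw [h4.fderiv_eq, h3.fderiv, hJa]
    exact add_comm _ _
  have hpush := coord_push hχm hf hpx hfd' ξ
  have hcov : coord φ x (covDerivAlong g f V p ξ) = jac χ φ (χ x)
      (fderiv ℝ (fun q => coord χ (f q) (V q)) p ξ +
        christoffel g x (χ x) (fderiv ℝ (fun q => χ (f q)) p ξ) (coord χ (f p) (V p))) := by
    rw [coord_eq_jac hφm hp, ← hpush]
    rw [show coord χ (f p) (V p) = comp (f p) (V p) from coord_chartAt _ _,
      show coord χ (f p) (push E f p ξ) = comp (f p) (push E f p ξ) from coord_chartAt _ _]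
    rfl
  have hchr := christoffel_transform hg (x₀ := x) (x₁ := x₀) hy hy'
    (fderiv ℝ (fun q => χ (f q)) p ξ) (coord χ (f p) (V p))
  rw [← hφ, ← hχ, χ.left_inv hpx] at hchr
  rw [hcov, map_add, hchr, h1, fderiv_chart_change hχm hφm hf hpx hp hfd' ξ,
    chrC_apply hg (φ.map_source hp), coord_change hχm hφm hpx hp (V p)]
  abel

end Along

end Christoffel

/-! ### Curvature as a commutator, and its chart independence -/

section Curvature

variable {E : Type*} [NormedAddCommGroup E] [NormedSpace ℂ E]

/-- The product rule for a holomorphic field of complex bilinear maps along real differentiable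
maps. -/
theorem exists_hasFDerivAt_bilin {X : Type*} [NormedAddCommGroup X] [NormedSpace ℝ X]
    {B : E → E →L[ℂ] E →L[ℂ] E} {h u w : X → E} {p : X} {h' u' w' : X →L[ℝ] E}
    (hB : DifferentiableAt ℂ B (h p)) (hh : HasFDerivAt h h' p) (hu : HasFDerivAt u u' p)
    (hw : HasFDerivAt w w' p) :
    ∃ D : X →L[ℝ] E, HasFDerivAt (fun q => B (h q) (u q) (w q)) D p ∧
      ∀ ξ, D ξ = fderiv ℂ B (h p) (h' ξ) (u p) (w p) + B (h p) (u' ξ) (w p) +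
        B (h p) (u p) (w' ξ) := by
  let x : E × E × E := (h p, u p, w p)
  have h1 : HasFDerivAt (𝕜 := ℂ) (fun x : E × E × E => x.1) (ContinuousLinearMap.fst ℂ E (E × E)) x :=
    hasFDerivAt_fst
  have h2 : HasFDerivAt (𝕜 := ℂ) (fun x : E × E × E => x.2.1) ((ContinuousLinearMap.fst ℂ E E).comp
    (ContinuousLinearMap.snd ℂ E (E × E))) x := hasFDerivAt_fst.comp x hasFDerivAt_snd
  have h3 : HasFDerivAt (𝕜 := ℂ) (fun x : E × E × E => x.2.2) ((ContinuousLinearMap.snd ℂ E E).comp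
    (ContinuousLinearMap.snd ℂ E (E × E))) x := hasFDerivAt_snd.comp x hasFDerivAt_snd
  have hB' : HasFDerivAt (fun x : E × E × E => B x.1) ((fderiv ℂ B (h p)).comp
    (ContinuousLinearMap.fst ℂ E (E × E))) x := HasFDerivAt.comp (g := B) x hB.hasFDerivAt h1
  have h4 := ((hB'.clm_apply h2).clm_apply h3).restrictScalars ℝ
  have h5 : HasFDerivAt (fun q => (h q, u q, w q)) (h'.prod (u'.prod w')) p :=
    hh.prodMk (hu.prodMk hw)
  refine ⟨_, HasFDerivAt.comp p (f := fun q => (h q, u q, w q)) h4 h5, fun ξ => ?_⟩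
  show B (h p) (u p) (w' ξ) + (B (h p) (u' ξ) + fderiv ℂ B (h p) (h' ξ) (u p)) (w p) = _
  rw [add_apply]
  abel

variable {M : Type*} [TopologicalSpace M] [ChartedSpace E M] [IsManifold 𝓘(ℂ, E) ω M]
  {g : BilinField E M} [FiniteDimensional ℂ E] (hg : IsAntiKaehler g) {x₀ : M} {y : E}

include hg

/-- The commutator of covariant derivatives along a map is the curvature, in every chart. -/
theorem coord_commutator {X : Type*} [NormedAddCommGroup X] [NormedSpace ℝ X] {f : X → M} {p : X}
    {V : (q : X) → Tan E (f q)} (hf : ∀ᶠ q in 𝓝 p, ContinuousAt f q)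
    (hp : f p ∈ (chartAt E x₀).source)
    (hfd : ContDiffAt ℝ 2 (fun q => chartAt E x₀ (f q)) p)
    (hV : ContDiffAt ℝ 2 (fun q => coord (chartAt E x₀) (f q) (V q)) p) (ξ η : X) :
    coord (chartAt E x₀) (f p) (covDerivAlong g f (fun q => covDerivAlong g f V q η) p ξ) -
      coord (chartAt E x₀) (f p) (covDerivAlong g f (fun q => covDerivAlong g f V q ξ) p η) =
      curvC g x₀ (chartAt E x₀ (f p)) (fderiv ℝ (fun q => chartAt E x₀ (f q)) p ξ)
        (fderiv ℝ (fun q => chartAt E x₀ (f q)) p η) (coord (chartAt E x₀) (f p) (V p)) := by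
  set φ := chartAt E x₀ with hφ
  set h : X → E := fun q => φ (f q) with hh
  set W : X → E := fun q => coord φ (f q) (V q) with hW
  have hf0 : ContinuousAt f p := hf.self_of_nhds
  have hy : h p ∈ φ.target := φ.map_source hp
  have hC : ∀ η, (fun q => coord φ (f q) (covDerivAlong g f V q η)) =ᶠ[𝓝 p]
      fun q => fderiv ℝ W q η + chrC g x₀ (h q) (fderiv ℝ h q η) (W q) := by
    intro η
    filter_upwards [hf, hf0.preimage_mem_nhds (φ.open_source.mem_nhds hp),
      hfd.eventually (by simp), hV.eventually (by simp)] with q h1 h2 h3 h4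
    exact coord_covDerivAlong hg h1 h2 (h3.differentiableAt (by simp))
      (h4.differentiableAt (by simp)) η
  have hDh : ∀ η, DifferentiableAt ℝ (fun q => fderiv ℝ h q η) p := fun η =>
    ((hfd.fderiv_right (m := 1) le_rfl).differentiableAt one_ne_zero).clm_apply
      (differentiableAt_const η)
  have hDW : ∀ η, DifferentiableAt ℝ (fun q => fderiv ℝ W q η) p := fun η =>
    ((hV.fderiv_right (m := 1) le_rfl).differentiableAt one_ne_zero).clm_apply
      (differentiableAt_const η)
  have hWd := hV.differentiableAt (by simp)
  have hCd : ∀ η ξ, coord φ (f p) (covDerivAlong g f (fun q => covDerivAlong g f V q η) p ξ) =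
      fderiv ℝ (fun q => fderiv ℝ W q η) p ξ +
        (fderiv ℂ (chrC g x₀) (h p) (fderiv ℝ h p ξ) (fderiv ℝ h p η) (W p) +
          chrC g x₀ (h p) (fderiv ℝ (fun q => fderiv ℝ h q η) p ξ) (W p) +
          chrC g x₀ (h p) (fderiv ℝ h p η) (fderiv ℝ W p ξ)) +
        chrC g x₀ (h p) (fderiv ℝ h p ξ) (fderiv ℝ W p η +
          chrC g x₀ (h p) (fderiv ℝ h p η) (W p)) := by
    intro η ξ
    obtain ⟨D, hD, hDξ⟩ := exists_hasFDerivAt_bilin (differentiableAt_chrC hg hy)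
      (hfd.differentiableAt (by simp)).hasFDerivAt (hDh η).hasFDerivAt hWd.hasFDerivAt
    have h1 := (hDW η).hasFDerivAt.add hD
    have h2 := h1.congr_of_eventuallyEq (hC η)
    rw [coord_covDerivAlong hg hf0 hp (hfd.differentiableAt (by simp)) h2.differentiableAt,
      h2.fderiv, add_apply, hDξ]
    exact congrArg (fun c => _ + chrC g x₀ (h p) (fderiv ℝ h p ξ) c) (hC η).self_of_nhds
  -- The second derivatives of `h` and `W`, and the sum of the two mixed products of their first
  -- derivatives, are symmetric in `ξ` and `η` and drop out.
  rw [hCd, hCd, curvC, fderiv_fderiv_symm hfd η ξ, fderiv_fderiv_symm hV η ξ, map_add, map_add]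
  abel

/-- The commutator of covariant derivatives along the inverse chart `φ.symm` is a tangent vector
independent of charts. Computing it in the preferred chart at `x` identifies it with the curvature;
computing it in the chart at `x₀` gives the formula there. -/
theorem coord_curvature {x : M} (hx : x ∈ (chartAt E x₀).source) (u v w : Tan E x) :
    coord (chartAt E x₀) x (curvature g x u v w) =
      curvC g x₀ (chartAt E x₀ x) (coord (chartAt E x₀) x u) (coord (chartAt E x₀) x v)
        (coord (chartAt E x₀) x w) := by
  obtain ⟨y, hy, rfl⟩ : ∃ y ∈ (chartAt E x₀).target, (chartAt E x₀).symm y = x :=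
    ⟨_, (chartAt E x₀).map_source hx, (chartAt E x₀).left_inv hx⟩
  revert u v w
  set φ := chartAt E x₀ with hφ
  set x := φ.symm y with hxy
  intro u v w
  set χ := chartAt E x with hχ
  have hφm : φ ∈ IsManifold.maximalAtlas 𝓘(ℂ, E) ω M := chart_mem x₀
  have hχm : χ ∈ IsManifold.maximalAtlas 𝓘(ℂ, E) ω M := chart_mem x
  have hpx : x ∈ χ.source := mem_chart_source E x
  have hV : ∀ q, ∃ a : Tan E (φ.symm q), q ∈ φ.target → coord φ _ a = coord φ x w := by
    intro q
    by_cases h : q ∈ φ.target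
    · obtain ⟨a, ha⟩ := coord_surjective hφm (φ.map_target h) (coord φ x w)
      exact ⟨a, fun _ => ha⟩
    · exact ⟨0, fun h' => absurd h' h⟩
  choose V hV using hV
  have hVy : V y = w := coord_injective hφm hx (hV y hy)
  have hf : ∀ᶠ q in 𝓝 y, ContinuousAt φ.symm q := by
    filter_upwards [φ.open_target.mem_nhds hy] with q hq
    exact φ.continuousAt_symm hq
  have hf0 : ContinuousAt φ.symm y := hf.self_of_nhds
  have h0 : (fun q => φ (φ.symm q)) =ᶠ[𝓝 y] id := by
    filter_upwards [φ.open_target.mem_nhds hy] with q hq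
    exact φ.right_inv hq
  have hV0 : (fun q => coord φ (φ.symm q) (V q)) =ᶠ[𝓝 y] fun _ => coord φ x w := by
    filter_upwards [φ.open_target.mem_nhds hy] with q hq
    exact hV q hq
  have hψ := contDiffAt_transition_real hφm hχm hy hpx
  have hV1 : ContDiffAt ℝ 2 (fun q => coord χ (φ.symm q) (V q)) y := by
    have h1 : ContDiffAt ℝ 2 (fun q => jac φ χ q (coord φ x w)) y :=
      (((contDiffAt_jac hφm hχm hy hpx).clm_apply contDiffAt_const).restrict_scalars ℝ).of_le le_top
    refine h1.congr_of_eventuallyEq ?_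
    filter_upwards [φ.open_target.mem_nhds hy, hf0.preimage_mem_nhds (χ.open_source.mem_nhds hpx)]
      with q hq hq'
    rw [coord_change hφm hχm (φ.map_target hq) hq', hV q hq, φ.right_inv hq]
  set ξ := coord φ x u with hξ
  set η := coord φ x v with hη
  have hc0 := coord_commutator hg (V := V) hf hx (contDiffAt_id.congr_of_eventuallyEq h0)
    (contDiffAt_const.congr_of_eventuallyEq hV0) ξ η
  have hc1 := coord_commutator (x₀ := x) hg (V := V) hf hpx (hψ.of_le le_top) hV1 ξ η
  have hd : ∀ a : Tan E x, fderiv ℝ (fun q => χ (φ.symm q)) y (coord φ x a) = coord χ x a := by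
    intro a
    have h1 : fderiv ℝ (fun q => χ (φ.symm q)) y (coord φ x a) = jac φ χ y (coord φ x a) :=
      fderiv_transition_apply hφm hχm hy hpx _
    rw [h1, coord_change hφm hχm hx hpx, hxy, φ.right_inv hy]
  rw [← hφ, h0.fderiv_eq, fderiv_id, ← hxy, hVy] at hc0
  rw [← hxy, ← hχ, hVy, hξ, hη, hd, hd] at hc1
  set Z₁ := covDerivAlong g φ.symm (fun q => covDerivAlong g φ.symm V q η) y ξ
  set Z₂ := covDerivAlong g φ.symm (fun q => covDerivAlong g φ.symm V q ξ) y η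
  have hsub : ∀ ψ : OpenPartialHomeomorph M E,
      coord ψ x (Z₁ - Z₂) = coord ψ x Z₁ - coord ψ x Z₂ := fun ψ =>
    map_sub (mfderiv 𝓘(ℝ, E) 𝓘(ℝ, E) ψ x) Z₁ Z₂
  have hcurv : coord χ x (curvature g x u v w) =
      curvC g x (χ x) (coord χ x u) (coord χ x v) (coord χ x w) := by
    rw [coord_chartAt, coord_chartAt, coord_chartAt, coord_chartAt]
    exact curvatureInChart_eq hg (mem_chart_target E x) _ _ _
  have : Z₁ - Z₂ = curvature g x u v w := by
    refine coord_injective hχm hpx ?_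
    rw [hcurv, hsub, ← hc1]
  rw [← this, hsub]
  exact hc0

end Curvature

/-! ### Geodesics -/

section Geodesic

variable {E : Type*} [NormedAddCommGroup E] [NormedSpace ℂ E]
  {M : Type*} [TopologicalSpace M] [ChartedSpace E M] [IsManifold 𝓘(ℂ, E) ω M]
  {g : BilinField E M} [FiniteDimensional ℂ E] (hg : IsAntiKaehler g)

/-- The curve `c` satisfies the geodesic equation at time `t`. -/
def IsGeodesicAt (g : BilinField E M) (c : ℝ → M) (t : ℝ) : Prop :=
  (∀ᶠ s in 𝓝 t, ContinuousAt c s) ∧ ContDiffAt ℝ 2 (fun s => chartAt E (c t) (c s)) t ∧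
    covDerivAlong g c (velocity E c) t 1 = 0

theorem IsGeodesicAt.continuousAt {c : ℝ → M} {t : ℝ} (h : IsGeodesicAt g c t) :
    ContinuousAt c t := h.1.self_of_nhds

theorem eventually_coord_velocity {c : ℝ → M} {t : ℝ} (hc : ∀ᶠ s in 𝓝 t, ContinuousAt c s) {x₀ : M}
    (hx : c t ∈ (chartAt E x₀).source) (hd : ContDiffAt ℝ 2 (fun s => chartAt E x₀ (c s)) t) :
    (fun s => coord (chartAt E x₀) (c s) (velocity E c s)) =ᶠ[𝓝 t]
      deriv fun s => chartAt E x₀ (c s) := by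
  filter_upwards [hc, hc.self_of_nhds.preimage_mem_nhds ((chartAt E x₀).open_source.mem_nhds hx),
    hd.eventually (by simp)] with s h1 h2 h3
  rw [velocity, coord_push (chart_mem x₀) h1 h2 (h3.differentiableAt (by simp))]
  exact fderiv_apply_one_eq_deriv

omit [FiniteDimensional ℂ E] in
theorem differentiableAt_deriv_of_contDiffAt {f : ℝ → E} {t : ℝ} (hf : ContDiffAt ℝ 2 f t) :
    DifferentiableAt ℝ (deriv f) t := by
  have h := ((hf.fderiv_right (m := 1) le_rfl).differentiableAt one_ne_zero).clm_apply
    (differentiableAt_const (1 : ℝ))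
  have e : deriv f = fun s => fderiv ℝ f s 1 := funext fun s => fderiv_apply_one_eq_deriv.symm
  rwa [e]

include hg

/-- Turns the geodesic condition, defined in the moving chart at `c t`, into a second order equation
in one fixed chart, to which theorems on differential equations apply. -/
theorem isGeodesicAt_iff {c : ℝ → M} {t : ℝ} (hc : ∀ᶠ s in 𝓝 t, ContinuousAt c s) {x₀ : M}
    (hx : c t ∈ (chartAt E x₀).source) :
    IsGeodesicAt g c t ↔ ContDiffAt ℝ 2 (fun s => chartAt E x₀ (c s)) t ∧
      deriv (deriv fun s => chartAt E x₀ (c s)) t + chrC g x₀ (chartAt E x₀ (c t))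
        (deriv (fun s => chartAt E x₀ (c s)) t) (deriv (fun s => chartAt E x₀ (c s)) t) = 0 := by
  have hc0 := hc.self_of_nhds
  have key : ContDiffAt ℝ 2 (fun s => chartAt E x₀ (c s)) t →
      coord (chartAt E x₀) (c t) (covDerivAlong g c (velocity E c) t 1) =
      deriv (deriv fun s => chartAt E x₀ (c s)) t + chrC g x₀ (chartAt E x₀ (c t))
        (deriv (fun s => chartAt E x₀ (c s)) t) (deriv (fun s => chartAt E x₀ (c s)) t) := by
    intro hd
    have hv := eventually_coord_velocity hc hx hd
    have hdd : DifferentiableAt ℝ (deriv fun s => chartAt E x₀ (c s)) t :=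
      differentiableAt_deriv_of_contDiffAt hd
    rw [coord_covDerivAlong hg hc0 hx (hd.differentiableAt (by simp))
      (hdd.congr_of_eventuallyEq hv), hv.fderiv_eq, fderiv_apply_one_eq_deriv,
      fderiv_apply_one_eq_deriv]
    exact congrArg (fun w => _ + chrC g x₀ _ _ w) hv.self_of_nhds
  constructor
  · rintro ⟨-, h2, h3⟩
    have hd : ContDiffAt ℝ 2 (fun s => chartAt E x₀ (c s)) t :=
      contDiffAt_chart_change (n := 2) (chart_mem (c t)) (chart_mem x₀) hc0 (mem_chart_source E _)
        hx h2
    refine ⟨hd, ?_⟩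
    rw [← key hd, h3, coord_zero]
  · rintro ⟨h1, h2⟩
    refine ⟨hc, contDiffAt_chart_change (n := 2) (chart_mem x₀) (chart_mem (c t)) hc0 hx
      (mem_chart_source E _) h1, ?_⟩
    rw [← coord_eq_zero (chart_mem x₀) hx, key h1, h2]

omit hg in
theorem IsGeodesic.isGeodesicAt {c : ℝ → M} (h : IsGeodesic g c) (t : ℝ) : IsGeodesicAt g c t := by
  refine ⟨Eventually.of_forall fun s => h.1.continuous.continuousAt, ?_, h.2 t⟩
  have := (contMDiffAt_iff.1 (h.1 t)).2
  simp only [mfld_simps, contDiffWithinAt_univ] at this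
  exact this.of_le two_le_infty

/-- The geodesic vector field in a chart. -/
noncomputable def geodField (g : BilinField E M) (x₀ : M) (x : E × E) : E × E :=
  (x.2, -chrC g x₀ x.1 x.2 x.2)

theorem contDiffAt_geodField {x₀ : M} {x : E × E} (hx : x.1 ∈ (chartAt E x₀).target) :
    ContDiffAt ℂ ∞ (geodField g x₀) x := by
  have h1 : ContDiffAt ℂ ∞ (fun x : E × E => chrC g x₀ x.1) x :=
    ContDiffAt.comp (g := chrC g x₀) x (contDiffAt_chrC hg hx) contDiffAt_fst
  exact contDiffAt_snd.prodMk ((h1.clm_apply contDiffAt_snd).clm_apply contDiffAt_snd).neg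

theorem exists_lipschitzOnWith_geodField {x₀ : M} {x : E × E} (hx : x.1 ∈ (chartAt E x₀).target) :
    ∃ K, ∃ U ∈ 𝓝 x, LipschitzOnWith K (geodField g x₀) U :=
  (((contDiffAt_geodField hg hx).restrict_scalars ℝ).of_le
    (WithTop.coe_le_coe.2 (le_top (a := (1 : ℕ∞))))).exists_lipschitzOnWith

theorem IsGeodesicAt.hasDerivAt {c : ℝ → M} {t : ℝ} (h : IsGeodesicAt g c t) {x₀ : M}
    (hx : c t ∈ (chartAt E x₀).source) :
    HasDerivAt (fun s => (chartAt E x₀ (c s), deriv (fun s => chartAt E x₀ (c s)) s))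
      (geodField g x₀ (chartAt E x₀ (c t), deriv (fun s => chartAt E x₀ (c s)) t)) t := by
  obtain ⟨h1, h2⟩ := (isGeodesicAt_iff hg h.1 hx).1 h
  have h3 : HasDerivAt (deriv fun s => chartAt E x₀ (c s)) _ t :=
    (differentiableAt_deriv_of_contDiffAt h1).hasDerivAt
  rw [eq_neg_of_add_eq_zero_left h2] at h3
  exact (h1.differentiableAt (by simp)).hasDerivAt.prodMk h3

/-- Local uniqueness of geodesics. -/
theorem eventuallyEq_of_isGeodesicAt {c₁ c₂ : ℝ → M} {t : ℝ}
    (h₁ : ∀ᶠ s in 𝓝 t, IsGeodesicAt g c₁ s) (h₂ : ∀ᶠ s in 𝓝 t, IsGeodesicAt g c₂ s) {x₀ : M}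
    (hx : c₁ t ∈ (chartAt E x₀).source) (h : c₁ t = c₂ t)
    (hd : deriv (fun s => chartAt E x₀ (c₁ s)) t = deriv (fun s => chartAt E x₀ (c₂ s)) t) :
    c₁ =ᶠ[𝓝 t] c₂ := by
  have hx' : c₂ t ∈ (chartAt E x₀).source := h ▸ hx
  have hs₁ := h₁.self_of_nhds.continuousAt.preimage_mem_nhds
    ((chartAt E x₀).open_source.mem_nhds hx)
  have hs₂ := h₂.self_of_nhds.continuousAt.preimage_mem_nhds
    ((chartAt E x₀).open_source.mem_nhds hx')
  obtain ⟨K, U, hU, hK⟩ := exists_lipschitzOnWith_geodField hg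
    (x := (chartAt E x₀ (c₁ t), deriv (fun s => chartAt E x₀ (c₁ s)) t))
    ((chartAt E x₀).map_source hx)
  have hU' : U ∈ 𝓝 (chartAt E x₀ (c₂ t), deriv (fun s => chartAt E x₀ (c₂ s)) t) := by
    rw [← h, ← hd]; exact hU
  have e₁ := (h₁.self_of_nhds.hasDerivAt hg hx).continuousAt.preimage_mem_nhds hU
  have e₂ := (h₂.self_of_nhds.hasDerivAt hg hx').continuousAt.preimage_mem_nhds hU'
  have key := ODE_solution_unique_of_eventually (v := fun _ => geodField g x₀) (s := fun _ => U)
    (t₀ := t) (K := K)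
    (f := fun s => (chartAt E x₀ (c₁ s), deriv (fun s => chartAt E x₀ (c₁ s)) s))
    (g := fun s => (chartAt E x₀ (c₂ s), deriv (fun s => chartAt E x₀ (c₂ s)) s))
    (Eventually.of_forall fun _ => hK)
    (by filter_upwards [h₁, hs₁, e₁] with s a1 a2 a3 using ⟨a1.hasDerivAt hg a2, a3⟩)
    (by filter_upwards [h₂, hs₂, e₂] with s a1 a2 a3 using ⟨a1.hasDerivAt hg a2, a3⟩)
    (by rw [h, hd])
  filter_upwards [key, hs₁, hs₂] with s a1 a2 a3
  exact (chartAt E x₀).injOn a2 a3 (congrArg Prod.fst a1)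

/-- Uniqueness of geodesics on an open connected set of times. -/
theorem eqOn_of_isGeodesicAt [T2Space M] {c₁ c₂ : ℝ → M} {s : Set ℝ} (hs : IsOpen s)
    (hs' : IsPreconnected s) (h₁ : ∀ t ∈ s, IsGeodesicAt g c₁ t)
    (h₂ : ∀ t ∈ s, IsGeodesicAt g c₂ t) {t₀ : ℝ} (ht₀ : t₀ ∈ s) (h₀ : c₁ =ᶠ[𝓝 t₀] c₂) :
    EqOn c₁ c₂ s := by
  set A : Set ℝ := {t | c₁ =ᶠ[𝓝 t] c₂} with hA
  have hAo : IsOpen A := by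
    rw [isOpen_iff_mem_nhds]
    intro t ht
    exact eventually_eventually_nhds.2 ht
  have hsub : s ⊆ A := by
    refine hs'.subset_of_closure_inter_subset hAo ⟨t₀, ht₀, h₀⟩ ?_
    rintro t ⟨htA, hts⟩
    -- At a limit of times of local agreement the points coincide because `M` is Hausdorff, and the
    -- coordinate velocities coincide by continuity; local uniqueness then gives agreement near the
    -- limit.
    have hfreq : ∃ᶠ u in 𝓝 t, c₁ =ᶠ[𝓝 u] c₂ := mem_closure_iff_frequently.1 htA
    have hct : c₁ t = c₂ t := by
      by_contra hne
      have hev := ((h₁ t hts).continuousAt.prodMk (h₂ t hts).continuousAt).eventually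
        (isClosed_diagonal.isOpen_compl.mem_nhds (show (c₁ t, c₂ t) ∈ (diagonal M)ᶜ from hne))
      obtain ⟨u, hu, hu'⟩ := (hfreq.and_eventually hev).exists
      exact hu' hu.self_of_nhds
    have hx : c₁ t ∈ (chartAt E (c₁ t)).source := mem_chart_source E _
    have hx' : c₂ t ∈ (chartAt E (c₁ t)).source := hct ▸ hx
    refine eventuallyEq_of_isGeodesicAt hg (eventually_of_mem (hs.mem_nhds hts) h₁)
      (eventually_of_mem (hs.mem_nhds hts) h₂) hx hct ?_
    by_contra hne
    have hd₁ := ((h₁ t hts).hasDerivAt hg hx).continuousAt.snd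
    have hd₂ := ((h₂ t hts).hasDerivAt hg hx').continuousAt.snd
    have hev := (hd₁.prodMk hd₂).eventually
      (isClosed_diagonal.isOpen_compl.mem_nhds (show (_, _) ∈ (diagonal E)ᶜ from hne))
    obtain ⟨u, hu, hu'⟩ := (hfreq.and_eventually hev).exists
    refine hu' (EventuallyEq.deriv_eq ?_)
    filter_upwards [hu] with r hr
    rw [hr]
  exact fun t ht => (hsub ht : c₁ =ᶠ[𝓝 t] c₂).self_of_nhds

/-- Rescaling time by `a` multiplies both the second derivative and the quadratic Christoffel term
by `a²`. -/
theorem IsGeodesicAt.comp_mul {c : ℝ → M} {a t : ℝ} (h : IsGeodesicAt g c (a * t)) :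
    IsGeodesicAt g (fun s => c (a * s)) t := by
  have hcont : ∀ᶠ s in 𝓝 t, ContinuousAt (fun s => c (a * s)) s := by
    have : Tendsto (fun s => a * s) (𝓝 t) (𝓝 (a * t)) := (continuous_const_mul a).continuousAt
    filter_upwards [this.eventually h.1] with s hs
    exact ContinuousAt.comp (g := c) hs (continuous_const_mul a).continuousAt
  have hx : c (a * t) ∈ (chartAt E (c (a * t))).source := mem_chart_source E _
  obtain ⟨h1, h2⟩ := (isGeodesicAt_iff hg h.1 hx).1 h
  refine (isGeodesicAt_iff hg hcont hx).2 ⟨?_, ?_⟩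
  · exact ContDiffAt.comp (g := fun s => chartAt E (c (a * t)) (c s)) t h1
      (contDiffAt_const.mul contDiffAt_id)
  · set y : ℝ → E := fun s => chartAt E (c (a * t)) (c s) with hy
    have d1 : (deriv fun s => y (a * s)) = fun s => a • deriv y (a * s) :=
      funext fun s => deriv_comp_mul_left a y s
    have d2 : deriv (fun s => a • deriv y (a * s)) t = a • a • deriv (deriv y) (a * t) := by
      have hdd : DifferentiableAt ℝ (deriv y) (a * t) :=
        differentiableAt_deriv_of_contDiffAt h1
      have := deriv_comp_mul_left a (deriv y) t
      rw [← this]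
      refine deriv_fun_const_smul a ?_
      exact DifferentiableAt.comp (g := deriv y) t hdd
        ((differentiableAt_const a).mul differentiableAt_id)
    show deriv (deriv fun s => y (a * s)) t + chrC g (c (a * t)) (y (a * t))
      (deriv (fun s => y (a * s)) t) (deriv (fun s => y (a * s)) t) = 0
    have hreal : ∀ v : E, a • v = (a : ℂ) • v := fun v => rfl
    rw [d1, d2]
    simp only [hreal, map_smul, smul_apply]
    rw [← smul_add, ← smul_add]
    have h2' : deriv (deriv y) (a * t) + chrC g (c (a * t)) (y (a * t)) (deriv y (a * t))
      (deriv y (a * t)) = 0 := h2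
    rw [h2', smul_zero, smul_zero]

end Geodesic

/-! ### Complex geodesics are holomorphic -/

section Holomorphic

variable {E : Type*} [NormedAddCommGroup E] [NormedSpace ℂ E]
  {M : Type*} [TopologicalSpace M] [ChartedSpace E M] [IsManifold 𝓘(ℂ, E) ω M]
  {g : BilinField E M}

/-- `γ` is holomorphic near `z`. -/
def IsHolAt (E : Type*) [NormedAddCommGroup E] [NormedSpace ℂ E] {M : Type*} [TopologicalSpace M]
    [ChartedSpace E M] (γ : ℂ → M) (z : ℂ) : Prop :=
  ∃ x₀ : M, ∃ y : ℂ → E, AnalyticAt ℂ y z ∧ y z ∈ (chartAt E x₀).target ∧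
    γ =ᶠ[𝓝 z] fun w => (chartAt E x₀).symm (y w)

theorem IsHolAt.continuousAt {γ : ℂ → M} {z : ℂ} (h : IsHolAt E γ z) : ContinuousAt γ z := by
  obtain ⟨x₀, y, h1, h2, h3⟩ := h
  refine ContinuousAt.congr ?_ h3.symm
  exact ContinuousAt.comp (g := (chartAt E x₀).symm) ((chartAt E x₀).continuousAt_symm h2)
    h1.continuousAt

theorem IsHolAt.analyticAt {γ : ℂ → M} {z : ℂ} (h : IsHolAt E γ z)
    {ψ : OpenPartialHomeomorph M E} (hψ : ψ ∈ IsManifold.maximalAtlas 𝓘(ℂ, E) ω M)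
    (hz : γ z ∈ ψ.source) : AnalyticAt ℂ (fun w => ψ (γ w)) z := by
  obtain ⟨x₀, y, h1, h2, h3⟩ := h
  have h4 : AnalyticAt ℂ (fun q => ψ ((chartAt E x₀).symm q)) (y z) :=
    (contDiffAt_transition (chart_mem x₀) hψ h2 (by
      have := h3.self_of_nhds
      simp only at this
      rwa [← this])).analyticAt
  have h5 : AnalyticAt ℂ (fun w => ψ ((chartAt E x₀).symm (y w))) z :=
    AnalyticAt.comp (g := fun q => ψ ((chartAt E x₀).symm q)) h4 h1
  refine h5.congr ?_
  filter_upwards [h3] with w hw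
  rw [hw]

theorem IsHolAt.eventually [FiniteDimensional ℂ E] {γ : ℂ → M} {z : ℂ} (h : IsHolAt E γ z) :
    ∀ᶠ w in 𝓝 z, IsHolAt E γ w := by
  have : CompleteSpace E := FiniteDimensional.complete ℂ E
  obtain ⟨x₀, y, h1, h2, h3⟩ := h
  filter_upwards [h1.eventually_analyticAt,
    h1.continuousAt.preimage_mem_nhds ((chartAt E x₀).open_target.mem_nhds h2),
    eventually_eventually_nhds.2 h3] with w h4 h5 h6
  exact ⟨x₀, y, h4, h5, h6⟩

theorem IsHolAt.congr {γ₁ γ₂ : ℂ → M} {z : ℂ} (h : IsHolAt E γ₁ z) (he : γ₂ =ᶠ[𝓝 z] γ₁) :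
    IsHolAt E γ₂ z := by
  obtain ⟨x₀, y, h1, h2, h3⟩ := h
  exact ⟨x₀, y, h1, h2, he.trans h3⟩

/-- Identity theorem for maps into `M` that agree on a ray. -/
theorem IsHolAt.eventuallyEq_of_ray {γ₁ γ₂ : ℂ → M} {a : ℂ} (ha : a ≠ 0) {k : ℝ}
    (h₁ : IsHolAt E γ₁ (k * a)) (h₂ : IsHolAt E γ₂ (k * a))
    (h : ∀ᶠ u : ℝ in 𝓝 k, γ₁ (u * a) = γ₂ (u * a)) : γ₁ =ᶠ[𝓝 (k * a : ℂ)] γ₂ := by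
  set ψ := chartAt E (γ₁ (k * a)) with hψ
  have hx₁ : γ₁ (k * a) ∈ ψ.source := mem_chart_source E _
  have hx₂ : γ₂ (k * a) ∈ ψ.source := h.self_of_nhds ▸ hx₁
  have a₁ := h₁.analyticAt (chart_mem _) hx₁
  have a₂ := h₂.analyticAt (chart_mem _) hx₂
  have ht : Tendsto (fun u : ℝ => (u * a : ℂ)) (𝓝[≠] k) (𝓝[≠] (k * a)) := by
    refine tendsto_nhdsWithin_iff.2 ⟨?_, ?_⟩
    · exact ((Complex.continuous_ofReal.mul continuous_const).tendsto k).mono_left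
        nhdsWithin_le_nhds
    · filter_upwards [self_mem_nhdsWithin] with u hu
      intro he
      exact hu (Complex.ofReal_injective (mul_right_cancel₀ ha he))
  have hfreq : ∃ᶠ w in 𝓝[≠] (k * a : ℂ), ψ (γ₁ w) = ψ (γ₂ w) := by
    refine ht.frequently (Eventually.frequently ?_)
    filter_upwards [h.filter_mono nhdsWithin_le_nhds] with u hu
    rw [hu]
  have hev := (a₁.frequently_eq_iff_eventually_eq a₂).1 hfreq
  filter_upwards [hev, h₁.continuousAt.preimage_mem_nhds (ψ.open_source.mem_nhds hx₁),
    h₂.continuousAt.preimage_mem_nhds (ψ.open_source.mem_nhds hx₂)] with w hw hw₁ hw₂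
  exact ψ.injOn hw₁ hw₂ hw

variable [FiniteDimensional ℂ E] (hg : IsAntiKaehler g)

include hg

/-- Local existence of complex geodesics with given initial data: a holomorphic map whose
restrictions to real lines through the origin are geodesics. -/
theorem exists_local_complex_geodesic (p : M) (v : E) (a : ℂ) :
    ∃ ε > 0, ∃ τ : ℂ → M, τ a = p ∧ (∀ z ∈ ball a ε, IsHolAt E τ z) ∧
      (∀ z : ℂ, ∀ u : ℝ, u * z ∈ ball a ε → IsGeodesicAt g (fun s : ℝ => τ (s * z)) u) ∧
      ∀ z : ℂ, ∀ u : ℝ, u * z = a → deriv (fun s : ℝ => chartAt E p (τ (s * z))) u = z • v := by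
  have : CompleteSpace E := FiniteDimensional.complete ℂ E
  set φ := chartAt E p with hφ
  have hp : p ∈ φ.source := mem_chart_source E p
  have hx : ((φ p, v) : E × E).1 ∈ φ.target := φ.map_source hp
  obtain ⟨K, U₁, hU₁, hK⟩ := exists_lipschitzOnWith_geodField hg hx
  have hU₂ : Prod.fst ⁻¹' φ.target ∈ 𝓝 ((φ p, v) : E × E) :=
    continuous_fst.continuousAt.preimage_mem_nhds (φ.open_target.mem_nhds hx)
  -- The geodesic vector field is holomorphic in position and velocity, so it can be integrated in a
  -- complex time variable.
  obtain ⟨ε, hε, Y, hY0, hY⟩ := exists_hasDerivAt_of_lipschitzOnWith (inter_mem hU₁ hU₂)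
    (f := geodField g p) (fun x hx => ((contDiffAt_geodField hg hx.2).differentiableAt
      (by simp)).differentiableWithinAt) (hK.mono inter_subset_left) a
  have hYt : ∀ z ∈ ball a ε, (Y z).1 ∈ φ.target := fun z hz => (hY z hz).1.2
  have hd1 : ∀ z ∈ ball a ε, HasDerivAt (fun z => (Y z).1) (Y z).2 z := fun z hz =>
    (hY z hz).2.fst
  have hd2 : ∀ z ∈ ball a ε, HasDerivAt (fun z => (Y z).2) (-chrC g p (Y z).1 (Y z).2 (Y z).2) z :=
    fun z hz => (hY z hz).2.snd
  have hhol : ∀ z ∈ ball a ε, IsHolAt E (fun z => φ.symm (Y z).1) z := fun z hz =>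
    ⟨p, fun z => (Y z).1, DifferentiableOn.analyticAt (s := ball a ε)
      (fun w hw => (hd1 w hw).differentiableAt.differentiableWithinAt)
      (isOpen_ball.mem_nhds hz), hYt z hz, EventuallyEq.rfl⟩
  have hline : ∀ z : ℂ, ∀ u : ℝ, HasDerivAt (fun s : ℝ => (s * z : ℂ)) z u := fun z u => by
    simpa using (Complex.ofRealCLM.hasDerivAt (x := u)).mul_const z
  have hopen : ∀ z : ℂ, ∀ u : ℝ, u * z ∈ ball a ε → ∀ᶠ s : ℝ in 𝓝 u, (s * z : ℂ) ∈ ball a ε :=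
    fun z u hu => (hline z u).continuousAt.preimage_mem_nhds (isOpen_ball.mem_nhds hu)
  have hderiv : ∀ z : ℂ, ∀ u : ℝ, u * z ∈ ball a ε →
      HasDerivAt (fun s : ℝ => (Y (s * z)).1) (z • (Y (u * z)).2) u := fun z u hu =>
    HasDerivAt.scomp (g₁ := fun z => (Y z).1) u (hd1 _ hu) (hline z u)
  have hderiv2 : ∀ z : ℂ, ∀ u : ℝ, u * z ∈ ball a ε →
      HasDerivAt (fun s : ℝ => (Y (s * z)).2)
        (z • -chrC g p (Y (u * z)).1 (Y (u * z)).2 (Y (u * z)).2) u := fun z u hu =>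
    HasDerivAt.scomp (g₁ := fun z => (Y z).2) u (hd2 _ hu) (hline z u)
  have hchart : ∀ z : ℂ, ∀ u : ℝ, u * z ∈ ball a ε →
      (fun s : ℝ => φ (φ.symm (Y (s * z)).1)) =ᶠ[𝓝 u] fun s : ℝ => (Y (s * z)).1 := by
    intro z u hu
    filter_upwards [hopen z u hu] with s hs
    exact φ.right_inv (hYt _ hs)
  refine ⟨ε, hε, fun z => φ.symm (Y z).1, ?_, hhol, ?_, ?_⟩
  · simp only [hY0, φ.left_inv hp]
  · intro z u hu
    have hc : ∀ᶠ s : ℝ in 𝓝 u, ContinuousAt (fun s : ℝ => φ.symm (Y (s * z)).1) s := by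
      filter_upwards [hopen z u hu] with s hs
      exact ContinuousAt.comp (g := fun z => φ.symm (Y z).1) (hhol _ hs).continuousAt
        (hline z s).continuousAt
    have hd' : deriv (fun s : ℝ => (Y (s * z)).1) =ᶠ[𝓝 u] fun s => z • (Y (s * z)).2 := by
      filter_upwards [hopen z u hu] with s hs
      exact (hderiv z s hs).deriv
    refine (isGeodesicAt_iff hg hc (x₀ := p) (φ.map_target (hYt _ hu))).2 ⟨?_, ?_⟩
    · refine ContDiffAt.congr_of_eventuallyEq ?_ (hchart z u hu)
      have hol : ContDiffAt ℝ 2 (fun z => (Y z).1) (u * z) := by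
        have : AnalyticAt ℂ (fun z => (Y z).1) (u * z) := DifferentiableOn.analyticAt (s := ball a ε)
          (fun w hw => (hd1 w hw).differentiableAt.differentiableWithinAt) (isOpen_ball.mem_nhds hu)
        exact this.contDiffAt.restrict_scalars ℝ
      exact ContDiffAt.comp (g := fun z => (Y z).1) u hol
        (Complex.ofRealCLM.contDiff.contDiffAt.mul contDiffAt_const)
    · show deriv (deriv (fun s : ℝ => φ (φ.symm (Y (s * z)).1))) u +
        chrC g p (φ (φ.symm (Y (u * z)).1)) (deriv (fun s : ℝ => φ (φ.symm (Y (s * z)).1)) u)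
          (deriv (fun s : ℝ => φ (φ.symm (Y (s * z)).1)) u) = 0
      -- Along `s ↦ s z` each derivative brings a factor `z`, and the symbols are complex bilinear:
      -- the complex-time equation is multiplied by `z²`.
      rw [(hchart z u hu).deriv.deriv_eq, (hchart z u hu).deriv_eq, hd'.deriv_eq,
        φ.right_inv (hYt _ hu), ((hderiv2 z u hu).fun_const_smul z).deriv, (hderiv z u hu).deriv]
      simp only [map_smul, smul_apply, smul_neg]
      abel
  · intro z u hu
    have hu' : u * z ∈ ball a ε := by rw [hu]; exact mem_ball_self hε
    have := (hchart z u hu').deriv_eq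
    rw [this, (hderiv z u hu').deriv, hu, hY0]

/-! Consequences of the definition of a complex geodesic. -/

variable [T2Space M] {γ : ℂ → M} (hγ : IsComplexGeodesic g γ)

include hγ

/-- The definition supplies an unrelated geodesic `c z` for each `z`, with initial velocity `z v`.
By uniqueness `c (u z)` is `c z` run at speed `u`, so `γ(u z) = c (u z) 1 = c z u`. -/
theorem IsComplexGeodesic.isGeodesic (z : ℂ) : IsGeodesic g (fun u : ℝ => γ (u * z)) ∧
    deriv (fun u : ℝ => chartAt E (γ 0) (γ (u * z))) 0 = z • comp (γ 0) (push E γ 0 1) := by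
  choose c hc hc0 hc1 using hγ
  set φ := chartAt E (γ 0) with hφ
  have h0 : ∀ z, c z 0 = γ 0 := fun z => congrArg (fun p : TangentBundle 𝓘(ℝ, E) M => p.1) (hc0 z)
  have hx : γ 0 ∈ φ.source := mem_chart_source E _
  have hd : ∀ z, deriv (fun s => φ (c z s)) 0 = z • comp (γ 0) (push E γ 0 1) := by
    intro z
    have h1 : coord φ (c z 0) (velocity E (c z) 0) = z • comp (γ 0) (push E γ 0 1) := by
      have := congrArg (fun p : TangentBundle 𝓘(ℝ, E) M => coord (E := E) φ p.1 p.2) (hc0 z)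
      refine this.trans ((coord_chartAt _ _).trans ?_)
      show z.re • comp (γ 0) (push E γ 0 1) + z.im • (Complex.I • comp (γ 0) (push E γ 0 1)) = _
      conv_rhs => rw [← Complex.re_add_im z]
      rw [add_smul, mul_smul]
      rfl
    have h2 := ((hc z).isGeodesicAt 0)
    have h3 := ((isGeodesicAt_iff hg h2.1 (x₀ := γ 0) (by rw [h0]; exact hx)).1 h2).1
    rw [← h1, ← (eventually_coord_velocity h2.1 (x₀ := γ 0) (by rw [h0]; exact hx) h3).self_of_nhds]
  have key : (fun u : ℝ => γ (u * z)) = c z := by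
    funext u
    have e : c (u * z) = fun s => c z (u * s) := by
      have h1 : ∀ t, IsGeodesicAt g (c (u * z)) t := fun t => (hc _).isGeodesicAt t
      have h2 : ∀ t, IsGeodesicAt g (fun s => c z (u * s)) t := fun t =>
        ((hc z).isGeodesicAt (u * t)).comp_mul hg
      have h3 : c (u * z) 0 = c z (u * 0) := by rw [mul_zero, h0, h0]
      have h4 : deriv (fun s => φ (c (u * z) s)) 0 = deriv (fun s => φ (c z (u * s))) 0 := by
        rw [hd, deriv_comp_mul_left u (fun s => φ (c z s)) 0, mul_zero, hd, mul_smul]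
        rfl
      exact funext fun s => eqOn_of_isGeodesicAt hg isOpen_univ isPreconnected_univ
        (fun t _ => h1 t) (fun t _ => h2 t) (mem_univ 0)
        (eventuallyEq_of_isGeodesicAt hg (Eventually.of_forall h1) (Eventually.of_forall h2)
          (x₀ := γ 0) (by rw [h0]; exact hx) h3 h4) (mem_univ s)
    rw [← hc1, e]
    simp only [mul_one]
  have key' : (fun u : ℝ => φ (γ (u * z))) = fun s => φ (c z s) :=
    congrArg (fun f : ℝ → M => fun s => φ (f s)) key
  exact ⟨key ▸ hc z, key' ▸ hd z⟩

/-- Near 0 the map coincides with a local holomorphic solution `τ`: for each small `z`, the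
geodesics `u ↦ γ(u z)` and `u ↦ τ(u z)` have the same initial data, so they agree at `u = 1`. -/
theorem IsComplexGeodesic.isHolAt_zero : IsHolAt E γ 0 := by
  obtain ⟨ε, hε, τ, hτ0, hτ1, hτ2, hτ3⟩ :=
    exists_local_complex_geodesic hg (γ 0) (comp (γ 0) (push E γ 0 1)) 0
  refine (hτ1 0 (mem_ball_self hε)).congr ?_
  filter_upwards [ball_mem_nhds 0 hε] with z hz
  set s : Set ℝ := {u : ℝ | (u * z : ℂ) ∈ ball (0 : ℂ) ε} with hs
  have hso : IsOpen s := isOpen_ball.preimage (Complex.continuous_ofReal.mul continuous_const)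
  have hsc : IsPreconnected s := by
    have : Convex ℝ s := (convex_ball (0 : ℂ) ε).is_linear_preimage
      (f := fun u : ℝ => (u * z : ℂ)) ⟨fun a b => by push_cast; ring, fun a b => by
        simp [mul_assoc]⟩
    exact this.isPreconnected
  have h0 : (0 : ℝ) ∈ s := by simp [hs, hε]
  have h1 : (1 : ℝ) ∈ s := by simpa [hs] using hz
  have hgeo : ∀ t, IsGeodesicAt g (fun u : ℝ => γ (u * z)) t :=
    (hγ.isGeodesic hg z).1.isGeodesicAt
  have hgeo' : ∀ t ∈ s, IsGeodesicAt g (fun u : ℝ => τ (u * z)) t := fun t ht => hτ2 z t ht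
  have := eqOn_of_isGeodesicAt hg hso hsc (fun t _ => hgeo t) hgeo' h0
    (eventuallyEq_of_isGeodesicAt hg (x₀ := γ 0) (Eventually.of_forall hgeo)
      (eventually_of_mem (hso.mem_nhds h0) hgeo') (by simp) (by simp [hτ0])
      (by rw [(hγ.isGeodesic hg z).2, hτ3 z 0 (by simp)])) h1
  simpa using this

/-- Continuation along the ray through `z`. The times at which `γ` is holomorphic form an open set.
At a limit time, compare `γ` with a holomorphic solution `τ` matched to it along the ray: they agree
near an earlier point of holomorphy by the identity theorem, and geodesics carry this agreement to a
neighbourhood of the limit point. -/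
theorem IsComplexGeodesic.isHolAt (z : ℂ) : IsHolAt E γ z := by
  rcases eq_or_ne z 0 with rfl | hz
  · exact hγ.isHolAt_zero hg
  set S : Set ℝ := {t : ℝ | IsHolAt E γ (t * z)} with hS
  have hline : Continuous fun t : ℝ => (t * z : ℂ) :=
    Complex.continuous_ofReal.mul continuous_const
  have hSo : IsOpen S := by
    rw [isOpen_iff_mem_nhds]
    intro t ht
    exact (hline.tendsto t).eventually (IsHolAt.eventually ht)
  have h0 : (0 : ℝ) ∈ S := by
    simpa [hS] using hγ.isHolAt_zero hg
  suffices hsub : (univ : Set ℝ) ⊆ S by simpa [hS] using hsub (mem_univ 1)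
  refine isPreconnected_univ.subset_of_closure_inter_subset hSo ⟨0, mem_univ _, h0⟩ ?_
  rintro t ⟨htS, -⟩
  rcases eq_or_ne t 0 with rfl | ht
  · exact h0
  set a : ℂ := t * z with ha
  have ht' : (t : ℂ) ≠ 0 := Complex.ofReal_ne_zero.2 ht
  have ha0 : a ≠ 0 := mul_ne_zero ht' hz
  set φ := chartAt E (γ a) with hφ
  have hgeo : ∀ z t, IsGeodesicAt g (fun u : ℝ => γ (u * z)) t := fun z =>
    (hγ.isGeodesic hg z).1.isGeodesicAt
  -- The factor `a⁻¹` gives `u ↦ τ(u a)` the same velocity as `u ↦ γ(u a)` at `u = 1`.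
  obtain ⟨ε, hε, τ, hτ0, hτ1, hτ2, hτ3⟩ :=
    exists_local_complex_geodesic hg (γ a) (a⁻¹ • deriv (fun u : ℝ => φ (γ (u * a))) 1) a
  have hopen : ∀ w : ℂ, IsOpen {u : ℝ | (u * w : ℂ) ∈ ball a ε} := fun w =>
    isOpen_ball.preimage (Complex.continuous_ofReal.mul continuous_const)
  have hconn : ∀ w : ℂ, IsPreconnected {u : ℝ | (u * w : ℂ) ∈ ball a ε} := fun w => by
    have : Convex ℝ {u : ℝ | (u * w : ℂ) ∈ ball a ε} := (convex_ball a ε).is_linear_preimage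
      (f := fun u : ℝ => (u * w : ℂ)) ⟨fun a b => by push_cast; ring, fun a b => by
        simp [mul_assoc]⟩
    exact this.isPreconnected
  have h1a : ((1 : ℝ) : ℂ) * a = a := by simp
  have h1 : (1 : ℝ) ∈ {u : ℝ | (u * a : ℂ) ∈ ball a ε} := by
    simp [hε]
  have hray : EqOn (fun u : ℝ => γ (u * a)) (fun u : ℝ => τ (u * a))
      {u : ℝ | (u * a : ℂ) ∈ ball a ε} := by
    refine eqOn_of_isGeodesicAt hg (hopen a) (hconn a) (fun t _ => hgeo a t)
      (fun t ht => hτ2 a t ht) h1 (eventuallyEq_of_isGeodesicAt hg (x₀ := γ a)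
        (Eventually.of_forall (hgeo a)) (eventually_of_mem ((hopen a).mem_nhds h1)
          (fun t ht => hτ2 a t ht)) (by simp) (by simp [hτ0]) ?_)
    rw [hτ3 a 1 h1a, smul_smul, mul_inv_cancel₀ ha0, one_smul]
  obtain ⟨r, hrb, hrS⟩ : ∃ r : ℝ, (r * z : ℂ) ∈ ball a ε ∧ r ∈ S :=
    mem_closure_iff.1 htS _ (hopen z) (show (t * z : ℂ) ∈ ball a ε from mem_ball_self hε)
  -- The point `r z` at which holomorphy is known is written as `k a` on the ray through `a`.
  set k : ℝ := r / t with hk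
  have hka : (k * a : ℂ) = r * z := by
    rw [hk, ha]; push_cast; field_simp
  have hkb : (k * a : ℂ) ∈ ball a ε := hka ▸ hrb
  have hloc : γ =ᶠ[𝓝 (k * a : ℂ)] τ := by
    refine IsHolAt.eventuallyEq_of_ray ha0 (hka ▸ hrS) (hτ1 _ hkb) ?_
    filter_upwards [(hopen a).mem_nhds hkb] with u hu using hray hu
  have hmul : Tendsto (fun w : ℂ => (k * w : ℂ)) (𝓝 a) (𝓝 (k * a)) :=
    (continuous_const.mul continuous_id).tendsto a
  refine (hτ1 a (mem_ball_self hε)).congr ?_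
  filter_upwards [ball_mem_nhds a hε, hmul.eventually (eventually_eventually_nhds.2 hloc),
    hmul.eventually (isOpen_ball.mem_nhds hkb)] with w hw hw1 hw2
  have hline' : Tendsto (fun u : ℝ => (u * w : ℂ)) (𝓝 k) (𝓝 (k * w)) :=
    (Complex.continuous_ofReal.mul continuous_const).tendsto k
  -- For `w` near `a`, the geodesics through multiples of `w` agree near `u = k`, hence also at `u =
  -- 1`.
  have := eqOn_of_isGeodesicAt hg (hopen w) (hconn w) (fun t _ => hgeo w t)
    (fun t ht => hτ2 w t ht) hw2 (hline'.eventually hw1) (show (1 : ℝ) ∈ _ by simpa using hw)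
  simpa using this

end Holomorphic

/-! ### Holomorphic fields along a holomorphic curve -/

section HolomorphicField

variable {E : Type*} [NormedAddCommGroup E] [NormedSpace ℂ E]
  {M : Type*} [TopologicalSpace M] [ChartedSpace E M] [IsManifold 𝓘(ℂ, E) ω M]
  {g : BilinField E M}

theorem hasDerivAt_ray (z₀ : ℂ) (u : ℝ) : HasDerivAt (fun s : ℝ => (s * z₀ : ℂ)) z₀ u := by
  simpa using (Complex.ofRealCLM.hasDerivAt (x := u)).mul_const z₀

/-- Multiplication of real tangent vectors by complex numbers, `(a + √-1 b) v = a v + b J v`. -/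
noncomputable def cmul {x : M} (c : ℂ) (v : Tan E x) : Tan E x := (comp x).symm (c • comp x v)

theorem coord_cmul {φ : OpenPartialHomeomorph M E}
    (hφ : φ ∈ IsManifold.maximalAtlas 𝓘(ℂ, E) ω M) {x : M} (hx : x ∈ φ.source) (c : ℂ)
    (v : Tan E x) : coord φ x (cmul c v) = c • coord φ x v := by
  rw [coord_eq_jac hφ hx, coord_eq_jac hφ hx]
  exact map_smul _ _ _

/-- The coordinates of the field `X` along `γ` are complex differentiable at `z`. -/
def HolFieldAt (γ : ℂ → M) (X : (z : ℂ) → Tan E (γ z)) (z : ℂ) : Prop :=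
  ∀ φ ∈ IsManifold.maximalAtlas 𝓘(ℂ, E) ω M, γ z ∈ φ.source →
    DifferentiableAt ℂ (fun w => coord φ (γ w) (X w)) z

variable {γ : ℂ → M} {X : (z : ℂ) → Tan E (γ z)} {z : ℂ}

theorem HolFieldAt.of_chart (hγ : IsHolAt E γ z) {φ : OpenPartialHomeomorph M E}
    (hφ : φ ∈ IsManifold.maximalAtlas 𝓘(ℂ, E) ω M) (hz : γ z ∈ φ.source)
    (h : DifferentiableAt ℂ (fun w => coord φ (γ w) (X w)) z) : HolFieldAt γ X z := by
  intro ψ hψ hz'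
  have hc := hγ.continuousAt
  have hev : (fun w => coord ψ (γ w) (X w)) =ᶠ[𝓝 z]
      fun w => jac φ ψ (φ (γ w)) (coord φ (γ w) (X w)) := by
    filter_upwards [hc.preimage_mem_nhds (φ.open_source.mem_nhds hz),
      hc.preimage_mem_nhds (ψ.open_source.mem_nhds hz')] with w hw hw'
    exact coord_change hφ hψ hw hw' _
  refine DifferentiableAt.congr_of_eventuallyEq ?_ hev
  have hJ : DifferentiableAt ℂ (jac φ ψ) (φ (γ z)) :=
    (contDiffAt_jac hφ hψ (φ.map_source hz) (by rwa [φ.left_inv hz])).differentiableAt (by simp)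
  exact (DifferentiableAt.comp (g := jac φ ψ) z hJ
    (hγ.analyticAt hφ hz).differentiableAt).clm_apply h

theorem HolFieldAt.cmul (hγ : IsHolAt E γ z) (h : HolFieldAt γ X z) (c : ℂ) :
    HolFieldAt γ (fun z => cmul c (X z)) z := by
  intro φ hφ hz
  refine ((h φ hφ hz).const_smul c).congr_of_eventuallyEq ?_
  filter_upwards [hγ.continuousAt.preimage_mem_nhds (φ.open_source.mem_nhds hz)] with w hw
  exact coord_cmul hφ hw c _

variable [FiniteDimensional ℂ E] (hg : IsAntiKaehler g)

theorem HolFieldAt.analyticAt (hγ : IsHolAt E γ z) (h : ∀ᶠ w in 𝓝 z, HolFieldAt γ X w)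
    {φ : OpenPartialHomeomorph M E} (hφ : φ ∈ IsManifold.maximalAtlas 𝓘(ℂ, E) ω M)
    (hz : γ z ∈ φ.source) : AnalyticAt ℂ (fun w => coord φ (γ w) (X w)) z := by
  have : CompleteSpace E := FiniteDimensional.complete ℂ E
  rw [Complex.analyticAt_iff_eventually_differentiableAt]
  filter_upwards [h, hγ.continuousAt.preimage_mem_nhds (φ.open_source.mem_nhds hz)] with w hw hw'
  exact hw φ hφ hw'

include hg

/-- The ordinary derivatives are complex linear in `ξ` by holomorphy, and the Christoffel term by
complex bilinearity; so `∇_ξ X = ξ ∇_1 X`. -/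
theorem coord_covDerivAlong_complex {x₀ : M} (hγ : IsHolAt E γ z) (hX : HolFieldAt γ X z)
    (hz : γ z ∈ (chartAt E x₀).source) (ξ : ℂ) :
    coord (chartAt E x₀) (γ z) (covDerivAlong g γ X z ξ) =
      ξ • (deriv (fun w => coord (chartAt E x₀) (γ w) (X w)) z +
        chrC g x₀ (chartAt E x₀ (γ z)) (deriv (fun w => chartAt E x₀ (γ w)) z)
          (coord (chartAt E x₀) (γ z) (X z))) := by
  have h1 := (hγ.analyticAt (chart_mem x₀) hz).differentiableAt
  have h2 := hX _ (chart_mem x₀) hz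
  rw [coord_covDerivAlong hg hγ.continuousAt hz (h1.restrictScalars ℝ) (h2.restrictScalars ℝ),
    fderiv_real_eq h1, fderiv_real_eq h2, fderiv_eq_smul_deriv, fderiv_eq_smul_deriv, smul_add,
    map_smul]
  rfl

/-- The chain rule along `s ↦ s z₀` brings out the same factor `z₀` from the derivative and from the
Christoffel term. -/
theorem coord_covDerivAlong_ray {x₀ : M} {z₀ : ℂ} {u : ℝ} (hγ : IsHolAt E γ (u * z₀))
    (hX : HolFieldAt γ X (u * z₀)) (hz : γ (u * z₀) ∈ (chartAt E x₀).source) :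
    coord (chartAt E x₀) (γ (u * z₀))
        (covDerivAlong g (fun s : ℝ => γ (s * z₀)) (fun s : ℝ => X (s * z₀)) u 1) =
      z₀ • coord (chartAt E x₀) (γ (u * z₀)) (covDerivAlong g γ X (u * z₀) 1) := by
  have h1 := (hγ.analyticAt (chart_mem x₀) hz).differentiableAt
  have h2 := hX _ (chart_mem x₀) hz
  have hr := hasDerivAt_ray z₀ u
  have e1 : HasDerivAt (fun s : ℝ => chartAt E x₀ (γ (s * z₀)))
      (z₀ • deriv (fun w => chartAt E x₀ (γ w)) (u * z₀)) u :=
    HasDerivAt.scomp (g₁ := fun w => chartAt E x₀ (γ w)) u h1.hasDerivAt hr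
  have e2 : HasDerivAt (fun s : ℝ => coord (chartAt E x₀) (γ (s * z₀)) (X (s * z₀)))
      (z₀ • deriv (fun w => coord (chartAt E x₀) (γ w) (X w)) (u * z₀)) u :=
    HasDerivAt.scomp (g₁ := fun w => coord (chartAt E x₀) (γ w) (X w)) u h2.hasDerivAt hr
  have hc : ContinuousAt (fun s : ℝ => γ (s * z₀)) u :=
    ContinuousAt.comp (g := γ) hγ.continuousAt hr.continuousAt
  refine (coord_covDerivAlong hg (f := fun s : ℝ => γ (s * z₀)) hc hz e1.differentiableAt
    e2.differentiableAt 1).trans ?_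
  rw [fderiv_apply_one_eq_deriv, fderiv_apply_one_eq_deriv, e1.deriv, e2.deriv,
    coord_covDerivAlong_complex hg hγ hX hz, one_smul, smul_add, map_smul]
  rfl

theorem HolFieldAt.covDerivAlong (hγ : IsHolAt E γ z) (h : ∀ᶠ w in 𝓝 z, HolFieldAt γ X w) (ξ : ℂ) :
    HolFieldAt γ (fun w => covDerivAlong g γ X w ξ) z := by
  have : CompleteSpace E := FiniteDimensional.complete ℂ E
  set φ := chartAt E (γ z) with hφ
  have hz : γ z ∈ φ.source := mem_chart_source E _
  have h1 := hγ.analyticAt (chart_mem _) hz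
  have h2 := HolFieldAt.analyticAt hγ h (chart_mem _) hz
  refine HolFieldAt.of_chart hγ (chart_mem (γ z)) hz ?_
  have hev : (fun w => coord φ (γ w) (AntiKaehler.covDerivAlong g γ X w ξ)) =ᶠ[𝓝 z] fun w =>
      ξ • (deriv (fun w => coord φ (γ w) (X w)) w +
        chrC g (γ z) (φ (γ w)) (deriv (fun w => φ (γ w)) w) (coord φ (γ w) (X w))) := by
    filter_upwards [h, hγ.eventually,
      hγ.continuousAt.preimage_mem_nhds (φ.open_source.mem_nhds hz)] with w a1 a2 a3
    exact coord_covDerivAlong_complex hg a2 a1 a3 ξ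
  refine DifferentiableAt.congr_of_eventuallyEq ?_ hev
  have h3 : DifferentiableAt ℂ (fun w => chrC g (γ z) (φ (γ w))) z :=
    DifferentiableAt.comp (g := chrC g (γ z)) z (differentiableAt_chrC hg (φ.map_source hz))
      h1.differentiableAt
  exact (h2.deriv.differentiableAt.add ((h3.clm_apply h1.deriv.differentiableAt).clm_apply
    h2.differentiableAt)).const_smul ξ

omit hg in
theorem coord_push_complex {φ : OpenPartialHomeomorph M E}
    (hφ : φ ∈ IsManifold.maximalAtlas 𝓘(ℂ, E) ω M) (hγ : IsHolAt E γ z) (hz : γ z ∈ φ.source)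
    (ξ : ℂ) : coord φ (γ z) (push E γ z ξ) = ξ • deriv (fun w => φ (γ w)) z := by
  have h1 := (hγ.analyticAt hφ hz).differentiableAt
  rw [coord_push hφ hγ.continuousAt hz (h1.restrictScalars ℝ), fderiv_real_eq h1,
    fderiv_eq_smul_deriv]

omit hg in
theorem push_eq_cmul (hγ : IsHolAt E γ z) (ξ : ℂ) :
    push E γ z ξ = AntiKaehler.cmul ξ (push E γ z 1) := by
  refine coord_injective (chart_mem (γ z)) (mem_chart_source E _) ?_
  rw [coord_cmul (chart_mem (γ z)) (mem_chart_source E _),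
    coord_push_complex (chart_mem (γ z)) hγ (mem_chart_source E _),
    coord_push_complex (chart_mem (γ z)) hγ (mem_chart_source E _), one_smul]

omit hg in
theorem velocity_ray {z₀ : ℂ} {u : ℝ} (hγ : IsHolAt E γ (u * z₀)) :
    velocity E (fun s : ℝ => γ (s * z₀)) u = AntiKaehler.cmul z₀ (push E γ (u * z₀) 1) := by
  have hz : γ (u * z₀) ∈ (chartAt E (γ (u * z₀))).source := mem_chart_source E _
  refine coord_injective (chart_mem (γ (u * z₀))) hz ?_
  have h1 := (hγ.analyticAt (chart_mem _) hz).differentiableAt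
  have hr := hasDerivAt_ray z₀ u
  have e1 : HasDerivAt (fun s : ℝ => chartAt E (γ (u * z₀)) (γ (s * z₀)))
      (z₀ • deriv (fun w => chartAt E (γ (u * z₀)) (γ w)) (u * z₀)) u :=
    HasDerivAt.scomp (g₁ := fun w => chartAt E (γ (u * z₀)) (γ w)) u h1.hasDerivAt hr
  rw [coord_cmul (chart_mem _) hz, coord_push_complex (chart_mem _) hγ hz, one_smul]
  refine (coord_push (chart_mem _) (f := fun s : ℝ => γ (s * z₀))
    (ContinuousAt.comp (g := γ) hγ.continuousAt hr.continuousAt) hz e1.differentiableAt 1).trans ?_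
  rw [fderiv_apply_one_eq_deriv, e1.deriv]

/-! ### The complex Jacobi equation -/

/-- In coordinates the curvature is built from the holomorphic complex bilinear symbols and their
complex derivative, hence is complex linear in each argument. -/
theorem curvature_cmul {x : M} (a b c : ℂ) (u v w : Tan E x) :
    curvature g x (AntiKaehler.cmul a u) (AntiKaehler.cmul b v) (AntiKaehler.cmul c w) =
      AntiKaehler.cmul (a * b * c) (curvature g x u v w) := by
  have hx : x ∈ (chartAt E x).source := mem_chart_source E x
  refine coord_injective (chart_mem x) hx ?_
  rw [coord_curvature hg hx, coord_cmul (chart_mem x) hx, coord_cmul (chart_mem x) hx,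
    coord_cmul (chart_mem x) hx, coord_cmul (chart_mem x) hx, coord_curvature hg hx, curvC, curvC]
  simp only [map_smul, smul_apply, smul_add, smul_sub, smul_smul]
  congr 1
  · congr 1
    · congr 1
      · congr 1; ring
      · congr 1; ring
    · congr 1; ring
  · congr 1; ring

end HolomorphicField

/-! ### Fields of type (1,0) through their real parts -/

section JacobiEquation

variable {E : Type*} [NormedAddCommGroup E] [NormedSpace ℂ E]
  {M : Type*} [TopologicalSpace M] [ChartedSpace E M] [IsManifold 𝓘(ℂ, E) ω M]
  {g : BilinField E M} {γ : ℂ → M}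

/-- The left hand side of the complex Jacobi equation for the holomorphic field with real part
`X`. -/
noncomputable def jacobiOp (g : BilinField E M) (γ : ℂ → M) (X : (z : ℂ) → Tan E (γ z)) (z : ℂ) :
    Tan E (γ z) :=
  covDerivAlong g γ (fun w => covDerivAlong g γ X w 1) z 1 +
    curvature g (γ z) (X z) (push E γ z 1) (push E γ z 1)

theorem cmul_comp {x : M} (a b : ℂ) (v : Tan E x) : cmul a (cmul b v) = cmul (a * b) v :=
  smul_smul a b (comp x v)

theorem cmul_one {x : M} (v : Tan E x) : cmul 1 v = v := one_smul ℂ (comp x v)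

theorem cmul_add {x : M} (a : ℂ) (v w : Tan E x) : cmul a (v + w) = cmul a v + cmul a w :=
  smul_add a (comp x v) (comp x w)

theorem add_cmul {x : M} (a b : ℂ) (v : Tan E x) : cmul (a + b) v = cmul a v + cmul b v :=
  add_smul a b (comp x v)

theorem sub_cmul {x : M} (a b : ℂ) (v : Tan E x) : cmul (a - b) v = cmul a v - cmul b v :=
  sub_smul a b (comp x v)

theorem cmul_eq_zero {x : M} {a : ℂ} (ha : a ≠ 0) {v : Tan E x} : cmul a v = 0 ↔ v = 0 :=
  smul_eq_zero_iff_right (M := E) ha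

theorem cmul_zero {x : M} (a : ℂ) : cmul a (0 : Tan E x) = 0 := smul_zero (A := E) a

theorem zero_cmul {x : M} (v : Tan E x) : cmul 0 v = 0 := zero_smul ℂ (comp x v)

/-- The `(1,0)`-vector with real part `v`. -/
noncomputable def type10 {x : M} (v : Tan E x) : Complexified (Tan E x) :=
  ⟨v, cmul (-Complex.I) v⟩

theorem isType10_iff {x : M} (Z : Complexified (Tan E x)) : IsType10 Z ↔ Z = type10 Z.re := by
  have hsmul : (Complex.I • Z : Complexified (Tan E x)) =
      ⟨Complex.I.re • Z.re - Complex.I.im • Z.im, Complex.I.re • Z.im + Complex.I.im • Z.re⟩ := rfl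
  rw [IsType10, hsmul]
  simp only [Complex.I_re, Complex.I_im, zero_smul, one_smul, zero_sub, zero_add,
    Complexified.mk.injEq]
  have h1 : ∀ v : Tan E x, J x v = cmul Complex.I v := fun v => rfl
  constructor
  · rintro ⟨h2, -⟩
    ext
    · rfl
    · show Z.im = cmul (-Complex.I) Z.re
      have : cmul (-Complex.I) Z.re = - cmul Complex.I Z.re := neg_smul Complex.I (comp x Z.re)
      rw [this, ← h1, h2, neg_neg]
  · intro h
    have h2 : Z.im = cmul (-Complex.I) Z.re := congrArg Complexified.im h
    have h3 : cmul (-Complex.I) Z.re = - cmul Complex.I Z.re := neg_smul Complex.I (comp x Z.re)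
    refine ⟨?_, ?_⟩
    · rw [h2, h3, neg_neg, h1]
    · rw [h2, h1, cmul_comp]
      simp [cmul_one]

/-- The real and imaginary parts contribute equally since `I * (-I) = 1`; hence the factor 2. -/
theorem holCoord_type10 {φ : OpenPartialHomeomorph M E}
    (hφ : φ ∈ IsManifold.maximalAtlas 𝓘(ℂ, E) ω M) {x : M} (hx : x ∈ φ.source) (v : Tan E x) :
    holCoord φ x (type10 v) = (2 : ℂ) • coord φ x v := by
  rw [holCoord, type10, coord_cmul hφ hx, smul_smul]
  simp [two_smul]

/-- Holomorphic fields along `γ` in terms of their real parts. -/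
theorem isHolomorphicAlong_iff (hγ : ∀ z, IsHolAt E γ z)
    (Y : (z : ℂ) → Complexified (Tan E (γ z))) :
    IsHolomorphicAlong γ Y ↔
      (∀ z, Y z = type10 (Y z).re) ∧ ∀ z, HolFieldAt γ (fun z => (Y z).re) z := by
  have hcont : Continuous γ := continuous_iff_continuousAt.2 fun z => (hγ z).continuousAt
  have hev : ∀ {φ : OpenPartialHomeomorph M E} {z : ℂ},
      φ ∈ IsManifold.maximalAtlas 𝓘(ℂ, E) ω M → γ z ∈ φ.source → (∀ z, Y z = type10 (Y z).re) →
      (fun w => holCoord φ (γ w) (Y w)) =ᶠ[𝓝 z] fun w => (2 : ℂ) • coord φ (γ w) (Y w).re := by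
    intro φ z hφ hz hY
    filter_upwards [(hγ z).continuousAt.preimage_mem_nhds (φ.open_source.mem_nhds hz)] with w hw
    rw [hY w, holCoord_type10 hφ hw]
    rfl
  rw [IsHolomorphicAlong]
  simp only [isType10_iff]
  refine and_congr_right fun hY => ⟨fun h z φ hφ hz => ?_, fun h φ hφ z hz => ?_⟩
  · have h1 := (h φ hφ).differentiableAt ((φ.open_source.preimage hcont).mem_nhds hz)
    have h2 := (h1.congr_of_eventuallyEq (hev hφ hz hY).symm).const_smul (2⁻¹ : ℂ)
    refine h2.congr_of_eventuallyEq (Eventually.of_forall fun w => ?_)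
    simp [smul_smul]
  · refine DifferentiableAt.differentiableWithinAt ?_
    exact ((h z φ hφ hz).const_smul (2 : ℂ)).congr_of_eventuallyEq (hev hφ hz hY)

variable [FiniteDimensional ℂ E] (hg : IsAntiKaehler g) (hγ : ∀ z, IsHolAt E γ z)
  {X : (z : ℂ) → Tan E (γ z)}

include hg hγ

theorem covDerivAlong_cmul {z : ℂ} (hX : HolFieldAt γ X z) (c ξ : ℂ) :
    covDerivAlong g γ (fun w => cmul c (X w)) z ξ = cmul (ξ * c) (covDerivAlong g γ X z 1) := by
  have hz : γ z ∈ (chartAt E (γ z)).source := mem_chart_source E _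
  refine coord_injective (chart_mem (γ z)) hz ?_
  have hev : (fun w => coord (chartAt E (γ z)) (γ w) (cmul c (X w))) =ᶠ[𝓝 z]
      fun w => c • coord (chartAt E (γ z)) (γ w) (X w) := by
    filter_upwards [(hγ z).continuousAt.preimage_mem_nhds
      ((chartAt E (γ z)).open_source.mem_nhds hz)] with w hw
    exact coord_cmul (chart_mem _) hw c _
  have hd := ((hX _ (chart_mem (γ z)) hz).hasDerivAt.const_smul c).congr_of_eventuallyEq hev
  rw [coord_cmul (chart_mem _) hz, coord_covDerivAlong_complex hg (hγ z) (hX.cmul (hγ z) c) hz,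
    coord_covDerivAlong_complex hg (hγ z) hX hz, hd.deriv, coord_cmul (chart_mem _) hz, map_smul,
    ← smul_add, smul_smul, one_smul]

theorem covDerivAlong_eq_cmul {z : ℂ} (hX : HolFieldAt γ X z) (ξ : ℂ) :
    covDerivAlong g γ X z ξ = cmul ξ (covDerivAlong g γ X z 1) := by
  have := covDerivAlong_cmul hg hγ hX 1 ξ
  simpa [cmul_one] using this

/-- With `D = ∇_1 X`, the derivatives along `∂/∂s` and `∂/∂t` are `D` and `I D`. The two halves of
`d/dz` then add up to `D` in the real part and to `-I D` in the imaginary part. -/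
theorem covDerivAlongC_ddz {z : ℂ} (hX : HolFieldAt γ X z) :
    covDerivAlongC g γ (fun w => type10 (X w)) z ddz = type10 (covDerivAlong g γ X z 1) := by
  have h1 : ddz.re = 1 / 2 := by
    show (1 / 2 : ℂ).re • (1 : ℂ) - (1 / 2 : ℂ).im • (-Complex.I) = 1 / 2
    norm_num
  have h2 : ddz.im = -(Complex.I / 2) := by
    show (1 / 2 : ℂ).re • (-Complex.I) + (1 / 2 : ℂ).im • (1 : ℂ) = _
    norm_num
    ring
  have e1 : ∀ ξ, covDerivAlong g γ (fun q => (type10 (X q)).re) z ξ =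
      cmul ξ (covDerivAlong g γ X z 1) := fun ξ => covDerivAlong_eq_cmul hg hγ hX ξ
  have e2 : ∀ ξ, covDerivAlong g γ (fun q => (type10 (X q)).im) z ξ =
      cmul (ξ * -Complex.I) (covDerivAlong g γ X z 1) := fun ξ =>
    covDerivAlong_cmul hg hγ hX (-Complex.I) ξ
  rw [covDerivAlongC, e1, e1, e2, e2, h1, h2, ← sub_cmul, ← add_cmul, type10]
  have e3 : (1 / 2 - -(Complex.I / 2) * -Complex.I : ℂ) = 1 := by
    linear_combination (-1 / 2 : ℂ) * Complex.I_mul_I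
  have e4 : (1 / 2 * -Complex.I + -(Complex.I / 2) : ℂ) = -Complex.I := by ring
  rw [e3, e4, cmul_one]

omit hγ in
-- Complex trilinearity reduces the eight terms to multiples of one curvature vector, with total
-- coefficient 1 in the real part and `-I` in the imaginary part.
theorem curvatureC_type10 {z : ℂ} (hγ : IsHolAt E γ z) (v : Tan E (γ z)) :
    curvatureC g (γ z) (type10 v) (pushC E γ z ddz) (pushC E γ z ddz) =
      type10 (curvature g (γ z) v (push E γ z 1) (push E γ z 1)) := by
  have h1 : ddz.re = 1 / 2 := by
    show (1 / 2 : ℂ).re • (1 : ℂ) - (1 / 2 : ℂ).im • (-Complex.I) = 1 / 2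
    norm_num
  have h2 : ddz.im = -(Complex.I / 2) := by
    show (1 / 2 : ℂ).re • (-Complex.I) + (1 / 2 : ℂ).im • (1 : ℂ) = _
    norm_num
    ring
  have hp : pushC E γ z ddz =
      ⟨cmul (1 / 2) (push E γ z 1), cmul (-(Complex.I / 2)) (push E γ z 1)⟩ := by
    rw [pushC, h1, h2, push_eq_cmul hγ (1 / 2), push_eq_cmul hγ (-(Complex.I / 2))]
  have hc : ∀ b c : ℂ, ∀ w : Tan E (γ z), curvature g (γ z) v (cmul b w) (cmul c w) =
      cmul (b * c) (curvature g (γ z) v w w) := by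
    intro b c w
    have := curvature_cmul hg 1 b c v w w
    rwa [cmul_one, one_mul] at this
  rw [hp, curvatureC, type10]
  simp only [curvature_cmul hg, hc]
  simp only [← sub_cmul, ← add_cmul]
  rw [type10]
  congr 1
  · refine Eq.trans (congrArg (fun c => cmul c _) ?_) (cmul_one _)
    linear_combination (-3 / 4 : ℂ) * Complex.I_mul_I
  · congr 1
    linear_combination (1 / 4 * Complex.I : ℂ) * Complex.I_mul_I

theorem isComplexJacobiField_iff (Y : (z : ℂ) → Complexified (Tan E (γ z)))
    (hY : IsHolomorphicAlong γ Y) :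
    IsComplexJacobiField g γ Y ↔ ∀ z, jacobiOp g γ (fun z => (Y z).re) z = 0 := by
  obtain ⟨h1, h2⟩ := (isHolomorphicAlong_iff hγ Y).1 hY
  set X : (z : ℂ) → Tan E (γ z) := fun z => (Y z).re with hX
  have hYX : Y = fun z => type10 (X z) := funext h1
  have hD : ∀ z, HolFieldAt γ (fun w => covDerivAlong g γ X w 1) z := fun z =>
    HolFieldAt.covDerivAlong hg (hγ z) (Eventually.of_forall h2) 1
  have e1 : (fun z => covDerivAlongC g γ Y z ddz) =
      fun z => type10 (covDerivAlong g γ X z 1) := by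
    funext z
    rw [hYX, covDerivAlongC_ddz hg hγ (h2 z)]
  have e2 : ∀ z, covDerivAlongC g γ (fun z' => covDerivAlongC g γ Y z' ddz) z ddz
      + curvatureC g (γ z) (Y z) (pushC E γ z ddz) (pushC E γ z ddz) =
        type10 (jacobiOp g γ X z) := by
    intro z
    rw [e1, covDerivAlongC_ddz hg hγ (hD z), h1 z, curvatureC_type10 hg (hγ z)]
    rw [jacobiOp]
    show Complexified.mk _ _ = Complexified.mk _ (cmul _ (_ + _))
    rw [cmul_add]
    rfl
  rw [IsComplexJacobiField]
  simp only [e2, hY, true_and]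
  refine forall_congr' fun z => ⟨fun h => congrArg Complexified.re h, fun h => ?_⟩
  rw [h, type10, cmul_zero]
  rfl

/-! ### The Jacobi equation along the rays -/

theorem covDerivAlong_ray (hX : ∀ z, HolFieldAt γ X z) (z₀ : ℂ) (u : ℝ) :
    covDerivAlong g (fun s : ℝ => γ (s * z₀)) (fun s : ℝ => X (s * z₀)) u 1 =
      cmul z₀ (covDerivAlong g γ X (u * z₀) 1) := by
  have hz : γ (u * z₀) ∈ (chartAt E (γ (u * z₀))).source := mem_chart_source E _
  refine coord_injective (chart_mem (γ (u * z₀))) hz ?_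
  rw [coord_cmul (chart_mem _) hz]
  exact coord_covDerivAlong_ray hg (hγ _) (hX _) hz

/-- Each of the two covariant derivatives along the ray brings a factor `z₀`, and so does each of
the two velocities in the curvature term. Smoothness is automatic since `X` is analytic. -/
theorem isJacobiField_ray_iff (hX : ∀ z, HolFieldAt γ X z) (z₀ : ℂ) :
    IsJacobiField g (fun u : ℝ => γ (u * z₀)) (fun u : ℝ => X (u * z₀)) ↔
      ∀ u : ℝ, cmul (z₀ * z₀) (jacobiOp g γ X (u * z₀)) = 0 := by
  have hD : ∀ z, HolFieldAt γ (fun w => covDerivAlong g γ X w 1) z := fun z =>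
    HolFieldAt.covDerivAlong hg (hγ z) (Eventually.of_forall hX) 1
  have hD' : ∀ z, HolFieldAt γ (fun w => cmul z₀ (covDerivAlong g γ X w 1)) z := fun z =>
    (hD z).cmul (hγ z) z₀
  have hsm : IsSmoothAlong (fun u : ℝ => γ (u * z₀)) (fun u : ℝ => X (u * z₀)) := by
    intro x₀ u hu
    have h1 := HolFieldAt.analyticAt (hγ (u * z₀)) (Eventually.of_forall hX) (chart_mem x₀) hu
    refine ContDiffAt.contDiffWithinAt ?_
    have h2 : ContDiffAt ℝ ∞ (fun w => coord (chartAt E x₀) (γ w) (X w)) (u * z₀) :=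
      (h1.contDiffAt (n := ∞)).restrict_scalars ℝ
    exact ContDiffAt.comp (g := fun w => coord (chartAt E x₀) (γ w) (X w)) u h2
      (Complex.ofRealCLM.contDiff.contDiffAt.mul contDiffAt_const)
  have e1 : (fun u : ℝ => covDerivAlong g (fun s : ℝ => γ (s * z₀)) (fun s : ℝ => X (s * z₀)) u 1) =
      fun u : ℝ => cmul z₀ (covDerivAlong g γ X (u * z₀) 1) :=
    funext fun u => covDerivAlong_ray hg hγ hX z₀ u
  rw [IsJacobiField]
  simp only [hsm, true_and]
  refine forall_congr' fun u => ?_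
  rw [e1, covDerivAlong_ray hg hγ hD' z₀ u, covDerivAlong_cmul hg hγ (hD _), velocity_ray (hγ _),
    cmul_comp, one_mul]
  have h2 := curvature_cmul hg 1 z₀ z₀ (X (u * z₀)) (push E γ (u * z₀) 1) (push E γ (u * z₀) 1)
  rw [cmul_one, one_mul] at h2
  rw [h2, jacobiOp, cmul_add]

theorem forall_isJacobiField_ray_iff (hX : ∀ z, HolFieldAt γ X z) :
    (∀ z₀ : ℂ, IsJacobiField g (fun u : ℝ => γ (u * z₀)) (fun u : ℝ => X (u * z₀))) ↔
      ∀ z, jacobiOp g γ X z = 0 := by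
  simp only [isJacobiField_ray_iff hg hγ hX]
  constructor
  · intro h z
    -- The factor `z₀²` must be nonzero: the origin is reached on the ray with `z₀ = 1`, any other
    -- `z` on its own ray at `u = 1`.
    rcases eq_or_ne z 0 with rfl | hz
    · have := h 1 0
      rw [cmul_eq_zero (by norm_num)] at this
      have e : ((0 : ℝ) : ℂ) * 1 = 0 := by simp
      rwa [e] at this
    · have := h z 1
      rw [cmul_eq_zero (mul_ne_zero hz hz)] at this
      have e : ((1 : ℝ) : ℂ) * z = z := by simp
      rwa [e] at this
  · intro h z₀ u
    rw [h, cmul_zero]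

end JacobiEquation

/-! ### Linear systems with holomorphic coefficients -/

/-- A fundamental solution `Φ` of `s' = A s` on a disc, and its left inverse `Ψ`. -/
theorem exists_fundamentalSolution {R : Type*} [NormedRing R] [NormedAlgebra ℂ R] [CompleteSpace R]
    {A : ℂ → R} {a : ℂ} {U : Set ℂ} (hU : U ∈ 𝓝 a) (hA : DifferentiableOn ℂ A U) :
    ∃ r > 0, ball a r ⊆ U ∧ ∃ Φ Ψ : ℂ → R, ∀ z ∈ ball a r,
      HasDerivAt Φ (A z * Φ z) z ∧ HasDerivAt Ψ (-(Ψ z * A z)) z ∧ Ψ z * Φ z = 1 := by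
  obtain ⟨V, hVU, hVo, haV⟩ := _root_.mem_nhds_iff.1 hU
  have hAV := hA.mono hVU
  -- Time is added as a first component to make the system autonomous; `Φ` and `Ψ` are solved for
  -- together.
  set f : ℂ × R × R → ℂ × R × R := fun p => (1, A p.1 * p.2.1, -(p.2.2 * A p.1)) with hf
  have hAf : ContDiffOn ℂ 1 (fun p : ℂ × R × R => A p.1) (V ×ˢ univ) :=
    ContDiffOn.comp (g := A) (hAV.contDiffOn hVo) contDiff_fst.contDiffOn fun p hp => hp.1
  have hfc : ContDiffOn ℂ 1 f (V ×ˢ univ) :=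
    contDiffOn_const.prodMk ((hAf.mul (contDiff_fst.comp contDiff_snd).contDiffOn).prodMk
      ((contDiff_snd.comp contDiff_snd).contDiffOn.mul hAf).neg)
  have hVn : V ×ˢ univ ∈ 𝓝 ((a, 1, 1) : ℂ × R × R) :=
    (hVo.prod isOpen_univ).mem_nhds ⟨haV, mem_univ _⟩
  obtain ⟨K, t, ht, hK⟩ := (hfc.contDiffAt hVn).exists_lipschitzOnWith
  obtain ⟨r, hr, y, hya, hy⟩ := exists_hasDerivAt_of_lipschitzOnWith (inter_mem ht hVn)
    ((hfc.differentiableOn (by simp)).mono inter_subset_right) (hK.mono inter_subset_left) a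
  have hy1 : ∀ z ∈ ball a r, HasDerivAt (fun z => (y z).1) 1 z := fun z hz =>
    (hy z hz).2.fst
  have hy2 : ∀ z ∈ ball a r, HasDerivAt (fun z => (y z).2.1) (A (y z).1 * (y z).2.1) z :=
    fun z hz => (hy z hz).2.snd.fst
  have hy3 : ∀ z ∈ ball a r, HasDerivAt (fun z => (y z).2.2) (-((y z).2.2 * A (y z).1)) z :=
    fun z hz => (hy z hz).2.snd.snd
  have haB : a ∈ ball a r := mem_ball_self hr
  have hpre : IsPreconnected (ball a r) := (convex_ball a r).isPreconnected
  have hyz : ∀ z ∈ ball a r, (y z).1 = z := by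
    intro z hz
    refine isOpen_ball.eqOn_of_deriv_eq (f := fun z => (y z).1) (g := fun z => z) hpre
      (fun w hw => (hy1 w hw).differentiableAt.differentiableWithinAt) differentiableOn_id
      (fun w hw => ?_) haB (by simp [hya]) hz
    rw [(hy1 w hw).deriv, (hasDerivAt_id' w).deriv]
  refine ⟨r, hr, fun z hz => ?_, fun z => (y z).2.1, fun z => (y z).2.2, fun z hz => ⟨?_, ?_, ?_⟩⟩
  · have := (hy z hz).1.2.1
    rw [hyz z hz] at this
    exact hVU this
  · simpa only [hyz z hz] using hy2 z hz
  · simpa only [hyz z hz] using hy3 z hz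
  -- `(Ψ Φ)' = -Ψ A Φ + Ψ A Φ = 0`, and the product is 1 at `a`.
  · have hd : ∀ w ∈ ball a r, HasDerivAt (fun z => (y z).2.2 * (y z).2.1) 0 w := by
      intro w hw
      refine ((hy3 w hw).mul (hy2 w hw)).congr_deriv ?_
      rw [neg_mul, mul_assoc, neg_add_cancel]
    have := isOpen_ball.is_const_of_deriv_eq_zero hpre
      (fun w hw => (hd w hw).differentiableAt.differentiableWithinAt)
      (fun w hw => (hd w hw).deriv) hz haB
    simpa [hya] using this

section

variable {F G : Type*} [NormedAddCommGroup F] [NormedSpace ℂ F] [NormedAddCommGroup G]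
  [NormedSpace ℂ G]

theorem clm_mul_eq_one_comm [FiniteDimensional ℂ F] {A B : F →L[ℂ] F} (h : A * B = 1) :
    B * A = 1 := by
  have h1 : (A : F →ₗ[ℂ] F) * (B : F →ₗ[ℂ] F) = 1 :=
    LinearMap.ext fun x => congrArg (fun T : F →L[ℂ] F => T x) h
  have h2 := mul_eq_one_comm.1 h1
  exact ContinuousLinearMap.ext fun x => congrArg (fun T : F →ₗ[ℂ] F => T x) h2

/-- Product rule for a holomorphic family of operators applied along a ray. -/
theorem hasDerivAt_clm_apply_ray {B : ℂ → F →L[ℂ] G} {B' : F →L[ℂ] G} {z₀ : ℂ} {u : ℝ}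
    (hB : HasDerivAt B B' (u * z₀)) {v : ℝ → F} {v' : F} (hv : HasDerivAt v v' u) :
    HasDerivAt (fun s : ℝ => B (s * z₀) (v s)) (z₀ • B' (v u) + B (u * z₀) v') u := by
  have h1 : HasFDerivAt (fun p : ℂ × F => B p.1) _ ((u * z₀, v u) : ℂ × F) :=
    HasFDerivAt.comp (g := B) _ hB.hasFDerivAt hasFDerivAt_fst
  have h2 := (h1.clm_apply (hasFDerivAt_snd (𝕜 := ℂ) (p := ((u * z₀, v u) : ℂ × F)))).restrictScalars ℝ
  have h3 := HasFDerivAt.comp_hasDerivAt (f := fun s : ℝ => ((s * z₀, v s) : ℂ × F)) u h2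
    ((hasDerivAt_ray z₀ u).prodMk hv)
  refine h3.congr_deriv ?_
  simp [add_comm]

end

/-! ### The Jacobi equation as a linear first order system -/

section JacobiSystem

variable {E : Type*} [NormedAddCommGroup E] [NormedSpace ℂ E] [FiniteDimensional ℂ E]
  {M : Type*} [TopologicalSpace M] [ChartedSpace E M] [IsManifold 𝓘(ℂ, E) ω M]
  {g : BilinField E M} {γ : ℂ → M} {x₀ : M}

/-- The matrix of the Jacobi equation, written as a first order system for the coordinates of a
field and of its covariant derivative along a curve at the point `y` with velocity `v`. -/
noncomputable def jacobiMatrix (g : BilinField E M) (x₀ : M) (y v : E) : (E × E) →L[ℂ] (E × E) :=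
  LinearMap.toContinuousLinearMap
    { toFun := fun p => (p.2 - chrC g x₀ y v p.1, -curvC g x₀ y p.1 v v - chrC g x₀ y v p.2)
      map_add' := fun p q => by
        simp only [curvC, Prod.fst_add, Prod.snd_add, map_add, add_apply, Prod.mk_add_mk]
        congr 1 <;> abel
      map_smul' := fun c p => by
        simp only [curvC, Prod.smul_fst, Prod.smul_snd, map_smul, smul_apply, Prod.smul_mk,
          RingHom.id_apply, smul_sub, smul_add, smul_neg] }

theorem jacobiMatrix_apply (y v : E) (p : E × E) : jacobiMatrix g x₀ y v p =
    (p.2 - chrC g x₀ y v p.1, -curvC g x₀ y p.1 v v - chrC g x₀ y v p.2) := rfl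

/-- The matrix of the Jacobi equation along `γ`. -/
noncomputable def jacobiMatrixAlong (g : BilinField E M) (γ : ℂ → M) (x₀ : M) (z : ℂ) :
    (E × E) →L[ℂ] (E × E) :=
  jacobiMatrix g x₀ (chartAt E x₀ (γ z)) (deriv (fun w => chartAt E x₀ (γ w)) z)

/-- `X` is at `z` a solution of the complex Jacobi equation with covariant derivative `P`. -/
def IsJacobiPairAt (g : BilinField E M) (γ : ℂ → M) (X P : (z : ℂ) → Tan E (γ z)) (z : ℂ) : Prop :=
  HolFieldAt γ X z ∧ HolFieldAt γ P z ∧ covDerivAlong g γ X z 1 = P z ∧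
    covDerivAlong g γ P z 1 + curvature g (γ z) (X z) (push E γ z 1) (push E γ z 1) = 0

variable (hg : IsAntiKaehler g)
include hg

theorem isJacobiPairAt_iff {X P : (z : ℂ) → Tan E (γ z)} {z : ℂ} (hγ : IsHolAt E γ z)
    (hz : γ z ∈ (chartAt E x₀).source) :
    IsJacobiPairAt g γ X P z ↔
      HasDerivAt (fun w => (coord (chartAt E x₀) (γ w) (X w), coord (chartAt E x₀) (γ w) (P w)))
        (jacobiMatrixAlong g γ x₀ z
          (coord (chartAt E x₀) (γ z) (X z), coord (chartAt E x₀) (γ z) (P z))) z := by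
  have key : HolFieldAt γ X z → HolFieldAt γ P z →
      ((covDerivAlong g γ X z 1 = P z ∧
        covDerivAlong g γ P z 1 + curvature g (γ z) (X z) (push E γ z 1) (push E γ z 1) = 0) ↔
      (deriv (fun w => coord (chartAt E x₀) (γ w) (X w)) z,
        deriv (fun w => coord (chartAt E x₀) (γ w) (P w)) z) = jacobiMatrixAlong g γ x₀ z
          (coord (chartAt E x₀) (γ z) (X z), coord (chartAt E x₀) (γ z) (P z))) := by
    intro hX hP
    rw [jacobiMatrixAlong, jacobiMatrix_apply, Prod.mk.injEq]
    refine and_congr ?_ ?_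
    · rw [← (show coord _ _ _ = coord _ _ _ ↔ _ from
        ⟨coord_injective (chart_mem x₀) hz, fun h => by rw [h]⟩),
        coord_covDerivAlong_complex hg hγ hX hz, one_smul, eq_sub_iff_add_eq]
    · rw [← coord_eq_zero (chart_mem x₀) hz, coord_add,
        coord_covDerivAlong_complex hg hγ hP hz, one_smul, coord_curvature hg hz,
        coord_push_complex (chart_mem x₀) hγ hz, one_smul, add_assoc, add_eq_zero_iff_eq_neg,
        neg_add_rev, sub_eq_add_neg]
  constructor
  · rintro ⟨hX, hP, h⟩
    rw [← (key hX hP).1 h]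
    exact (hX _ (chart_mem x₀) hz).hasDerivAt.prodMk (hP _ (chart_mem x₀) hz).hasDerivAt
  · intro h
    have h1 : HasDerivAt (fun w => coord (chartAt E x₀) (γ w) (X w)) _ z := h.fst
    have h2 : HasDerivAt (fun w => coord (chartAt E x₀) (γ w) (P w)) _ z := h.snd
    have hX : HolFieldAt γ X z := .of_chart hγ (chart_mem x₀) hz h1.differentiableAt
    have hP : HolFieldAt γ P z := .of_chart hγ (chart_mem x₀) hz h2.differentiableAt
    refine ⟨hX, hP, (key hX hP).2 ?_⟩
    rw [h1.deriv, h2.deriv]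

set_option maxSynthPendingDepth 6 in
theorem differentiableOn_jacobiMatrixAlong {U : Set ℂ} (hU : IsOpen U)
    (hγ : ∀ z ∈ U, IsHolAt E γ z) (hUx : ∀ z ∈ U, γ z ∈ (chartAt E x₀).source) :
    DifferentiableOn ℂ (jacobiMatrixAlong g γ x₀) U := by
  have : CompleteSpace E := FiniteDimensional.complete ℂ E
  -- In finite dimension it is enough to treat the operators applied to a fixed vector; the detour
  -- through `C¹` is free, since complex differentiability on an open set implies it.
  refine ContDiffOn.differentiableOn (n := 1) (contDiffOn_clm_apply.2 fun p => ?_) (by simp)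
  refine DifferentiableOn.contDiffOn (fun z hz => ?_) hU
  refine DifferentiableAt.differentiableWithinAt ?_
  have hy := (hγ z hz).analyticAt (chart_mem x₀) (hUx z hz)
  have hy' := hy.deriv.differentiableAt
  have ht := (chartAt E x₀).map_source (hUx z hz)
  have h1 : DifferentiableAt ℂ (fun w => chrC g x₀ (chartAt E x₀ (γ w))) z :=
    DifferentiableAt.comp (g := chrC g x₀) z (differentiableAt_chrC hg ht) hy.differentiableAt
  have h2 : DifferentiableAt ℂ (fun w => fderiv ℂ (chrC g x₀) (chartAt E x₀ (γ w))) z :=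
    DifferentiableAt.comp (g := fderiv ℂ (chrC g x₀)) z (differentiableAt_fderiv_chrC hg ht)
      hy.differentiableAt
  have h3 := h1.clm_apply hy'
  have hc : ∀ c : E, DifferentiableAt ℂ (fun _ : ℂ => c) z := fun c => differentiableAt_const c
  refine ((hc p.2).sub (h3.clm_apply (hc p.1))).prodMk
    (DifferentiableAt.sub (DifferentiableAt.neg ?_) (h3.clm_apply (hc p.2)))
  exact (((((h2.clm_apply (hc p.1)).clm_apply hy').clm_apply hy').sub
    (((h2.clm_apply hy').clm_apply (hc p.1)).clm_apply hy')).add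
    ((h1.clm_apply (hc p.1)).clm_apply (h3.clm_apply hy'))).sub
    (h3.clm_apply ((h1.clm_apply (hc p.1)).clm_apply hy'))

end JacobiSystem

/-! ### Initial value problem and uniqueness for Jacobi fields -/

section JacobiFields

variable {E : Type*} [NormedAddCommGroup E] [NormedSpace ℂ E] [FiniteDimensional ℂ E]
  {M : Type*} [TopologicalSpace M] [ChartedSpace E M] [IsManifold 𝓘(ℂ, E) ω M]
  {g : BilinField E M} {γ : ℂ → M} (hg : IsAntiKaehler g) (hγ : ∀ z, IsHolAt E γ z)

/-- The coordinates of tangent vectors at `x` in the preferred chart at `x₀`. -/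
noncomputable def tanEquiv (x₀ x : M) : E ≃L[ℂ] E :=
  open Classical in
  if hx : x ∈ (chartAt E x₀).source then (exists_coordEquiv (chart_mem (E := E) x₀) hx).choose
  else ContinuousLinearEquiv.refl ℂ E

theorem coord_eq_tanEquiv {x₀ x : M} (hx : x ∈ (chartAt E x₀).source) (v : Tan E x) :
    coord (chartAt E x₀) x v = tanEquiv x₀ x (comp x v) := by
  rw [tanEquiv, dif_pos hx]
  exact (exists_coordEquiv (chart_mem (E := E) x₀) hx).choose_spec v

include hg hγ

/-- In finite dimension the left inverse `Ψ` is also a right inverse. -/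
theorem exists_jacobi_fundamentalSolution (a : ℂ) :
    ∃ r > 0, ∃ Φ Ψ : ℂ → (E × E) →L[ℂ] (E × E), ∀ z ∈ ball a r,
      γ z ∈ (chartAt E (γ a)).source ∧
      HasDerivAt Φ (jacobiMatrixAlong g γ (γ a) z * Φ z) z ∧
      HasDerivAt Ψ (-(Ψ z * jacobiMatrixAlong g γ (γ a) z)) z ∧ Ψ z * Φ z = 1 ∧ Φ z * Ψ z = 1 := by
  have : CompleteSpace E := FiniteDimensional.complete ℂ E
  have hcont : Continuous γ := continuous_iff_continuousAt.2 fun z => (hγ z).continuousAt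
  have hUo : IsOpen (γ ⁻¹' (chartAt E (γ a)).source) :=
    (chartAt E (γ a)).open_source.preimage hcont
  obtain ⟨r, hr, hrU, Φ, Ψ, h⟩ := exists_fundamentalSolution
    (hUo.mem_nhds (mem_chart_source E (γ a)))
    (differentiableOn_jacobiMatrixAlong hg hUo (fun z _ => hγ z) fun z hz => hz)
  exact ⟨r, hr, Φ, Ψ, fun z hz => ⟨hrU hz, (h z hz).1, (h z hz).2.1, (h z hz).2.2,
    clm_mul_eq_one_comm (h z hz).2.2⟩⟩

/-- The initial value problem for the complex Jacobi equation. -/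
theorem exists_isJacobiPairAt (p₀ : E × E) :
    ∃ X P : (z : ℂ) → Tan E (γ z), comp (γ 0) (X 0) = p₀.1 ∧ comp (γ 0) (P 0) = p₀.2 ∧
      ∀ z, IsJacobiPairAt g γ X P z := by
  classical
  choose r hr Φ Ψ h using exists_jacobi_fundamentalSolution hg hγ
  -- Variation of constants: `Θ a z` sends a value and a covariant derivative at `z` to `Ψ` applied
  -- to their coordinates, which is constant along solutions. Off the ball an arbitrary bijection is
  -- used.
  let Θ : ℂ → ℂ → E × E ≃ E × E := fun a z =>
    if hz : z ∈ ball a (r a) then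
      { toFun := fun p => Ψ a z (tanEquiv (γ a) (γ z) p.1, tanEquiv (γ a) (γ z) p.2)
        invFun := fun q => ((tanEquiv (γ a) (γ z)).symm (Φ a z q).1,
          (tanEquiv (γ a) (γ z)).symm (Φ a z q).2)
        left_inv := fun p => by
          have := congrArg (fun T : (E × E) →L[ℂ] (E × E) =>
            T (tanEquiv (γ a) (γ z) p.1, tanEquiv (γ a) (γ z) p.2)) (h a z hz).2.2.2.2
          simp only [mul_apply_eq_comp, one_apply_eq_self] at this
          simp [this]
        right_inv := fun q => by
          have := congrArg (fun T : (E × E) →L[ℂ] (E × E) => T q) (h a z hz).2.2.2.1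
          simpa using this }
    else Equiv.refl _
  let vec : (ℂ → E × E) → (z : ℂ) → Tan E (γ z) := fun s z => (comp (γ z)).symm (s z).1
  let cov : (ℂ → E × E) → (z : ℂ) → Tan E (γ z) := fun s z => (comp (γ z)).symm (s z).2
  have hΘ : ∀ a, ∀ z ∈ ball a (r a), ∀ s : ℂ → E × E, Θ a z (s z) =
      Ψ a z (coord (chartAt E (γ a)) (γ z) (vec s z), coord (chartAt E (γ a)) (γ z) (cov s z)) := by
    intro a z hz s
    rw [coord_eq_tanEquiv (h a z hz).1, coord_eq_tanEquiv (h a z hz).1]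
    simp only [Θ, dif_pos hz]
    rfl
  have hpair : ∀ a, ∀ s : ℂ → E × E, ∀ k, (∀ z ∈ ball a (r a), Θ a z (s z) = k) →
      ∀ z ∈ ball a (r a), IsJacobiPairAt g γ (vec s) (cov s) z := by
    intro a s k hs z hz
    have hco : ∀ w ∈ ball a (r a), (coord (chartAt E (γ a)) (γ w) (vec s w),
        coord (chartAt E (γ a)) (γ w) (cov s w)) = Φ a w k := by
      intro w hw
      rw [← hs w hw, hΘ a w hw, ← mul_apply_eq_comp, (h a w hw).2.2.2.2]
      rfl
    refine (isJacobiPairAt_iff hg (hγ z) (h a z hz).1).2 ?_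
    rw [hco z hz]
    refine HasDerivAt.congr_of_eventuallyEq (f := fun w => Φ a w k) ?_ ?_
    · simpa using (h a z hz).2.1.clm_apply (hasDerivAt_const z k)
    · filter_upwards [isOpen_ball.mem_nhds hz] with w hw using hco w hw
  -- Along a solution the derivative of `Ψ` cancels that of the state. A solution built over one
  -- ball thus has constant image in any other trivialization, which gives locally constant
  -- transition maps.
  have hconst : ∀ b, ∀ s : ℂ → E × E, ∀ U, IsOpen U → IsPreconnected U → U ⊆ ball b (r b) →
      (∀ z ∈ U, IsJacobiPairAt g γ (vec s) (cov s) z) →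
      ∀ z ∈ U, ∀ w ∈ U, Θ b z (s z) = Θ b w (s w) := by
    intro b s U hUo hU hUb hs z hz w hw
    rw [hΘ b z (hUb hz), hΘ b w (hUb hw)]
    have hd : ∀ ζ ∈ U, HasDerivAt (fun ζ => Ψ b ζ (coord (chartAt E (γ b)) (γ ζ) (vec s ζ),
        coord (chartAt E (γ b)) (γ ζ) (cov s ζ))) 0 ζ := by
      intro ζ hζ
      refine ((h b ζ (hUb hζ)).2.2.1.clm_apply
        ((isJacobiPairAt_iff hg (hγ ζ) (h b ζ (hUb hζ)).1).1 (hs ζ hζ))).congr_deriv ?_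
      simp
    exact hUo.is_const_of_deriv_eq_zero hU
      (fun ζ hζ => (hd ζ hζ).differentiableAt.differentiableWithinAt)
      (fun ζ hζ => (hd ζ hζ).deriv) hz hw
  obtain ⟨s, hs0, hs⟩ := exists_flat_section r hr Θ (fun a b z hz w hw x => by
    have h1 := hpair a (fun ζ => (Θ a ζ).symm x) x (fun ζ _ => (Θ a ζ).apply_symm_apply x)
    exact hconst b (fun ζ => (Θ a ζ).symm x) (ball a (r a) ∩ ball b (r b))
      (isOpen_ball.inter isOpen_ball)
      ((convex_ball a _).inter (convex_ball b _)).isPreconnected inter_subset_right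
      (fun ζ hζ => h1 ζ hζ.1) z hz w hw) p₀
  refine ⟨vec s, cov s, congrArg Prod.fst hs0, congrArg Prod.snd hs0, fun a => ?_⟩
  exact hpair a s (Θ a a (s a)) (fun z hz => hs a z hz a (mem_ball_self (hr a))) a
    (mem_ball_self (hr a))

/-- A real Jacobi field along a ray solves, in coordinates, the restricted complex system. -/
theorem hasDerivAt_jacobiState_ray {z₀ : ℂ} (hz₀ : z₀ ≠ 0) {V : (u : ℝ) → Tan E (γ (u * z₀))}
    (hV : IsJacobiField g (fun u : ℝ => γ (u * z₀)) V) {x₀ : M} {u : ℝ}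
    (hu : γ (u * z₀) ∈ (chartAt E x₀).source) :
    HasDerivAt (fun s : ℝ => (coord (chartAt E x₀) (γ (s * z₀)) (V s),
        z₀⁻¹ • coord (chartAt E x₀) (γ (s * z₀))
          (covDerivAlong g (fun u : ℝ => γ (u * z₀)) V s 1)))
      (z₀ • jacobiMatrixAlong g γ x₀ (u * z₀) (coord (chartAt E x₀) (γ (u * z₀)) (V u),
        z₀⁻¹ • coord (chartAt E x₀) (γ (u * z₀))
          (covDerivAlong g (fun u : ℝ => γ (u * z₀)) V u 1))) u := by
  set φ := chartAt E x₀ with hφ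
  set c : ℝ → M := fun u => γ (u * z₀) with hc
  have hcc : Continuous c := by
    refine Continuous.comp (g := γ) (continuous_iff_continuousAt.2 fun z => (hγ z).continuousAt) ?_
    exact Complex.continuous_ofReal.mul continuous_const
  have hSo : IsOpen (c ⁻¹' φ.source) := φ.open_source.preimage hcc
  set v : ℝ → E := fun s => coord φ (c s) (V s) with hv
  set q : ℝ → E := fun s => coord φ (c s) (covDerivAlong g c V s 1) with hq
  set y : ℂ → E := fun w => φ (γ w) with hy
  set B : ℂ → E →L[ℂ] E := fun w => chrC g x₀ (y w) (deriv y w) with hB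
  have hya : ∀ s ∈ c ⁻¹' φ.source, AnalyticAt ℂ y (s * z₀) := fun s hs =>
    (hγ _).analyticAt (chart_mem x₀) hs
  have hyd : ∀ s ∈ c ⁻¹' φ.source,
      HasDerivAt (fun s : ℝ => φ (c s)) (z₀ • deriv y (s * z₀)) s := fun s hs =>
    HasDerivAt.scomp (g₁ := y) s (hya s hs).differentiableAt.hasDerivAt (hasDerivAt_ray z₀ s)
  have hvs : ∀ s ∈ c ⁻¹' φ.source, ContDiffAt ℝ ∞ v s := fun s hs =>
    (hV.1 x₀).contDiffAt (hSo.mem_nhds hs)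
  have hvd : ∀ s ∈ c ⁻¹' φ.source, DifferentiableAt ℝ v s := fun s hs =>
    (hvs s hs).differentiableAt (by simp)
  have hcov : ∀ s ∈ c ⁻¹' φ.source, ∀ W : (u : ℝ) → Tan E (c u),
      DifferentiableAt ℝ (fun s => coord φ (c s) (W s)) s →
      coord φ (c s) (covDerivAlong g c W s 1) =
        deriv (fun s => coord φ (c s) (W s)) s + z₀ • B (s * z₀) (coord φ (c s) (W s)) := by
    intro s hs W hW
    have h1 := coord_covDerivAlong hg (f := c) (V := W) hcc.continuousAt hs
      (hyd s hs).differentiableAt hW 1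
    rw [fderiv_apply_one_eq_deriv, fderiv_apply_one_eq_deriv, (hyd s hs).deriv, map_smul] at h1
    exact h1
  have hqv : ∀ s ∈ c ⁻¹' φ.source, q s = deriv v s + z₀ • B (s * z₀) (v s) := fun s hs =>
    hcov s hs V (hvd s hs)
  have hBd : DifferentiableAt ℂ B (u * z₀) := by
    have : CompleteSpace E := FiniteDimensional.complete ℂ E
    have h1 : DifferentiableAt ℂ (fun w => chrC g x₀ (y w)) (u * z₀) :=
      DifferentiableAt.comp (g := chrC g x₀) _ (differentiableAt_chrC hg (φ.map_source hu))
        (hya u hu).differentiableAt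
    exact h1.clm_apply (hya u hu).deriv.differentiableAt
  -- Differentiability of the first covariant derivative is read off from its formula, since only
  -- the smoothness of `V` itself is given.
  have hqd : DifferentiableAt ℝ q u := by
    have h1 : DifferentiableAt ℝ (deriv v) u :=
      differentiableAt_deriv_of_contDiffAt ((hvs u hu).of_le (by exact two_le_infty))
    have h2 := hasDerivAt_clm_apply_ray hBd.hasDerivAt (hvd u hu).hasDerivAt
    refine (h1.add (h2.differentiableAt.fun_const_smul z₀)).congr_of_eventuallyEq ?_
    filter_upwards [hSo.mem_nhds hu] with s hs using hqv s hs
  -- The covariant derivative along the ray is `z₀` times the one along `γ`; dividing it by `z₀`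
  -- turns the real equations into `z₀` times the complex system.
  have hv' : deriv v u = z₀ • (z₀⁻¹ • q u - B (u * z₀) (v u)) := by
    rw [smul_sub, smul_inv_smul₀ hz₀, hqv u hu, add_sub_cancel_right]
  have hq' : z₀⁻¹ • deriv q u = z₀ • (-curvC g x₀ (y (u * z₀)) (v u) (deriv y (u * z₀))
      (deriv y (u * z₀)) - B (u * z₀) (z₀⁻¹ • q u)) := by
    have h1 := congrArg (coord φ (c u)) (hV.2 u)
    rw [coord_zero, coord_add, hcov u hu (fun s => covDerivAlong g c V s 1) hqd,
      coord_curvature hg hu, velocity_ray (hγ _), coord_cmul (chart_mem x₀) hu,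
      coord_push_complex (chart_mem x₀) (hγ _) hu, one_smul] at h1
    have h2 : deriv q u + z₀ • B (u * z₀) (q u) + curvC g x₀ (y (u * z₀)) (v u)
      (z₀ • deriv y (u * z₀)) (z₀ • deriv y (u * z₀)) = 0 := h1
    have h3 : curvC g x₀ (y (u * z₀)) (v u) (z₀ • deriv y (u * z₀)) (z₀ • deriv y (u * z₀)) =
        (z₀ * z₀) • curvC g x₀ (y (u * z₀)) (v u) (deriv y (u * z₀)) (deriv y (u * z₀)) := by
      simp only [curvC, map_smul, smul_apply, smul_add, smul_sub, smul_smul]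
    rw [h3, add_assoc, add_eq_zero_iff_eq_neg] at h2
    rw [h2, map_smul, smul_sub, smul_neg, smul_neg, smul_add, smul_inv_smul₀ hz₀,
      inv_smul_smul₀ hz₀, smul_smul, inv_mul_cancel_left₀ hz₀, neg_add_rev, sub_eq_add_neg]
  refine ((hvd u hu).hasDerivAt.prodMk (hqd.hasDerivAt.fun_const_smul z₀⁻¹)).congr_deriv ?_
  rw [hv', hq', jacobiMatrixAlong, jacobiMatrix_apply]
  rfl

/-- A Jacobi field along a ray is determined by its initial value and initial derivative. -/
theorem isJacobiField_ray_unique {z₀ : ℂ} (hz₀ : z₀ ≠ 0) {V W : (u : ℝ) → Tan E (γ (u * z₀))}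
    (hV : IsJacobiField g (fun u : ℝ => γ (u * z₀)) V)
    (hW : IsJacobiField g (fun u : ℝ => γ (u * z₀)) W) (h0 : V 0 = W 0)
    (h1 : covDerivAlong g (fun u : ℝ => γ (u * z₀)) V 0 1 =
      covDerivAlong g (fun u : ℝ => γ (u * z₀)) W 0 1) (u : ℝ) : V u = W u := by
  set D : ((u : ℝ) → Tan E (γ (u * z₀))) → (u : ℝ) → Tan E (γ (u * z₀)) := fun V u =>
    covDerivAlong g (fun u : ℝ => γ (u * z₀)) V u 1 with hD
  -- Equality of value and covariant derivative is shown to be a locally constant proposition, hence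
  -- constant on `ℝ`. Locally, the injective `Ψ` turns the states of both fields into constants.
  have hlc : IsLocallyConstant fun u => V u = W u ∧ D V u = D W u := by
    refine (IsLocallyConstant.iff_eventually_eq _).2 fun t => ?_
    obtain ⟨r, hr, Φ, Ψ, h⟩ := exists_jacobi_fundamentalSolution hg hγ (t * z₀)
    have hpre : (fun s : ℝ => (s * z₀ : ℂ)) ⁻¹' ball (t * z₀) r ∈ 𝓝 t :=
      (hasDerivAt_ray z₀ t).continuousAt.preimage_mem_nhds (ball_mem_nhds _ hr)
    obtain ⟨δ, hδ, hsub⟩ := Metric.mem_nhds_iff.1 hpre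
    set φ := chartAt E (γ (t * z₀)) with hφ
    set S : ((u : ℝ) → Tan E (γ (u * z₀))) → ℝ → E × E := fun V s =>
      (coord φ (γ (s * z₀)) (V s), z₀⁻¹ • coord φ (γ (s * z₀)) (D V s)) with hS
    have hconst : ∀ V, IsJacobiField g (fun u : ℝ => γ (u * z₀)) V → ∀ s ∈ ball t δ,
        Ψ (s * z₀) (S V s) = Ψ (t * z₀) (S V t) := by
      intro V hV s hs
      have hd : ∀ s ∈ ball t δ, HasDerivAt (fun s : ℝ => Ψ (s * z₀) (S V s)) 0 s := by
        intro s hs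
        refine (hasDerivAt_clm_apply_ray (h _ (hsub hs)).2.2.1
          (hasDerivAt_jacobiState_ray hg hγ hz₀ hV (h _ (hsub hs)).1)).congr_deriv ?_
        rw [map_smul, neg_apply, mul_apply_eq_comp, smul_neg]
        exact neg_add_cancel _
      exact isOpen_ball.is_const_of_deriv_eq_zero (convex_ball t δ).isPreconnected
        (fun ζ hζ => (hd ζ hζ).differentiableAt.differentiableWithinAt)
        (fun ζ hζ => (hd ζ hζ).deriv) hs (mem_ball_self hδ)
    have hinj : ∀ s ∈ ball t δ, Function.Injective (Ψ (s * z₀)) := by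
      intro s hs
      refine Function.LeftInverse.injective (g := Φ (s * z₀)) fun x => ?_
      rw [← mul_apply_eq_comp, (h _ (hsub hs)).2.2.2.2]
      rfl
    have hSeq : ∀ s ∈ ball t δ, (V s = W s ∧ D V s = D W s) ↔ S V s = S W s := by
      intro s hs
      have hs' := (h _ (hsub hs)).1
      simp only [hS, Prod.mk.injEq, smul_right_inj (inv_ne_zero hz₀)]
      exact and_congr ⟨fun e => by rw [e], coord_injective (chart_mem _) hs'⟩
        ⟨fun e => by rw [e], coord_injective (chart_mem _) hs'⟩
    filter_upwards [ball_mem_nhds t hδ] with s hs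
    rw [hSeq s hs, hSeq t (mem_ball_self hδ), ← (hinj s hs).eq_iff, hconst V hV s hs,
      hconst W hW s hs, (hinj t (mem_ball_self hδ)).eq_iff]
  exact ((hlc.apply_eq_of_preconnectedSpace u 0).mpr ⟨h0, h1⟩).1

end JacobiFields

/-! ### Conjugate radii and conjugate points -/

section ConjugateRadii

variable {E : Type*} [NormedAddCommGroup E] [NormedSpace ℂ E] [FiniteDimensional ℂ E]
  {M : Type*} [TopologicalSpace M] [ChartedSpace E M] [IsManifold 𝓘(ℂ, E) ω M]
  {g : BilinField E M} {γ : ℂ → M} (hg : IsAntiKaehler g) (hγ : ∀ z, IsHolAt E γ z)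

theorem IsJacobiPairAt.jacobiOp_eq_zero {X P : (z : ℂ) → Tan E (γ z)}
    (h : ∀ z, IsJacobiPairAt g γ X P z) (z : ℂ) : jacobiOp g γ X z = 0 := by
  have h1 : (fun w => covDerivAlong g γ X w 1) = P := funext fun w => (h w).2.2.1
  rw [jacobiOp, h1]
  exact (h z).2.2.2

theorem holFieldAt_zero (z : ℂ) : HolFieldAt γ (fun z => (0 : Tan E (γ z))) z := by
  intro φ _ _
  simp only [coord_zero]
  exact differentiableAt_const 0

include hg hγ

theorem covDerivAlong_zero (z : ℂ) :
    covDerivAlong g γ (fun z => (0 : Tan E (γ z))) z 1 = 0 := by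
  have h := covDerivAlong_cmul hg hγ (holFieldAt_zero z) 0 1
  simpa only [cmul_zero, mul_zero, zero_cmul] using h

theorem isJacobiField_ray_zero (z₀ : ℂ) : IsJacobiField g (fun u : ℝ => γ (u * z₀))
    (fun u : ℝ => (0 : Tan E (γ (u * z₀)))) := by
  refine (isJacobiField_ray_iff hg hγ (fun z => holFieldAt_zero z) z₀).2 fun u => ?_
  have h1 : (fun w => covDerivAlong g γ (fun z => (0 : Tan E (γ z))) w 1) = fun w => 0 :=
    funext fun w => covDerivAlong_zero hg hγ w
  have h2 := curvature_cmul hg (x := γ (u * z₀)) 0 1 1 0 (push E γ (u * z₀) 1)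
    (push E γ (u * z₀) 1)
  rw [cmul_zero, cmul_one, zero_mul, zero_mul, zero_cmul] at h2
  rw [jacobiOp, h1, covDerivAlong_zero hg hγ, h2, add_zero, cmul_zero]

/-- A holomorphic field whose real part satisfies the complex Jacobi equation and vanishes on a
real ray vanishes. -/
theorem eq_zero_of_ray_eq_zero {X : (z : ℂ) → Tan E (γ z)} (hX : ∀ z, HolFieldAt γ X z)
    (hJ : ∀ z, jacobiOp g γ X z = 0) {z₀ : ℂ} (hz₀ : z₀ ≠ 0) (h : ∀ u : ℝ, X (u * z₀) = 0)
    (z : ℂ) : X z = 0 := by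
  have hX0 : ∀ z, z = 0 → X z = 0 := by
    have h1 := h 0
    have e : ((0 : ℝ) : ℂ) * z₀ = 0 := by simp
    rw [e] at h1
    rintro z rfl
    exact h1
  have hzero : ∀ z₁ : ℂ, covDerivAlong g (fun u : ℝ => γ (u * z₁))
      (fun u : ℝ => (0 : Tan E (γ (u * z₁)))) 0 1 = 0 := by
    intro z₁
    rw [covDerivAlong_ray hg hγ (fun z => holFieldAt_zero z) z₁ 0, covDerivAlong_zero hg hγ,
      cmul_zero]
  -- The covariant derivative along the vanishing ray is zero and equals `z₀` times `∇_1 X` at 0, so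
  -- all initial data at 0 vanish and every other ray is covered by uniqueness.
  have hP : ∀ z, z = 0 → covDerivAlong g γ X z 1 = 0 := by
    have h1 := covDerivAlong_ray hg hγ hX z₀ 0
    simp only [h] at h1
    rw [hzero, eq_comm, cmul_eq_zero hz₀] at h1
    rintro z rfl
    have e : ((0 : ℝ) : ℂ) * z₀ = 0 := by simp
    rwa [e] at h1
  rcases eq_or_ne z 0 with rfl | hz
  · exact hX0 0 rfl
  have h2 := isJacobiField_ray_unique hg hγ hz
    ((isJacobiField_ray_iff hg hγ hX z).2 fun u => by rw [hJ, cmul_zero])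
    (isJacobiField_ray_zero hg hγ z) ?_ ?_ 1
  · have e : ((1 : ℝ) : ℂ) * z = z := by simp
    rwa [e] at h2
  · exact hX0 _ (by simp)
  · rw [hzero, covDerivAlong_ray hg hγ hX z 0, hP _ (by simp), cmul_zero]

/-- A complex field restricts to the ray, and it stays nonzero by `eq_zero_of_ray_eq_zero`.
Conversely, a real field extends: solve the complex equation with matching data at 0; by uniqueness
the solution restricts to the given field and so vanishes at `z₀`. -/
theorem isComplexConjugateRadius_iff {z₀ : ℂ} (hz₀ : z₀ ≠ 0) :
    IsComplexConjugateRadius g γ z₀ ↔ IsConjugateAlong g (fun u : ℝ => γ (u * z₀)) 0 1 := by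
  have e0 : ((0 : ℝ) : ℂ) * z₀ = 0 := by simp
  have e1 : ((1 : ℝ) : ℂ) * z₀ = z₀ := by simp
  constructor
  · rintro ⟨Y, hY, ⟨z, hz⟩, hY0, hY1⟩
    obtain ⟨h1, h2⟩ := (isHolomorphicAlong_iff hγ Y).1 hY.1
    have hJ := (isComplexJacobiField_iff hg hγ Y hY.1).1 hY
    refine ⟨fun u => (Y (u * z₀)).re, (forall_isJacobiField_ray_iff hg hγ h2).2 hJ z₀, ?_, ?_, ?_⟩
    · by_contra! hu
      have h3 : (Y z).re = 0 := eq_zero_of_ray_eq_zero hg hγ h2 hJ hz₀ hu z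
      apply hz
      rw [h1, h3, type10, cmul_zero]
      rfl
    · show (Y (((0 : ℝ) : ℂ) * z₀)).re = 0
      rw [e0, hY0]
      rfl
    · show (Y (((1 : ℝ) : ℂ) * z₀)).re = 0
      rw [e1, hY1]
      rfl
  · rintro ⟨V, hV, ⟨u, hu⟩, hV0, hV1⟩
    -- Stated for every `z` equal to 0, because the tangent space at `γ(0 * z₀)` is not
    -- syntactically the one at `γ 0`.
    have hex : ∀ z, z = 0 → ∀ p : Tan E (γ z), ∃ X P : (z : ℂ) → Tan E (γ z),
        X z = 0 ∧ P z = p ∧ ∀ z, IsJacobiPairAt g γ X P z := by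
      rintro z rfl p
      exact exists_isJacobiPairAt hg hγ (0, comp (γ 0) p)
    -- The factor `z₀⁻¹` compensates for the factor `z₀` that restriction to the ray puts on the
    -- covariant derivative.
    obtain ⟨X, P, hX0, hP0, hXP⟩ := hex _ e0
      (cmul z₀⁻¹ (covDerivAlong g (fun u : ℝ => γ (u * z₀)) V 0 1))
    have hX : ∀ z, HolFieldAt γ X z := fun z => (hXP z).1
    have hJ := IsJacobiPairAt.jacobiOp_eq_zero hXP
    have hcov : covDerivAlong g (fun u : ℝ => γ (u * z₀)) (fun u : ℝ => X (u * z₀)) 0 1 =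
        covDerivAlong g (fun u : ℝ => γ (u * z₀)) V 0 1 := by
      rw [covDerivAlong_ray hg hγ hX z₀ 0, (hXP _).2.2.1, hP0, cmul_comp, mul_inv_cancel₀ hz₀,
        cmul_one]
    have hVX := isJacobiField_ray_unique hg hγ hz₀ hV
      ((forall_isJacobiField_ray_iff hg hγ hX).2 hJ z₀) (hV0.trans hX0.symm) hcov.symm
    have hYhol : IsHolomorphicAlong γ fun z => type10 (X z) :=
      (isHolomorphicAlong_iff hγ _).2 ⟨fun z => rfl, hX⟩
    refine ⟨fun z => type10 (X z), (isComplexJacobiField_iff hg hγ _ hYhol).2 hJ,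
      ⟨u * z₀, fun h => hu ?_⟩, ?_, ?_⟩
    · rw [hVX]
      exact congrArg Complexified.re h
    · rw [e0] at hX0
      show type10 (X 0) = 0
      rw [hX0, type10, cmul_zero]
      rfl
    · have h3 : X z₀ = 0 := by
        have := (hVX 1).symm.trans hV1
        rwa [e1] at this
      show type10 (X z₀) = 0
      rw [h3, type10, cmul_zero]
      rfl

end ConjugateRadii

end AntiKaehler

theorem proposition8p2
    {E : Type*} [NormedAddCommGroup E] [NormedSpace ℂ E] [FiniteDimensional ℂ E]
    {M : Type*} [TopologicalSpace M] [T2Space M] [ChartedSpace E M] [IsManifold 𝓘(ℂ, E) ω M]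
    (g : AntiKaehler.BilinField E M) (hg : AntiKaehler.IsAntiKaehler g)
    (γ : ℂ → M) (hγ : AntiKaehler.IsComplexGeodesic g γ) :
    (∀ z₀ : ℂ, AntiKaehler.IsGeodesic g (fun u : ℝ => γ (u * z₀))) ∧
    (∀ Y : (z : ℂ) → AntiKaehler.Complexified (AntiKaehler.Tan E (γ z)),
      AntiKaehler.IsHolomorphicAlong γ Y →
        (AntiKaehler.IsComplexJacobiField g γ Y ↔
          ∀ z₀ : ℂ, AntiKaehler.IsJacobiField g (fun u : ℝ => γ (u * z₀))
            (fun u : ℝ => (Y (u * z₀)).re))) ∧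
    (∀ z₀ : ℂ, z₀ ≠ 0 →
      (AntiKaehler.IsComplexConjugateRadius g γ z₀ ↔
        AntiKaehler.IsConjugateAlong g (fun u : ℝ => γ (u * z₀)) 0 1)) := by
  have hol : ∀ z, AntiKaehler.IsHolAt E γ z := hγ.isHolAt hg
  refine ⟨fun z₀ => (hγ.isGeodesic hg z₀).1, fun Y hY => ?_, fun z₀ hz₀ =>
    AntiKaehler.isComplexConjugateRadius_iff hg hol hz₀⟩
  rw [AntiKaehler.isComplexJacobiField_iff hg hol Y hY,
    AntiKaehler.forall_isJacobiField_ray_iff hg hol ((AntiKaehler.isHolomorphicAlong_iff hol Y).1 hY).2]
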